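/- Let $p,q\ge 2$ be integers. For real $\beta,h$ and $N\ge 1$, the $p$-tensor Curie–Weiss Potts model is the probability distribution on $[q]^N$ $$\mathbb P_{\beta,h,N}(\boldsymbol x)=\frac{1}{q^N Z_N(\beta,h)}\exp\Big(\beta N\sum_{r=1}^q \bar x_{\cdot r}^{\,p}+Nh\,\bar x_{\cdot 1}\Big),\qquad \bar x_{\cdot r}=\frac1N\sum_{i=1}^N \mathbf 1_{x_i=r},$$ with $Z_N(\beta,h)$ the normalizing constant. On the set $\mathcal P_q$ of probability vectors put $H_{\beta,h}(\boldsymbol t)=\beta\sum_r t_r^p+ht_1-\sum_r t_r\log t_r$. A point $(\beta,h)$ with $\beta>0$, $h\ge 0$ is called regular if $H_{\beta,h}$ has a unique global maximizer $\boldsymbol m_*=(m_1,\dots,m_q)$ on $\mathcal P_q$ and the quadratic form $\boldsymbol t\mapsto \sum_r\big(\beta p(p-1)m_r^{p-2}-\tfrac1{m_r}\big)t_r^2$ is negative definite on $\{\boldsymbol t\in\mathbb R^q:\sum_r t_r=0\}$. Put $\boldsymbol x_s=\big(\tfrac{1+(q-1)s}{q},\tfrac{1-s}{q},\dots,\tfrac{1-s}{q}\big)$,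 $f_{\beta,h}(s)=H_{\beta,h}(\boldsymbol x_s)$ and $k(x)=\beta x^p-x\log x$. Let $(\beta,h)$ be regular, let $h$ be known, let $\boldsymbol X\sim\mathbb P_{\beta,h,N}$, and let $\hat\beta_N$ be the maximum likelihood estimator of $\beta$, i.e. a maximizer over $b\in\mathbb R$ of $\mathbb P_{b,h,N}(\boldsymbol X)$; at the observations for which no maximizer exists, $\hat\beta_N$ may be any real number. Then, as $N\to\infty$: 1. If $h>0$, then $\boldsymbol m_*\ne\boldsymbol x_0$, $\boldsymbol m_*=\boldsymbol x_s$ for some $s\in(0,1)$, and $$\sqrt N(\hat\beta_N-\beta)\xrightarrow{D}\mathcal N\Big(0,\,-\frac{q^2f_{\beta,h}''(s)}{p^2(q-1)^2}\big(m_1^{p-1}-m_2^{p-1}\big)^{-2}\Big),$$ where the variance is positive. 2. If $h=0$, then $\boldsymbol m_*=\boldsymbol x_0$ and, weakly on the extended real line $[-\infty,\infty]$, $$\sqrt N(\hat\beta_N-\beta)\xrightarrow{D}\gamma_1\delta_{-\infty}+(1-\gamma_1)\delta_{\infty},\qquad \gamma_1:=\mathbb P\Big(\boldsymbol W^\top\boldsymbol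 W\le\frac{1-q}{k''(1/q)}\Big),\quad \boldsymbol W\sim\mathcal N_q(\boldsymbol 0,\Sigma),$$ where $\Sigma=(\Sigma_{ij})$ is the positive semidefinite matrix $\Sigma=\big(-\tfrac{q^2}{q-1}f_{\beta,0}''(0)\big)^{-1}A$ with $A_{11}=q-1$, $A_{1j}=A_{j1}=-1$, $A_{jj}=1+(q-2)\rho$ and $A_{ij}=-\rho$ for distinct $i,j\ge 2$, and $\rho=k''\big(\tfrac{1+(q-1)s}{q}\big)/k''\big(\tfrac{1-s}{q}\big)$ at $s=0$ (so $\rho=1$). -/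

import Mathlib

open Filter MeasureTheory ProbabilityTheory
open scoped ENNReal

noncomputable section

namespace CWPotts

/-! Throughout, `p` is the interaction order and `q` the number of colors. Colors are the elements
of `Fin q`; the distinguished color (color `1` in the usual labelling) is `0 : Fin q`. -/

/-- The magnetization `X̄_{·r} = N⁻¹ ∑ᵢ 𝟙{Xᵢ = r}` of the color `r`. -/
def magnetization {q N : ℕ} (x : Fin N → Fin q) (r : Fin q) : ℝ :=
  (N : ℝ)⁻¹ * ∑ i, if x i = r then 1 else 0

/-- The unnormalized Gibbs weight `exp (β N ∑ᵣ X̄_{·r} ^ p + N h X̄_{·1})`. -/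
def gibbsWeight (p : ℕ) {q N : ℕ} [NeZero q] (β h : ℝ) (x : Fin N → Fin q) : ℝ :=
  Real.exp (β * N * ∑ r, magnetization x r ^ p + N * h * magnetization x 0)

/-- The partition function `Z_N(β, h)`, normalized by `q ^ N`. -/
def partitionFunction (p q N : ℕ) [NeZero q] (β h : ℝ) : ℝ :=
  ((q : ℝ) ^ N)⁻¹ * ∑ x : Fin N → Fin q, gibbsWeight p β h x

/-- The probability mass of the configuration `x` in the `p`-tensor Curie-Weiss Potts model; as a
function of the parameters it is the likelihood. -/
def gibbsProb (p : ℕ) {q N : ℕ} [NeZero q] (β h : ℝ) (x : Fin N → Fin q) : ℝ :=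
  gibbsWeight p β h x / ((q : ℝ) ^ N * partitionFunction p q N β h)

/-- The law `P_{β,h,N}` on `[q]^N` of the `p`-tensor Curie-Weiss Potts model. -/
def pottsMeasure (p q N : ℕ) [NeZero q] (β h : ℝ) : Measure (Fin N → Fin q) :=
  ∑ x : Fin N → Fin q, ENNReal.ofReal (gibbsProb p β h x) • Measure.dirac x

instance isProbabilityMeasure_pottsMeasure (p q N : ℕ) [NeZero q] (β h : ℝ) :
    IsProbabilityMeasure (pottsMeasure p q N β h) := by
  have hq : ((q : ℝ) ^ N) ≠ 0 := pow_ne_zero _ (Nat.cast_ne_zero.mpr (NeZero.ne q))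
  have hw : ∀ x : Fin N → Fin q, 0 < gibbsWeight p β h x := fun x => Real.exp_pos _
  have hS : 0 < ∑ x : Fin N → Fin q, gibbsWeight p β h x :=
    Finset.sum_pos (fun x _ => hw x) ⟨fun _ => 0, Finset.mem_univ _⟩
  have hZ : (q : ℝ) ^ N * partitionFunction p q N β h
      = ∑ x : Fin N → Fin q, gibbsWeight p β h x := by
    rw [partitionFunction, ← mul_assoc, mul_inv_cancel₀ hq, one_mul]
  constructor
  simp only [pottsMeasure, Measure.coe_finsetSum, Finset.sum_apply, Measure.smul_apply,
    measure_univ, smul_eq_mul, mul_one]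
  rw [← ENNReal.ofReal_sum_of_nonneg
    (fun x _ => by rw [gibbsProb, hZ]; exact (div_pos (hw x) hS).le)]
  simp only [gibbsProb, hZ]
  rw [← Finset.sum_div, div_self hS.ne', ENNReal.ofReal_one]

/-- `b` is a marginal maximum likelihood estimate of `β` from the observation `x`, the parameter
`h` being known: it maximizes the likelihood `b ↦ P_{b,h,N}(x)` over the real line. -/
def IsMLEBeta (p : ℕ) {q N : ℕ} [NeZero q] (h : ℝ) (x : Fin N → Fin q) (b : ℝ) : Prop :=
  ∀ b' : ℝ, gibbsProb p b' h x ≤ gibbsProb p b h x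

/-- `βhat N` is a maximum likelihood estimator of `β` (for known `h`): its value is a maximizer of
the likelihood at every observation for which the likelihood has a maximizer on the real line.
(For `N ≥ 2` the exceptional observations are those where `∑ᵣ X̄_{·r} ^ p` takes its smallest or its largest
possible value; there the value of the estimator is arbitrary.) -/
def IsMLEstimatorBeta (p q : ℕ) [NeZero q] (h : ℝ)
    (βhat : (N : ℕ) → (Fin N → Fin q) → ℝ) : Prop :=
  ∀ (N : ℕ) (x : Fin N → Fin q), (∃ b, IsMLEBeta p h x b) → IsMLEBeta p h x (βhat N x)

/-- The negative free energy
`H_{β,h}(t) = β ∑ᵣ tᵣ ^ p + h t₁ - ∑ᵣ tᵣ log tᵣ` (with `0 log 0 = 0`). -/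
def freeEnergy (p : ℕ) {q : ℕ} [NeZero q] (β h : ℝ) (t : Fin q → ℝ) : ℝ :=
  β * ∑ r, t r ^ p + h * t 0 - ∑ r, t r * Real.log (t r)

/-- `m` is a global maximizer of `H_{β,h}` on the probability simplex. -/
def IsGlobalMaximizer (p : ℕ) {q : ℕ} [NeZero q] (β h : ℝ) (m : Fin q → ℝ) : Prop :=
  m ∈ stdSimplex ℝ (Fin q) ∧
    ∀ t ∈ stdSimplex ℝ (Fin q), freeEnergy p β h t ≤ freeEnergy p β h m

/-- The quadratic form `Q_{s,β}(t) = ∑ᵣ (β p (p - 1) sᵣ ^ (p - 2) - 1 / sᵣ) tᵣ²`. -/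
def quadForm (p : ℕ) {q : ℕ} (β : ℝ) (s t : Fin q → ℝ) : ℝ :=
  ∑ r, (β * p * (p - 1) * s r ^ (p - 2) - 1 / s r) * t r ^ 2

/-- The point `(β, h)` of the parameter space `(0, ∞) × [0, ∞)` is regular: `H_{β,h}` has a unique
global maximizer, and there the quadratic form is negative definite on the hyperplane of vectors
with coordinate sum zero. -/
def IsRegular (p q : ℕ) [NeZero q] (β h : ℝ) : Prop :=
  0 < β ∧ 0 ≤ h ∧ ∃ m : Fin q → ℝ,
    (∀ m', IsGlobalMaximizer p β h m' ↔ m' = m) ∧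
    ∀ t : Fin q → ℝ, ∑ r, t r = 0 → t ≠ 0 → quadForm p β m t < 0

/-- The vector `x_s = ((1 + (q - 1) s) / q, (1 - s) / q, …, (1 - s) / q)`. -/
def xvec (q : ℕ) [NeZero q] (s : ℝ) (r : Fin q) : ℝ :=
  if r = 0 then (1 + ((q : ℝ) - 1) * s) / q else (1 - s) / q

/-- `f_{β,h}(s) = H_{β,h}(x_s)`. -/
def freeEnergyLine (p q : ℕ) [NeZero q] (β h s : ℝ) : ℝ :=
  freeEnergy p β h (xvec q s)

/-- `k_{β,p}(x) = β x ^ p - x log x`. -/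
def kfun (p : ℕ) (β x : ℝ) : ℝ := β * x ^ p - x * Real.log x

/-- The ratio `k''((1 + (q - 1) s) / q) / k''((1 - s) / q)`. -/
def kratio (p q : ℕ) (β s : ℝ) : ℝ :=
  iteratedDeriv 2 (kfun p β) ((1 + ((q : ℝ) - 1) * s) / q) /
    iteratedDeriv 2 (kfun p β) ((1 - s) / q)

/-- The limiting covariance matrix `Σ` of `√N (X̄_N - x_s)` at a regular point with maximizer
`x_s`. -/
def limitCov (p q : ℕ) [NeZero q] (β h s : ℝ) : Matrix (Fin q) (Fin q) ℝ :=
  (-((q : ℝ) ^ 2 / ((q : ℝ) - 1)) * iteratedDeriv 2 (freeEnergyLine p q β h) s)⁻¹ •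
    Matrix.of fun i j : Fin q =>
      if i = 0 ∧ j = 0 then (q : ℝ) - 1
      else if i = 0 ∨ j = 0 then -1
      else if i = j then 1 + ((q : ℝ) - 2) * kratio p q β s
      else -kratio p q β s

/-- The limiting variance of `√N (β̂_N - β)` at a regular point whose maximizer is `m = x_s`. -/
def limitVarBeta (p : ℕ) {q : ℕ} [NeZero q] (β h s : ℝ) (m : Fin q → ℝ) : ℝ :=
  -((q : ℝ) ^ 2 * iteratedDeriv 2 (freeEnergyLine p q β h) s) /
      ((p : ℝ) ^ 2 * ((q : ℝ) - 1) ^ 2) *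
    ((m 0 ^ (p - 1) - m 1 ^ (p - 1)) ^ 2)⁻¹

/-- `γ₁ = P(Wᵀ W ≤ (1 - q) / k''(1 / q))` for `W ∼ N_q(0, Σ)`, with `Σ` taken at `h = 0` and
`s = 0`. -/
def gammaOne (p q : ℕ) [NeZero q] (β : ℝ) : ℝ≥0∞ :=
  multivariateGaussian 0 (limitCov p q β 0 0)
    {w : EuclideanSpace ℝ (Fin q) |
      ∑ r, w r ^ 2 ≤ (1 - (q : ℝ)) / iteratedDeriv 2 (kfun p β) (1 / (q : ℝ))}

/-- The law `γ₁ δ_{-∞} + (1 - γ₁) δ_{∞}` on the extended real line. -/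
def degenerateLaw (p q : ℕ) [NeZero q] (β : ℝ) : Measure EReal :=
  gammaOne p q β • Measure.dirac ⊥ + (1 - gammaOne p q β) • Measure.dirac ⊤

instance isProbabilityMeasure_degenerateLaw (p q : ℕ) [NeZero q] (β : ℝ) :
    IsProbabilityMeasure (degenerateLaw p q β) := by
  constructor
  have h1 : gammaOne p q β ≤ 1 := prob_le_one
  simp [degenerateLaw, h1]

end CWPotts

end

noncomputable section

namespace CWPotts

open scoped Topology

/-! ### Expectations under the Gibbs measure -/

section GibbsMean

variable {p q N : ℕ} [NeZero q] {β h : ℝ}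
  {E : Type*} [NormedAddCommGroup E] [NormedSpace ℝ E]

/-! Write S for `powerSum`, w = √N (X̄ - m) for the fluctuations and T = ∑ᵣ mᵣ^p. The reciprocal
likelihood of an observation x is a convex function of b whose derivative has the sign of E_b S -
S(x). Hence, unless S(x) is extremal, the estimator is at most β + t/√N exactly when a_N (S(x) - T)
is at most its mean under β + t/√N, for any scaling a_N > 0. By `tendsto_pottsMeasure_estimator_le`
two limits therefore suffice: the law of a_N (S - T) under β, without atoms, and the mean of a_N (S
- T) under β + t/√N. The same ingredients show that extremal observations have vanishing
probability.

Both limits come from one exact identity, `gibbsMean_exchange`, in place of a Laplace expansion of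
the partition function. Recoloring a single vertex between the colors r and 0 gives E[θ_r g(X̄)] =
E[θ_0 g(X̄ + (e_r - e_0)/N)], where the rate θ_r depends on the proportion of color r only. At the
maximizer all rates have a common value κ, by the critical equations, and √N (θ_r - κ) equals -κ
(k''(m_r) w_r + t p m_r^{p-1}) up to a remainder. Three test functions are used. The choice g = 1
gives the limits of the means of linear functionals of w under the perturbed parameter
(`tendsto_gibbsMean_linear`). The choice g = w bounds E|w|², because the quadratic form is negative
definite, and at the uniform vector it gives the limit of E|w|² (`exists_gibbsMean_sqDev_le`,
`tendsto_gibbsMean_sqDev`). A character of w gives an approximate equation ψ' = -v s ψ for the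
characteristic function, which is the central limit theorem (`tendsto_gibbsMean_devChar`). The
remainder is controlled near m by differentiability of the rates and far from m by exponential
concentration (`tendsto_mul_gibbsMean_far`), which rests on the Gibbs variational bound and on
counting types.

If h > 0, two-color comparisons force m = x_s with m_1 < m_0, so S - T is linear in w to first
order. With a_N = √N its limit law is N(0, 1/V), and its mean under β + t/√N tends to t/V. The
limiting distribution function is P(N(0, 1/V) ≤ t/V) = P(N(0, V) ≤ t).

If h = 0, symmetry and uniqueness force m to be uniform, and the linear term vanishes because ∑ᵣ wᵣ
= 0. With a_N = N the statistic behaves like a positive multiple C|w|², and its mean tends to C (1 -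
q)/k''(1/q) whatever t is. All distribution functions of √N (β̂_N - β) thus converge to the same
constant γ₁, which means that mass γ₁ escapes to -∞ and the remaining mass to +∞. -/

lemma gibbsProb_eq (x : Fin N → Fin q) :
    gibbsProb p β h x = gibbsWeight p β h x / ∑ y : Fin N → Fin q, gibbsWeight p β h y := by
  have hq : ((q : ℝ) ^ N) ≠ 0 := pow_ne_zero _ (Nat.cast_ne_zero.mpr (NeZero.ne q))
  rw [gibbsProb, partitionFunction, ← mul_assoc, mul_inv_cancel₀ hq, one_mul]

lemma gibbsWeight_pos (x : Fin N → Fin q) : 0 < gibbsWeight p β h x := Real.exp_pos _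

lemma sum_gibbsWeight_pos : 0 < ∑ x : Fin N → Fin q, gibbsWeight p β h x :=
  Finset.sum_pos (fun x _ => gibbsWeight_pos x) ⟨fun _ => 0, Finset.mem_univ _⟩

lemma gibbsProb_pos (x : Fin N → Fin q) : 0 < gibbsProb p β h x := by
  rw [gibbsProb_eq]
  exact div_pos (gibbsWeight_pos x) sum_gibbsWeight_pos

lemma sum_gibbsProb : ∑ x : Fin N → Fin q, gibbsProb p β h x = 1 := by
  simp only [gibbsProb_eq]
  rw [← Finset.sum_div, div_self sum_gibbsWeight_pos.ne']

/-- The expectation under `P_{β,h,N}`. -/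
def gibbsMean (p : ℕ) {q N : ℕ} [NeZero q] (β h : ℝ) (f : (Fin N → Fin q) → E) : E :=
  ∑ x, gibbsProb p β h x • f x

lemma integral_pottsMeasure [CompleteSpace E] (f : (Fin N → Fin q) → E) :
    ∫ x, f x ∂pottsMeasure p q N β h = gibbsMean p β h f := by
  rw [pottsMeasure, integral_finsetSum_measure]
  · simp only [gibbsMean]
    refine Finset.sum_congr rfl fun x _ => ?_
    rw [integral_smul_measure, integral_dirac, ENNReal.toReal_ofReal (gibbsProb_pos x).le]
  · exact fun x _ => (integrable_dirac (by simp [enorm_lt_top])).smul_measure ENNReal.ofReal_ne_top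

lemma gibbsMean_add (f g : (Fin N → Fin q) → E) :
    gibbsMean p β h (fun x => f x + g x) = gibbsMean p β h f + gibbsMean p β h g := by
  simp [gibbsMean, Finset.sum_add_distrib]

lemma gibbsMean_sub (f g : (Fin N → Fin q) → E) :
    gibbsMean p β h (fun x => f x - g x) = gibbsMean p β h f - gibbsMean p β h g := by
  simp [gibbsMean, smul_sub]

lemma gibbsMean_const_mul {𝕜 : Type*} [RCLike 𝕜] (c : 𝕜) (f : (Fin N → Fin q) → 𝕜) :
    gibbsMean p β h (fun x => c * f x) = c * gibbsMean p β h f := by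
  simp [gibbsMean, Finset.mul_sum]

lemma gibbsMean_const (c : E) : gibbsMean p β h (fun _ : Fin N → Fin q => c) = c := by
  rw [gibbsMean, ← Finset.sum_smul, sum_gibbsProb, one_smul]

lemma gibbsMean_sum {ι : Type*} (s : Finset ι) (f : ι → (Fin N → Fin q) → E) :
    gibbsMean p β h (fun x => ∑ i ∈ s, f i x) = ∑ i ∈ s, gibbsMean p β h (f i) := by
  simp only [gibbsMean, Finset.smul_sum]
  rw [Finset.sum_comm]

lemma gibbsMean_mono {f g : (Fin N → Fin q) → ℝ} (hfg : ∀ x, f x ≤ g x) :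
    gibbsMean p β h f ≤ gibbsMean p β h g :=
  Finset.sum_le_sum fun x _ => mul_le_mul_of_nonneg_left (hfg x) (gibbsProb_pos x).le

lemma gibbsMean_nonneg {f : (Fin N → Fin q) → ℝ} (hf : ∀ x, 0 ≤ f x) :
    0 ≤ gibbsMean p β h f :=
  Finset.sum_nonneg fun x _ => mul_nonneg (gibbsProb_pos x).le (hf x)

lemma norm_gibbsMean_le {f : (Fin N → Fin q) → E} {g : (Fin N → Fin q) → ℝ}
    (hfg : ∀ x, ‖f x‖ ≤ g x) : ‖gibbsMean p β h f‖ ≤ gibbsMean p β h g := by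
  refine (norm_sum_le _ _).trans (Finset.sum_le_sum fun x _ => ?_)
  rw [norm_smul, Real.norm_of_nonneg (gibbsProb_pos x).le, smul_eq_mul]
  exact mul_le_mul_of_nonneg_left (hfg x) (gibbsProb_pos x).le

open Classical in
lemma pottsMeasure_real_eq (S : Set (Fin N → Fin q)) :
    (pottsMeasure p q N β h).real S = gibbsMean p β h (fun x => if x ∈ S then (1 : ℝ) else 0) := by
  rw [← integral_pottsMeasure]
  have : (fun x => if x ∈ S then (1 : ℝ) else 0) = S.indicator 1 := by
    ext x; simp [Set.indicator]
  rw [this, integral_indicator_one (Set.toFinite S).measurableSet]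

end GibbsMean

/-! ### The magnetization vector -/

section Magnetization

variable {q N : ℕ}

lemma magnetization_nonneg (x : Fin N → Fin q) (r : Fin q) : 0 ≤ magnetization x r := by
  unfold magnetization
  have : (0 : ℝ) ≤ ∑ i, if x i = r then (1 : ℝ) else 0 :=
    Finset.sum_nonneg fun i _ => by split_ifs <;> norm_num
  positivity

lemma sum_magnetization [NeZero N] (x : Fin N → Fin q) : ∑ r, magnetization x r = 1 := by
  unfold magnetization
  rw [← Finset.mul_sum, Finset.sum_comm]
  have hN : (N : ℝ) ≠ 0 := Nat.cast_ne_zero.mpr (NeZero.ne N)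
  simp [hN]

lemma magnetization_le_one [NeZero N] (x : Fin N → Fin q) (r : Fin q) : magnetization x r ≤ 1 := by
  rw [← sum_magnetization x]
  exact Finset.single_le_sum (f := fun r => magnetization x r)
    (fun s _ => magnetization_nonneg x s) (Finset.mem_univ r)

lemma magnetization_mem_stdSimplex [NeZero N] (x : Fin N → Fin q) :
    magnetization x ∈ stdSimplex ℝ (Fin q) :=
  ⟨magnetization_nonneg x, sum_magnetization x⟩

lemma magnetization_update (x : Fin N → Fin q) (i : Fin N) (r s : Fin q) :
    magnetization (Function.update x i r) s
      = magnetization x s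
        + (N : ℝ)⁻¹ * ((if s = r then 1 else 0) - (if s = x i then 1 else 0)) := by
  unfold magnetization
  rw [← mul_add]
  congr 1
  rw [← Finset.add_sum_erase _ _ (Finset.mem_univ i),
    ← Finset.add_sum_erase _ (fun j => if x j = s then (1 : ℝ) else 0) (Finset.mem_univ i)]
  have : ∑ j ∈ Finset.univ.erase i, (if Function.update x i r j = s then (1 : ℝ) else 0)
      = ∑ j ∈ Finset.univ.erase i, if x j = s then (1 : ℝ) else 0 := by
    refine Finset.sum_congr rfl fun j hj => ?_
    rw [Function.update_of_ne (Finset.ne_of_mem_erase hj)]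
  rw [this, Function.update_self]
  simp only [eq_comm (a := s)]
  ring

/-- Recoloring one vertex, written as a bijection between the configurations in which it has the
color `r` and those in which it has the color `s`. -/
lemma sum_ite_color_eq {M : Type*} [AddCommMonoid M] (i : Fin N) (r s : Fin q)
    (A : (Fin N → Fin q) → M) :
    ∑ x, (if x i = r then A x else 0)
      = ∑ x, (if x i = s then A (Function.update x i r) else 0) := by
  refine Fintype.sum_equiv
    (Equiv.piCongrRight fun j => if j = i then Equiv.swap r s else Equiv.refl _) _ _ fun x => ?_
  by_cases hx : x i = r
  · have : Function.update (Equiv.piCongrRight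
        (fun j => if j = i then Equiv.swap r s else Equiv.refl _) x) i r = x := by
      ext1 j
      by_cases hj : j = i
      · subst hj; simp [hx]
      · simp [hj]
    rw [this]
    simp [hx]
  · have h2 : Equiv.swap r s (x i) ≠ s := by
      intro h3
      apply hx
      rw [← (Equiv.swap r s).injective.eq_iff, h3, Equiv.swap_apply_left]
    simp [hx, h2]

end Magnetization

/-! ### The exchange identity -/

section Exchange

variable {p q N : ℕ} [NeZero q]

/-- `∑_{k<p} y^k (y - z)^{p-1-k} = (y^p - (y - z)^p) / z`, a polynomial in `(y, z)`. -/
def powSlope (p : ℕ) (y z : ℝ) : ℝ := ∑ k ∈ Finset.range p, y ^ k * (y - z) ^ (p - 1 - k)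

lemma powSlope_mul (y z : ℝ) : powSlope p y z * z = y ^ p - (y - z) ^ p := by
  have := (Commute.all y (y - z)).geom_sum₂_mul p
  rwa [sub_sub_cancel] at this

lemma powSlope_zero (y : ℝ) : powSlope p y 0 = p * y ^ (p - 1) := by
  unfold powSlope
  rw [Finset.sum_congr rfl (g := fun _ => y ^ (p - 1))]
  · simp
  · intro k hk
    rw [sub_zero, ← pow_add]
    congr 1
    have := Finset.mem_range.mp hk
    omega

/-- The rate `y exp (-(b p y^{p-1} + h 𝟙_{r=0}))` with which a vertex of color `r` leaves its color,
as a function of the proportion `y` of that color, with its finite-`N` correction; here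
`b = β + t η` and `η = N^{-1/2}`. -/
def exchangeRate (p : ℕ) {q : ℕ} [NeZero q] (β h t : ℝ) (r : Fin q) (y η : ℝ) : ℝ :=
  y * Real.exp (-((β + t * η) * powSlope p y (η ^ 2) + if r = 0 then h else 0))

/-- Detailed balance, exact at finite N. Only the proportions of the colors 0 and r change, by 1/N
each, so the logarithm of the ratio of weights is a difference of two increments N (y^p - (y -
1/N)^p). Each exponential involves only the color that the vertex would leave, which is why the left
side uses the proportion of r after the recoloring. -/
lemma gibbsWeight_update [NeZero N] (b h : ℝ) (x : Fin N → Fin q) (i : Fin N) (r : Fin q)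
    (hx : x i = 0) :
    gibbsWeight p b h (Function.update x i r)
        * Real.exp (-(b * powSlope p (magnetization (Function.update x i r) r) (N : ℝ)⁻¹
          + if r = 0 then h else 0))
      = gibbsWeight p b h x
        * Real.exp (-(b * powSlope p (magnetization x 0) (N : ℝ)⁻¹ + h)) := by
  have hN : (N : ℝ) ≠ 0 := Nat.cast_ne_zero.mpr (NeZero.ne N)
  have key : ∀ y, powSlope p y (N : ℝ)⁻¹ = N * (y ^ p - (y - (N : ℝ)⁻¹) ^ p) := by
    intro y
    rw [← powSlope_mul]
    field_simp
  by_cases hr : r = 0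
  · subst hr
    rw [← hx, Function.update_eq_self]
    simp [hx]
  unfold gibbsWeight
  rw [← Real.exp_add, ← Real.exp_add]
  congr 1
  rw [key, key]
  have hm := magnetization_update x i r
  rw [← Finset.add_sum_erase _ _ (Finset.mem_univ r),
    ← Finset.add_sum_erase _ (fun s => magnetization x s ^ p) (Finset.mem_univ r)]
  have h0 : (0 : Fin q) ∈ Finset.univ.erase r := by simp [Ne.symm hr]
  rw [← Finset.add_sum_erase _ _ h0,
    ← Finset.add_sum_erase _ (fun s => magnetization x s ^ p) h0]
  have hrest : ∑ s ∈ (Finset.univ.erase r).erase 0, magnetization (Function.update x i r) s ^ p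
      = ∑ s ∈ (Finset.univ.erase r).erase 0, magnetization x s ^ p := by
    refine Finset.sum_congr rfl fun s hs => ?_
    have h1 : s ≠ 0 := Finset.ne_of_mem_erase hs
    have h2 : s ≠ r := Finset.ne_of_mem_erase (Finset.mem_of_mem_erase hs)
    rw [hm, hx]
    simp [h1, h2]
  have e0 : magnetization (Function.update x i r) 0 = magnetization x 0 - (N : ℝ)⁻¹ := by
    rw [hm, hx]; simp [Ne.symm hr]; ring
  have er : magnetization (Function.update x i r) r = magnetization x r + (N : ℝ)⁻¹ := by
    rw [hm, hx]; simp [hr]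
  rw [hrest, e0, er, if_neg hr]
  simp only [add_sub_cancel_right]
  field_simp
  ring

/-- Moving one vertex from color `r` to color `0` does not change the Gibbs measure up to the
exchange rates. -/
lemma gibbsMean_exchange [NeZero N] {E : Type*} [NormedAddCommGroup E] [NormedSpace ℝ E]
    (β h t : ℝ) (r : Fin q) (g : (Fin q → ℝ) → E) :
    gibbsMean p (β + t / √N) h (fun x : Fin N → Fin q =>
        exchangeRate p β h t r (magnetization x r) (√N)⁻¹ • g (magnetization x))
      = gibbsMean p (β + t / √N) h (fun x : Fin N → Fin q =>
        exchangeRate p β h t (0 : Fin q) (magnetization x 0) (√N)⁻¹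
          • g (fun s => magnetization x s
            + (N : ℝ)⁻¹ * ((if s = r then 1 else 0) - (if s = (0 : Fin q) then 1 else 0)))) := by
  have hη : ((√N)⁻¹) ^ 2 = (N : ℝ)⁻¹ := by rw [inv_pow, Real.sq_sqrt (Nat.cast_nonneg N)]
  have hb : β + t * (√N)⁻¹ = β + t / √N := by rw [div_eq_mul_inv]
  set b := β + t / √N with hbdef
  simp only [gibbsMean, gibbsProb_eq, exchangeRate, hη, hb, if_true]
  simp only [div_eq_inv_mul, mul_smul, ← Finset.smul_sum]
  congr 1
  -- The prefactor y of the rate is an average over vertices of indicators, so both sides become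
  -- averages over vertices, and the recoloring bijection applies to each vertex separately.
  have expand : ∀ (s : Fin q) (G : (Fin N → Fin q) → E),
      ∑ x, gibbsWeight p b h x • magnetization x s • G x
        = (N : ℝ)⁻¹ • ∑ i, ∑ x, if x i = s then gibbsWeight p b h x • G x else 0 := by
    intro s G
    rw [Finset.sum_comm, Finset.smul_sum]
    refine Finset.sum_congr rfl fun x _ => ?_
    rw [magnetization, smul_comm, mul_smul, Finset.sum_smul]
    congr 1
    refine Finset.sum_congr rfl fun i _ => ?_
    split_ifs <;> simp
  rw [expand, expand]
  congr 1
  refine Finset.sum_congr rfl fun i _ => ?_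
  rw [sum_ite_color_eq i r 0]
  refine Finset.sum_congr rfl fun x _ => ?_
  by_cases hx : x i = 0
  · have hm : magnetization (Function.update x i r) = fun s => magnetization x s
        + (N : ℝ)⁻¹ * ((if s = r then 1 else 0) - (if s = 0 then 1 else 0)) := by
      ext s; rw [magnetization_update, hx]
    rw [if_pos hx, if_pos hx, ← hm, smul_smul, smul_smul, gibbsWeight_update b h x i r hx]
  · rw [if_neg hx, if_neg hx]

end Exchange

/-! ### Concentration of the magnetization -/

section Concentration

variable {p q : ℕ}

lemma continuous_freeEnergy [NeZero q] (β h : ℝ) :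
    Continuous (freeEnergy p β h : (Fin q → ℝ) → ℝ) := by
  unfold freeEnergy
  have : ∀ r : Fin q, Continuous fun t : Fin q → ℝ => t r * Real.log (t r) := fun r =>
    Real.continuous_mul_log.comp (continuous_apply r)
  fun_prop

lemma sum_comp_eq_magnetization {N : ℕ} [NeZero N] (x : Fin N → Fin q) (f : Fin q → ℝ) :
    ∑ i, f (x i) = N * ∑ r, magnetization x r * f r := by
  have hN : (N : ℝ) ≠ 0 := Nat.cast_ne_zero.mpr (NeZero.ne N)
  simp only [magnetization, mul_assoc, Finset.sum_mul]
  rw [← Finset.mul_sum, mul_inv_cancel_left₀ hN, Finset.sum_comm]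
  simp

lemma sum_prod_eq_one {N : ℕ} {m : Fin q → ℝ} (hm : ∑ r, m r = 1) :
    ∑ x : Fin N → Fin q, ∏ i, m (x i) = 1 := by
  rw [← Fintype.sum_pow, hm, one_pow]

/-- The mean of X̄_{·r} under independent colors of law m. The indicator is absorbed into the factor
of its vertex, so that the sum over configurations still factorizes. -/
lemma sum_prod_mul_magnetization {N : ℕ} [NeZero N] {m : Fin q → ℝ} (hm : ∑ r, m r = 1)
    (r : Fin q) : ∑ x : Fin N → Fin q, (∏ i, m (x i)) * magnetization x r = m r := by
  have hN : (N : ℝ) ≠ 0 := Nat.cast_ne_zero.mpr (NeZero.ne N)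
  have key : ∀ i : Fin N, ∑ x : Fin N → Fin q, (∏ j, m (x j)) * (if x i = r then 1 else 0)
      = m r := by
    intro i
    have h1 : ∀ x : Fin N → Fin q, (∏ j, m (x j)) * (if x i = r then 1 else 0)
        = ∏ j, (if j = i then (if x j = r then m (x j) else 0) else m (x j)) := by
      intro x
      rw [← Finset.mul_prod_erase _ _ (Finset.mem_univ i),
        ← Finset.mul_prod_erase _ (fun j => if j = i then _ else _) (Finset.mem_univ i),
        Finset.prod_congr rfl (g := fun j => m (x j))
          (fun j hj => if_neg (Finset.ne_of_mem_erase hj))]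
      simp only [if_true]
      split_ifs <;> ring
    rw [Finset.sum_congr rfl fun x _ => h1 x,
      ← Fintype.piFinset_univ, ← Finset.prod_univ_sum (fun _ : Fin N => (Finset.univ : Finset (Fin q)))
        (fun j c => if j = i then (if c = r then m c else 0) else m c),
      ← Finset.mul_prod_erase _ _ (Finset.mem_univ i), Finset.prod_eq_one]
    · simp
    · intro j hj
      simp [Finset.ne_of_mem_erase hj, hm]
  simp only [magnetization, ← mul_assoc, mul_comm _ (N : ℝ)⁻¹]
  simp only [mul_assoc, ← Finset.mul_sum]
  rw [Finset.sum_congr rfl fun x _ => Finset.mul_sum _ _ (∏ i, m (x i)), Finset.sum_comm,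
    Finset.sum_congr rfl fun i _ => key i]
  simp [hN]

lemma gibbsWeight_eq_exp [NeZero q] {N : ℕ} (β h : ℝ) (x : Fin N → Fin q) :
    gibbsWeight p β h x
      = Real.exp (N * (freeEnergy p β h (magnetization x)
          + ∑ r, magnetization x r * Real.log (magnetization x r))) := by
  unfold gibbsWeight freeEnergy
  congr 1
  ring

/-- The Gibbs variational lower bound on the partition function, with the product measure of
marginal `m` as trial measure. -/
lemma exp_freeEnergy_le_sum_gibbsWeight [NeZero q] {N : ℕ} [NeZero N] {β h : ℝ} (hβ : 0 ≤ β)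
    {m : Fin q → ℝ} (hm : ∑ r, m r = 1) (hpos : ∀ r, 0 < m r) :
    Real.exp (N * freeEnergy p β h m) ≤ ∑ x : Fin N → Fin q, gibbsWeight p β h x := by
  set ν : (Fin N → Fin q) → ℝ := fun x => ∏ i, m (x i) with hν
  have hν0 : ∀ x, 0 < ν x := fun x => Finset.prod_pos fun i _ => hpos _
  have hν1 : ∑ x, ν x = 1 := sum_prod_eq_one hm
  have hνm : ∀ r, ∑ x, ν x * magnetization x r = m r := sum_prod_mul_magnetization hm
  have hlog : ∀ x, Real.log (ν x) = N * ∑ r, magnetization x r * Real.log (m r) := by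
    intro x
    rw [hν, Real.log_prod (fun i _ => (hpos _).ne'),
      sum_comp_eq_magnetization x (fun r => Real.log (m r))]
  -- The logarithm of the density of the Gibbs weight with respect to ν. Jensen's inequality for exp
  -- bounds the total weight below by the exponential of the ν-mean of `e`.
  set e : (Fin N → Fin q) → ℝ := fun x =>
    β * N * ∑ r, magnetization x r ^ p + N * h * magnetization x 0 - Real.log (ν x) with he
  have hw : ∀ x, gibbsWeight p β h x = ν x * Real.exp (e x) := by
    intro x
    rw [he, gibbsWeight, Real.exp_sub, Real.exp_log (hν0 x), mul_div_cancel₀ _ (hν0 x).ne']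
  have hjensen : Real.exp (∑ x, ν x * e x) ≤ ∑ x, ν x * Real.exp (e x) := by
    have := convexOn_exp.map_sum_le (t := Finset.univ) (w := ν) (p := e)
      (fun x _ => (hν0 x).le) hν1 (fun x _ => Set.mem_univ _)
    simpa [smul_eq_mul] using this
  rw [Finset.sum_congr rfl fun x _ => hw x]
  refine le_trans (Real.exp_le_exp.mpr ?_) hjensen
  -- Jensen's inequality again, now for the convex power. It points in the useful direction because
  -- β is nonnegative.
  have hpow : ∀ r, m r ^ p ≤ ∑ x, ν x * magnetization x r ^ p := by
    intro r
    rw [← hνm r]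
    exact Real.pow_arith_mean_le_arith_mean_pow _ _ _ (fun x _ => (hν0 x).le) hν1
      (fun x _ => magnetization_nonneg x r) p
  have h1 : ∑ x, ν x * e x = β * N * ∑ r, ∑ x, ν x * magnetization x r ^ p
      + N * h * ∑ x, ν x * magnetization x 0
      - N * ∑ r, (∑ x, ν x * magnetization x r) * Real.log (m r) := by
    simp only [he, hlog, mul_sub, mul_add, Finset.sum_sub_distrib, Finset.sum_add_distrib]
    congr 1
    · congr 1
      · rw [Finset.sum_comm, Finset.mul_sum]
        refine Finset.sum_congr rfl fun x _ => ?_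
        rw [← Finset.mul_sum]; ring
      · rw [Finset.mul_sum]
        exact Finset.sum_congr rfl fun x _ => by ring
    · simp only [Finset.sum_mul]
      rw [Finset.sum_comm, Finset.mul_sum]
      refine Finset.sum_congr rfl fun x _ => ?_
      simp only [mul_assoc]
      rw [← Finset.mul_sum]; ring
  rw [h1]
  simp only [hνm]
  unfold freeEnergy
  have h2 : ∑ r, m r ^ p ≤ ∑ r, ∑ x, ν x * magnetization x r ^ p :=
    Finset.sum_le_sum fun r _ => hpow r
  have h3 : β * N * ∑ r, m r ^ p ≤ β * N * ∑ r, ∑ x, ν x * magnetization x r ^ p :=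
    mul_le_mul_of_nonneg_left h2 (by positivity)
  linarith

/-- A type is determined by q color counts, each in {0, …, N}. The number of types is thus
polynomial in N and does not matter on the exponential scale. -/
lemma card_image_magnetization_le (N : ℕ) :
    (Finset.univ.image (magnetization : (Fin N → Fin q) → Fin q → ℝ)).card ≤ (N + 1) ^ q := by
  have hsub : Finset.univ.image (magnetization : (Fin N → Fin q) → Fin q → ℝ)
      ⊆ Finset.univ.image (fun (c : Fin q → Fin (N + 1)) r => (N : ℝ)⁻¹ * ((c r : ℕ) : ℝ)) := by
    intro τ hτ
    obtain ⟨x, -, rfl⟩ := Finset.mem_image.mp hτ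
    refine Finset.mem_image.mpr
      ⟨fun r => ⟨(Finset.univ.filter fun i => x i = r).card, ?_⟩, Finset.mem_univ _, ?_⟩
    · exact Nat.lt_succ_of_le ((Finset.card_filter_le _ _).trans (by simp))
    · ext r
      simp [magnetization]
  refine (Finset.card_le_card hsub).trans (Finset.card_image_le.trans ?_)
  simp

/-- The number of configurations of a given type is at most the exponential of its entropy. -/
lemma sum_type_gibbsWeight_le [NeZero q] {N : ℕ} [NeZero N] (β h : ℝ) (y : Fin N → Fin q) :
    ∑ x : Fin N → Fin q with magnetization x = magnetization y, gibbsWeight p β h x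
      ≤ Real.exp (N * freeEnergy p β h (magnetization y)) := by
  set τ := magnetization y with hτ
  have hτ1 : ∑ r, τ r = 1 := sum_magnetization y
  -- Under independent colors of law τ, all configurations of type τ are equally likely. Their total
  -- probability is at most 1, which bounds their number. Colors that occur have positive frequency,
  -- so the logarithms are genuine.
  have hprod : ∀ x : Fin N → Fin q, magnetization x = τ →
      ∏ i, τ (x i) = Real.exp (N * ∑ r, τ r * Real.log (τ r)) := by
    intro x hx
    have hpos : ∀ i, 0 < τ (x i) := by
      intro i
      rw [← hx, magnetization]
      have hN : 0 < (N : ℝ) := Nat.cast_pos.mpr (NeZero.pos N)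
      refine mul_pos (inv_pos.mpr hN) (Finset.sum_pos' (fun j _ => by split_ifs <;> norm_num)
        ⟨i, Finset.mem_univ i, by simp⟩)
    have h1 := sum_comp_eq_magnetization x (fun r => Real.log (τ r))
    rw [hx] at h1
    rw [← h1, Real.exp_sum]
    exact Finset.prod_congr rfl fun i _ => (Real.exp_log (hpos i)).symm
  have hle : ∑ x : Fin N → Fin q with magnetization x = τ,
      Real.exp (N * ∑ r, τ r * Real.log (τ r)) ≤ 1 := by
    rw [← sum_prod_eq_one (N := N) hτ1]
    refine le_trans (Finset.sum_le_sum fun x hx =>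
      (hprod x (Finset.mem_filter.mp hx).2).ge) ?_
    exact Finset.sum_le_sum_of_subset_of_nonneg (Finset.filter_subset _ _)
      fun x _ _ => Finset.prod_nonneg fun i _ => by rw [hτ]; exact magnetization_nonneg y _
  calc ∑ x : Fin N → Fin q with magnetization x = τ, gibbsWeight p β h x
      = ∑ x : Fin N → Fin q with magnetization x = τ,
          Real.exp (N * freeEnergy p β h τ) * Real.exp (N * ∑ r, τ r * Real.log (τ r)) := by
        refine Finset.sum_congr rfl fun x hx => ?_
        rw [gibbsWeight_eq_exp, (Finset.mem_filter.mp hx).2, mul_add, Real.exp_add]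
    _ = Real.exp (N * freeEnergy p β h τ) * ∑ x : Fin N → Fin q with magnetization x = τ,
          Real.exp (N * ∑ r, τ r * Real.log (τ r)) := (Finset.mul_sum _ _ _).symm
    _ ≤ Real.exp (N * freeEnergy p β h τ) * 1 :=
        mul_le_mul_of_nonneg_left hle (Real.exp_pos _).le
    _ = _ := mul_one _

/-- The indicator of the vectors with a coordinate at distance at least `δ` from that of `m`. -/
def farIndicator (m : Fin q → ℝ) (δ : ℝ) (τ : Fin q → ℝ) : ℝ :=
  Set.indicator {τ : Fin q → ℝ | ∃ r, δ ≤ |τ r - m r|} (fun _ => 1) τ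

lemma farIndicator_nonneg (m : Fin q → ℝ) (δ : ℝ) (τ : Fin q → ℝ) : 0 ≤ farIndicator m δ τ :=
  Set.indicator_nonneg (fun _ _ => zero_le_one) τ

lemma farIndicator_of_le {m : Fin q → ℝ} {δ : ℝ} {τ : Fin q → ℝ} (r : Fin q)
    (hr : δ ≤ |τ r - m r|) : farIndicator m δ τ = 1 :=
  Set.indicator_of_mem (show τ ∈ {τ : Fin q → ℝ | ∃ r, δ ≤ |τ r - m r|} from ⟨r, hr⟩) _

/-- Method of types: split the sum by type, bound each far class by exp (N S), and count the types.
-/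
lemma sum_gibbsWeight_far_le [NeZero q] {N : ℕ} [NeZero N] {β h S δ : ℝ} {m : Fin q → ℝ}
    (hS : ∀ τ ∈ stdSimplex ℝ (Fin q), (∃ r, δ ≤ |τ r - m r|) → freeEnergy p β h τ ≤ S) :
    ∑ x : Fin N → Fin q, gibbsWeight p β h x * farIndicator m δ (magnetization x)
      ≤ (N + 1 : ℝ) ^ q * Real.exp (N * S) := by
  rw [← Finset.sum_fiberwise_of_maps_to (g := magnetization)
    (t := Finset.univ.image (magnetization : (Fin N → Fin q) → Fin q → ℝ))
    (fun x hx => Finset.mem_image_of_mem _ hx)]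
  have hb : ∀ τ ∈ Finset.univ.image (magnetization : (Fin N → Fin q) → Fin q → ℝ),
      ∑ x : Fin N → Fin q with magnetization x = τ,
        gibbsWeight p β h x * farIndicator m δ (magnetization x) ≤ Real.exp (N * S) := by
    intro τ hτ
    obtain ⟨y, -, rfl⟩ := Finset.mem_image.mp hτ
    rw [Finset.sum_congr rfl (g := fun x => gibbsWeight p β h x
        * farIndicator m δ (magnetization y))
      (fun x hx => by rw [(Finset.mem_filter.mp hx).2]), ← Finset.sum_mul]
    by_cases hfar : ∃ r, δ ≤ |magnetization y r - m r|
    · have h1 : farIndicator m δ (magnetization y) = 1 :=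
        let ⟨r, hr⟩ := hfar
        farIndicator_of_le r hr
      rw [h1, mul_one]
      refine (sum_type_gibbsWeight_le β h y).trans (Real.exp_le_exp.mpr ?_)
      exact mul_le_mul_of_nonneg_left (hS _ (magnetization_mem_stdSimplex y) hfar)
        (Nat.cast_nonneg N)
    · have h1 : farIndicator m δ (magnetization y) = 0 :=
        Set.indicator_of_notMem
          (show magnetization y ∉ {τ : Fin q → ℝ | ∃ r, δ ≤ |τ r - m r|} from hfar) _
      rw [h1, mul_zero]
      exact (Real.exp_pos _).le
  refine (Finset.sum_le_sum hb).trans ?_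
  rw [Finset.sum_const, nsmul_eq_mul]
  refine mul_le_mul_of_nonneg_right ?_ (Real.exp_pos _).le
  exact_mod_cast card_image_magnetization_le N

/-! ### Local perturbations of β and exponential concentration -/

lemma sum_magnetization_pow_nonneg {N : ℕ} (x : Fin N → Fin q) :
    0 ≤ ∑ r, magnetization x r ^ p :=
  Finset.sum_nonneg fun r _ => pow_nonneg (magnetization_nonneg x r) p

lemma sum_magnetization_pow_le_one {N : ℕ} [NeZero N] (hp : p ≠ 0) (x : Fin N → Fin q) :
    ∑ r, magnetization x r ^ p ≤ 1 := by
  rw [← sum_magnetization x]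
  exact Finset.sum_le_sum fun r _ =>
    pow_le_of_le_one (magnetization_nonneg x r) (magnetization_le_one x r) hp

lemma gibbsWeight_add [NeZero q] (β s h : ℝ) {N : ℕ} (x : Fin N → Fin q) :
    gibbsWeight p (β + s) h x
      = gibbsWeight p β h x * Real.exp (s * N * ∑ r, magnetization x r ^ p) := by
  unfold gibbsWeight
  rw [← Real.exp_add]
  congr 1
  ring

/-- Since ∑ᵣ X̄_{·r}^p lies in [0, 1], the shift of β changes every weight by a factor between exp
(-|t|√N) and exp (|t|√N), and the normalization by no more. This loss is subexponential, so
concentration under β carries over to β + t/√N. -/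
lemma gibbsProb_perturb_le [NeZero q] {N : ℕ} [NeZero N] (hp : p ≠ 0) (β h t : ℝ) (x : Fin N → Fin q) :
    gibbsProb p (β + t / √N) h x ≤ Real.exp (2 * (|t| * √N)) * gibbsProb p β h x := by
  have hbd : ∀ y : Fin N → Fin q, |t / √N * N * ∑ r, magnetization y r ^ p| ≤ |t| * √N := by
    intro y
    have h1 : t / √N * N = t * √N := by
      rw [div_mul_eq_mul_div, mul_div_assoc, Real.div_sqrt]
    rw [h1, abs_mul, abs_mul, abs_of_nonneg (Real.sqrt_nonneg _),
      abs_of_nonneg (sum_magnetization_pow_nonneg y)]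
    exact mul_le_of_le_one_right (by positivity) (sum_magnetization_pow_le_one hp y)
  rw [gibbsProb_eq, gibbsProb_eq, ← mul_div_assoc]
  rw [div_le_div_iff₀ sum_gibbsWeight_pos sum_gibbsWeight_pos]
  have h1 : gibbsWeight p (β + t / √N) h x
      ≤ gibbsWeight p β h x * Real.exp (|t| * √N) := by
    rw [gibbsWeight_add]
    exact mul_le_mul_of_nonneg_left (Real.exp_le_exp.mpr (abs_le.mp (hbd x)).2)
      (gibbsWeight_pos x).le
  have h2 : ∑ y : Fin N → Fin q, gibbsWeight p β h y
      ≤ Real.exp (|t| * √N) * ∑ y : Fin N → Fin q, gibbsWeight p (β + t / √N) h y := by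
    rw [Finset.mul_sum]
    refine Finset.sum_le_sum fun y _ => ?_
    rw [gibbsWeight_add, mul_left_comm, ← Real.exp_add]
    refine le_mul_of_one_le_right (gibbsWeight_pos y).le (Real.one_le_exp ?_)
    linarith [(abs_le.mp (hbd y)).1]
  calc gibbsWeight p (β + t / √N) h x * ∑ y : Fin N → Fin q, gibbsWeight p β h y
      ≤ (gibbsWeight p β h x * Real.exp (|t| * √N))
        * (Real.exp (|t| * √N) * ∑ y : Fin N → Fin q, gibbsWeight p (β + t / √N) h y) :=
        mul_le_mul h1 h2 sum_gibbsWeight_pos.le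
          (mul_nonneg (gibbsWeight_pos x).le (Real.exp_pos _).le)
    _ = _ := by rw [two_mul, Real.exp_add]; ring

/-- The magnetization concentrates exponentially fast at a unique maximizer, also under
perturbations of `β` of order `N^{-1/2}`. -/
theorem tendsto_mul_gibbsMean_far [NeZero q] (hp : p ≠ 0) {β h : ℝ} (hβ : 0 ≤ β) {m : Fin q → ℝ}
    (hm : m ∈ stdSimplex ℝ (Fin q)) (hpos : ∀ r, 0 < m r)
    (huniq : ∀ τ ∈ stdSimplex ℝ (Fin q), τ ≠ m → freeEnergy p β h τ < freeEnergy p β h m)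
    (t : ℝ) {δ : ℝ} (hδ : 0 < δ) :
    Tendsto (fun N : ℕ => N * gibbsMean p (β + t / √N) h
      (fun x : Fin N → Fin q => farIndicator m δ (magnetization x))) atTop (𝓝 0) := by
  -- A strict gap: the far part of the simplex is compact, so the free energy attains its maximum
  -- there, and uniqueness places that maximum below the value at m.
  obtain ⟨S, hSlt, hS⟩ : ∃ S < freeEnergy p β h m, ∀ τ ∈ stdSimplex ℝ (Fin q),
      (∃ r, δ ≤ |τ r - m r|) → freeEnergy p β h τ ≤ S := by
    set K : Set (Fin q → ℝ) := stdSimplex ℝ (Fin q) ∩ {τ | ∃ r, δ ≤ |τ r - m r|} with hK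
    have hKc : IsCompact K := by
      refine (isCompact_stdSimplex ℝ (Fin q)).inter_right ?_
      simp only [Set.ofPred_exists]
      exact isClosed_iUnion_of_finite fun r => isClosed_le (by fun_prop) (by fun_prop)
    rcases K.eq_empty_or_nonempty with hKe | hKn
    · refine ⟨freeEnergy p β h m - 1, by linarith, fun τ hτ hfar => ?_⟩
      have : τ ∈ K := ⟨hτ, hfar⟩
      simp [hKe] at this
    · obtain ⟨τ₀, hτ₀, hmax⟩ := hKc.exists_isMaxOn hKn (continuous_freeEnergy (p := p) β h).continuousOn
      refine ⟨freeEnergy p β h τ₀, huniq τ₀ hτ₀.1 ?_, fun τ hτ hfar => hmax ⟨hτ, hfar⟩⟩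
      rintro rfl
      obtain ⟨r, hr⟩ := hτ₀.2
      simp at hr
      linarith
  set c := freeEnergy p β h m - S with hc
  have hcpos : 0 < c := by linarith
  -- Of the q + 1 powers of N + 1, q count the types and one absorbs the prefactor N. Half of the
  -- exponential rate c is spent on the perturbation of β.
  have hbound : ∀ᶠ N : ℕ in atTop, N * gibbsMean p (β + t / √N) h
      (fun x : Fin N → Fin q => farIndicator m δ (magnetization x))
      ≤ Real.exp (2 * t ^ 2 / c + c / 2) *
        (((N + 1 : ℕ) : ℝ) ^ (q + 1) * Real.exp (-(c / 2) * ((N + 1 : ℕ) : ℝ))) := by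
    filter_upwards [eventually_ge_atTop 1] with N hN
    have : NeZero N := ⟨by omega⟩
    have h1 : gibbsMean p (β + t / √N) h
        (fun x : Fin N → Fin q => farIndicator m δ (magnetization x))
        ≤ Real.exp (2 * (|t| * √N)) * ((N + 1 : ℝ) ^ q * Real.exp (-(N * c))) := by
      have h2 : gibbsMean p (β + t / √N) h
          (fun x : Fin N → Fin q => farIndicator m δ (magnetization x))
          ≤ Real.exp (2 * (|t| * √N)) * gibbsMean p β h
            (fun x : Fin N → Fin q => farIndicator m δ (magnetization x)) := by
        unfold gibbsMean
        rw [Finset.mul_sum]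
        refine Finset.sum_le_sum fun x _ => ?_
        rw [smul_eq_mul, smul_eq_mul, ← mul_assoc]
        exact mul_le_mul_of_nonneg_right (gibbsProb_perturb_le hp β h t x)
          (farIndicator_nonneg _ _ _)
      refine h2.trans (mul_le_mul_of_nonneg_left ?_ (Real.exp_pos _).le)
      unfold gibbsMean
      simp only [gibbsProb_eq, smul_eq_mul, div_mul_eq_mul_div]
      rw [← Finset.sum_div, div_le_iff₀ sum_gibbsWeight_pos]
      refine (sum_gibbsWeight_far_le hS).trans ?_
      have h3 := exp_freeEnergy_le_sum_gibbsWeight (p := p) (N := N) (h := h) hβ hm.2 hpos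
      calc (N + 1 : ℝ) ^ q * Real.exp (N * S)
          = (N + 1 : ℝ) ^ q * Real.exp (-(N * c)) * Real.exp (N * freeEnergy p β h m) := by
            rw [mul_assoc, ← Real.exp_add]
            congr 2
            rw [hc]; ring
        _ ≤ _ := mul_le_mul_of_nonneg_left h3 (by positivity)
    -- Completing the square in √N.
    have h4 : 2 * (|t| * √N) ≤ c / 2 * N + 2 * t ^ 2 / c := by
      have h5 : √(N : ℝ) ^ 2 = N := Real.sq_sqrt (Nat.cast_nonneg N)
      have h6 : c / 2 * N + 2 * t ^ 2 / c - 2 * (|t| * √N) = (c * √N - 2 * |t|) ^ 2 / (2 * c) := by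
        have h7 : (c * √N - 2 * |t|) ^ 2 = c ^ 2 * N - 4 * c * |t| * √N + 4 * t ^ 2 := by
          rw [← sq_abs t]
          linear_combination c ^ 2 * h5
        rw [h7]
        field_simp
        ring
      have : 0 ≤ (c * √N - 2 * |t|) ^ 2 / (2 * c) := by positivity
      linarith
    calc N * gibbsMean p (β + t / √N) h
          (fun x : Fin N → Fin q => farIndicator m δ (magnetization x))
        ≤ (N + 1) * (Real.exp (c / 2 * N + 2 * t ^ 2 / c)
            * ((N + 1 : ℝ) ^ q * Real.exp (-(N * c)))) := by
          refine mul_le_mul (by linarith) (h1.trans ?_) (gibbsMean_nonneg fun x =>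
            farIndicator_nonneg _ _ _) (by positivity)
          exact mul_le_mul_of_nonneg_right (Real.exp_le_exp.mpr h4) (by positivity)
      _ = (N + 1 : ℝ) ^ (q + 1) * (Real.exp (c / 2 * N + 2 * t ^ 2 / c)
            * Real.exp (-(N * c))) := by ring
      _ = _ := by
          rw [← Real.exp_add]
          push_cast
          rw [mul_left_comm, ← Real.exp_add]
          congr 2
          ring
  have hlim : Tendsto (fun N : ℕ => Real.exp (2 * t ^ 2 / c + c / 2) *
        (((N + 1 : ℕ) : ℝ) ^ (q + 1) * Real.exp (-(c / 2) * ((N + 1 : ℕ) : ℝ)))) atTop (𝓝 0) := by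
    have h1 : Tendsto (fun y : ℝ => y ^ (q + 1) * Real.exp (-(c / 2) * y)) atTop (𝓝 0) := by
      have h2 := (Real.tendsto_pow_mul_exp_neg_atTop_nhds_zero (q + 1)).comp
        (tendsto_id.const_mul_atTop (half_pos hcpos))
      have h3 := h2.const_mul ((c / 2) ^ (q + 1))⁻¹
      rw [mul_zero] at h3
      refine h3.congr fun y => ?_
      simp only [Function.comp, id]
      rw [mul_pow, neg_mul]
      field_simp
    have h4 := (h1.comp ((tendsto_natCast_atTop_atTop (R := ℝ)).comp
      (tendsto_add_atTop_nat 1))).const_mul (Real.exp (2 * t ^ 2 / c + c / 2))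
    rw [mul_zero] at h4
    exact h4
  refine squeeze_zero' (Eventually.of_forall fun N => ?_) hbound hlim
  exact mul_nonneg (Nat.cast_nonneg N) (gibbsMean_nonneg fun x => farIndicator_nonneg _ _ _)

end Concentration

/-! ### Maximizers of the free energy -/

section Maximizer

variable {p q : ℕ}

/-- `k''(y) = β p (p - 1) y^{p-2} - 1 / y`. -/
def curvature (p : ℕ) (β y : ℝ) : ℝ := β * p * (p - 1) * y ^ (p - 2) - 1 / y

/-- `k'(y) + 1 = β p y^{p-1} - log y`. -/
def slope (p : ℕ) (β y : ℝ) : ℝ := β * (p * y ^ (p - 1)) - Real.log y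

lemma quadForm_eq (β : ℝ) (s t : Fin q → ℝ) :
    quadForm p β s t = ∑ r, curvature p β (s r) * t r ^ 2 := rfl

lemma hasDerivAt_kfun (β : ℝ) {y : ℝ} (hy : 0 < y) :
    HasDerivAt (kfun p β) (slope p β y - 1) y := by
  have h1 := ((hasDerivAt_pow p y).const_mul β).sub
    ((hasDerivAt_id y).mul (Real.hasDerivAt_log hy.ne'))
  refine h1.congr_deriv ?_
  simp only [slope, id]
  field_simp
  ring

lemma hasDerivAt_slope (hp : 2 ≤ p) (β : ℝ) {y : ℝ} (hy : 0 < y) :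
    HasDerivAt (slope p β) (curvature p β y) y := by
  have h1 := (((hasDerivAt_pow (p - 1) y).const_mul (p : ℝ)).const_mul β).sub
    (Real.hasDerivAt_log hy.ne')
  refine h1.congr_deriv ?_
  simp only [curvature]
  rw [Nat.cast_sub (by omega), Nat.sub_sub]
  push_cast
  field_simp

lemma mul_curvature (hp : 2 ≤ p) (β : ℝ) {y : ℝ} (hy : 0 < y) :
    y * curvature p β y = β * p * (p - 1) * y ^ (p - 1) - 1 := by
  obtain ⟨k, rfl⟩ : ∃ k, p = k + 2 := ⟨p - 2, by omega⟩
  simp only [curvature, show k + 2 - 2 = k from rfl, show k + 2 - 1 = k + 1 from rfl, pow_succ]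
  field_simp

/-- The function y k''(y) is affine in y^{p-1} with positive slope. Consequently k'' changes sign at
most once on (0, ∞), from negative to positive. -/
lemma mul_curvature_lt (hp : 2 ≤ p) {β x y : ℝ} (hβ : 0 < β) (hx : 0 < x) (hxy : x < y) :
    x * curvature p β x < y * curvature p β y := by
  rw [mul_curvature hp β hx, mul_curvature hp β (hx.trans hxy)]
  have h1 : x ^ (p - 1) < y ^ (p - 1) := pow_lt_pow_left₀ hxy hx.le (by omega)
  have h2 : (2 : ℝ) ≤ p := by exact_mod_cast hp
  have h3 : 0 < β * p * (p - 1) := by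
    have : (0 : ℝ) < p - 1 := by linarith
    positivity
  have := mul_lt_mul_of_pos_left h1 h3
  linarith

/-- If k'' were nonpositive at the right end it would be negative on the interior of the interval,
so k' would be strictly decreasing and could not take equal values at both ends. -/
lemma curvature_pos_of_slope_eq (hp : 2 ≤ p) {β x y : ℝ} (hβ : 0 < β) (hx : 0 < x) (hxy : x < y)
    (hs : slope p β x = slope p β y) : 0 < curvature p β y := by
  by_contra! hc
  have hy : 0 < y := hx.trans hxy
  have hanti : StrictAntiOn (slope p β) (Set.Icc x y) := by
    refine strictAntiOn_of_deriv_neg (convex_Icc x y) (fun z hz =>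
      (hasDerivAt_slope hp β (hx.trans_le hz.1)).continuousAt.continuousWithinAt) fun z hz => ?_
    rw [interior_Icc] at hz
    have hz0 : 0 < z := hx.trans hz.1
    rw [(hasDerivAt_slope hp β hz0).deriv]
    have h1 := mul_curvature_lt hp hβ hz0 hz.2
    have h2 : y * curvature p β y ≤ 0 := mul_nonpos_of_nonneg_of_nonpos hy.le hc
    by_contra! h3
    have := mul_nonneg hz0.le h3
    linarith
  have := hanti (Set.left_mem_Icc.mpr hxy.le) (Set.right_mem_Icc.mpr hxy.le) hxy
  linarith

lemma curvature_pos_mono (hp : 2 ≤ p) {β x y : ℝ} (hβ : 0 < β) (hx : 0 < x) (hxy : x ≤ y)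
    (hc : 0 < curvature p β x) : 0 < curvature p β y := by
  rcases hxy.eq_or_lt with rfl | hlt
  · exact hc
  · have h1 := mul_curvature_lt hp hβ hx hlt
    have h2 := mul_pos hx hc
    exact pos_of_mul_pos_right (h2.trans h1) (hx.trans hlt).le

lemma iteratedDeriv_two_kfun (hp : 2 ≤ p) (β : ℝ) {y : ℝ} (hy : 0 < y) :
    iteratedDeriv 2 (kfun p β) y = curvature p β y := by
  rw [iteratedDeriv_succ, iteratedDeriv_one]
  have h1 : deriv (kfun p β) =ᶠ[𝓝 y] fun z => slope p β z - 1 := by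
    filter_upwards [lt_mem_nhds hy] with z hz
    exact (hasDerivAt_kfun β hz).deriv
  rw [h1.deriv_eq, deriv_sub_const, (hasDerivAt_slope hp β hy).deriv]

variable [NeZero q]

/-- The contribution `β y^p + h y 𝟙_{r=0} - y log y` of the color `r` to the free energy. -/
def colorEnergy (p : ℕ) (β h : ℝ) (r : Fin q) (y : ℝ) : ℝ :=
  kfun p β y + (if r = 0 then h else 0) * y

lemma freeEnergy_eq_sum (β h : ℝ) (t : Fin q → ℝ) :
    freeEnergy p β h t = ∑ r, colorEnergy p β h r (t r) := by
  simp only [freeEnergy, colorEnergy, kfun, Finset.sum_add_distrib, Finset.sum_sub_distrib,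
    ite_mul, zero_mul, Finset.sum_ite_eq', Finset.mem_univ, if_true, Finset.mul_sum]
  ring

/-- The data of a regular point: `m` is the unique maximizer, and the quadratic form is negative
definite there. -/
structure IsRegularMaximizer (p : ℕ) (β h : ℝ) (m : Fin q → ℝ) : Prop where
  beta_pos : 0 < β
  mem : m ∈ stdSimplex ℝ (Fin q)
  lt : ∀ τ ∈ stdSimplex ℝ (Fin q), τ ≠ m → freeEnergy p β h τ < freeEnergy p β h m
  neg : ∀ t : Fin q → ℝ, ∑ r, t r = 0 → t ≠ 0 → quadForm p β m t < 0

lemma IsRegular.isRegularMaximizer {β h : ℝ} (hreg : IsRegular p q β h) {m : Fin q → ℝ}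
    (hm : IsGlobalMaximizer p β h m) : IsRegularMaximizer p β h m := by
  obtain ⟨hβ, -, m', huniq, hneg⟩ := hreg
  obtain rfl := (huniq m).mp hm
  refine ⟨hβ, hm.1, fun τ hτ hne => ?_, hneg⟩
  refine lt_of_le_of_ne (hm.2 τ hτ) fun heq => hne ((huniq τ).mp ⟨hτ, fun t ht => ?_⟩)
  rw [heq]
  exact hm.2 t ht

/-! ### Shape of a regular maximizer -/

namespace IsRegularMaximizer

variable {β h : ℝ} {m : Fin q → ℝ}

/-- The free energy is a sum over colors, so redistributing mass between two colors leaves the other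
summands untouched. Positivity, criticality and symmetry of the maximizer are all deduced from such
comparisons. -/
lemma pair_lt (H : IsRegularMaximizer p β h m) {r s : Fin q} (hrs : r ≠ s) {a b : ℝ}
    (ha : 0 ≤ a) (hb : 0 ≤ b) (hab : a + b = m r + m s) (hne : a ≠ m r) :
    colorEnergy p β h r a + colorEnergy p β h s b
      < colorEnergy p β h r (m r) + colorEnergy p β h s (m s) := by
  set τ : Fin q → ℝ := Function.update (Function.update m s b) r a with hτ
  have hτr : τ r = a := by simp [hτ]
  have hτs : τ s = b := by simp [hτ, Ne.symm hrs]
  have hτo : ∀ u ∈ (Finset.univ.erase r).erase s, τ u = m u := by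
    intro u hu
    have h1 : u ≠ s := Finset.ne_of_mem_erase hu
    have h2 : u ≠ r := Finset.ne_of_mem_erase (Finset.mem_of_mem_erase hu)
    simp [hτ, h1, h2]
  have hs : s ∈ Finset.univ.erase r := by simp [Ne.symm hrs]
  have split : ∀ F : Fin q → ℝ,
      ∑ u, F u = F r + (F s + ∑ u ∈ (Finset.univ.erase r).erase s, F u) := by
    intro F
    rw [Finset.add_sum_erase _ F hs, Finset.add_sum_erase _ F (Finset.mem_univ r)]
  have hsum : ∑ u, τ u = 1 := by
    rw [← H.mem.2, split τ, split m, hτr, hτs, Finset.sum_congr rfl hτo]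
    linarith
  have hmem : τ ∈ stdSimplex ℝ (Fin q) := by
    refine ⟨fun u => ?_, hsum⟩
    by_cases h1 : u = r
    · subst h1; rw [hτr]; exact ha
    by_cases h2 : u = s
    · subst h2; rw [hτs]; exact hb
    rw [hτo u (by simp [h1, h2])]
    exact H.mem.1 u
  have hlt := H.lt τ hmem (fun heq => hne (by rw [← hτr, heq]))
  rw [freeEnergy_eq_sum, freeEnergy_eq_sum, split, split (fun u => colorEnergy p β h u (m u)),
    hτr, hτs, Finset.sum_congr rfl fun u hu => by rw [hτo u hu]] at hlt
  linarith

lemma hasDerivAt_colorEnergy (r : Fin q) {y : ℝ} (hy : 0 < y) :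
    HasDerivAt (colorEnergy p β h r) (slope p β y - 1 + if r = 0 then h else 0) y := by
  have := (hasDerivAt_kfun (p := p) β hy).add ((hasDerivAt_id y).const_mul (if r = 0 then h else 0))
  exact this.congr_deriv (by simp)

/-- The entropy has infinite slope at 0. Moving a small mass ε to an empty color gains at least ε
(-log ε + c), with c the field on that color, while the color that gives it up loses only O(ε). -/
lemma pos (hp : 2 ≤ p) (H : IsRegularMaximizer p β h m) (r : Fin q) : 0 < m r := by
  by_contra hr
  have hr0 : m r = 0 := le_antisymm (not_lt.mp hr) (H.mem.1 r)
  obtain ⟨s, hs⟩ : ∃ s, 0 < m s := by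
    by_contra! hall
    have : ∑ u, m u ≤ 0 := Finset.sum_nonpos fun u _ => hall u
    rw [H.mem.2] at this
    linarith
  have hrs : r ≠ s := by rintro rfl; exact hr hs
  set c : ℝ := if r = 0 then h else 0 with hc
  set D := slope p β (m s) - 1 + if s = 0 then h else 0 with hD
  have hd : HasDerivAt (fun ε => colorEnergy p β h s (m s - ε)) (-D) 0 := by
    have h1 : HasDerivAt (colorEnergy p β h s) D (m s - 0) := by
      rw [sub_zero]; exact hasDerivAt_colorEnergy s hs
    have := h1.comp_const_sub (m s) 0
    exact this
  have hlim := hd.tendsto_slope_zero_right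
  have hlog : Tendsto (fun ε : ℝ => -Real.log ε + c) (𝓝[>] 0) atTop :=
    (tendsto_neg_atBot_atTop.comp Real.tendsto_log_nhdsGT_zero).atTop_add tendsto_const_nhds
  have hsum := hlog.atTop_add hlim
  have h1 := hsum.eventually (eventually_ge_atTop 0)
  obtain ⟨ε, hε1, hε2⟩ := (h1.and (Ioo_mem_nhdsGT hs)).exists
  have hpair := H.pair_lt hrs (a := ε) (b := m s - ε) hε2.1.le (by linarith [hε2.2])
    (by rw [hr0]; ring) (by rw [hr0]; exact hε2.1.ne')
  have hε0 : 0 < ε := hε2.1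
  have hk0 : colorEnergy p β h r (m r) = 0 := by
    rw [hr0]; simp [colorEnergy, kfun, show p ≠ 0 by omega]
  have hk : ε * (-Real.log ε + c) ≤ colorEnergy p β h r ε := by
    have : 0 ≤ β * ε ^ p := mul_nonneg H.beta_pos.le (pow_nonneg hε0.le p)
    simp only [colorEnergy, kfun, ← hc]
    linarith
  simp only [zero_add, sub_zero, smul_eq_mul] at hε1
  have h3 : 0 ≤ ε * (-Real.log ε + c + ε⁻¹ * (colorEnergy p β h s (m s - ε)
      - colorEnergy p β h s (m s))) := mul_nonneg hε0.le hε1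
  rw [mul_add, mul_inv_cancel_left₀ hε0.ne'] at h3
  linarith

/-- The Lagrange condition, obtained by differentiating along e_r - e_s. This direction is
admissible on both sides because both coordinates are positive. -/
lemma critical (hp : 2 ≤ p) (H : IsRegularMaximizer p β h m) (r s : Fin q) :
    slope p β (m r) + (if r = 0 then h else 0) = slope p β (m s) + if s = 0 then h else 0 := by
  by_cases hrs : r = s
  · rw [hrs]
  have hr := H.pos hp r
  have hs := H.pos hp s
  have hd1 : HasDerivAt (fun ε => colorEnergy p β h r (m r + ε))
      (slope p β (m r) - 1 + if r = 0 then h else 0) 0 := by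
    have h1 : HasDerivAt (colorEnergy p β h r) (slope p β (m r) - 1 + if r = 0 then h else 0)
        (m r + 0) := by
      rw [add_zero]; exact hasDerivAt_colorEnergy r hr
    exact h1.comp_const_add (m r) 0
  have hd2 : HasDerivAt (fun ε => colorEnergy p β h s (m s - ε))
      (-(slope p β (m s) - 1 + if s = 0 then h else 0)) 0 := by
    have h1 : HasDerivAt (colorEnergy p β h s) (slope p β (m s) - 1 + if s = 0 then h else 0)
        (m s - 0) := by
      rw [sub_zero]; exact hasDerivAt_colorEnergy s hs
    exact h1.comp_const_sub (m s) 0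
  have hmax : IsLocalMax (fun ε => colorEnergy p β h r (m r + ε)
      + colorEnergy p β h s (m s - ε)) 0 := by
    filter_upwards [Ioo_mem_nhds (neg_lt_zero.mpr hr) hs] with ε hε
    rcases eq_or_ne ε 0 with rfl | hne
    · exact le_rfl
    · have := H.pair_lt hrs (a := m r + ε) (b := m s - ε) (by linarith [hε.1])
        (by linarith [hε.2]) (by ring) (by simpa using hne)
      simpa using this.le
  have := hmax.hasDerivAt_eq_zero (hd1.add hd2)
  linarith

/-- The quadratic form evaluated at e_r - e_s. -/
lemma curvature_add_neg (H : IsRegularMaximizer p β h m) {r s : Fin q} (hrs : r ≠ s) :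
    curvature p β (m r) + curvature p β (m s) < 0 := by
  have h1 := H.neg (fun u => (if u = r then 1 else 0) - if u = s then 1 else 0)
    (by simp) (fun h0 => by simpa [hrs] using congrFun h0 r)
  rw [quadForm_eq] at h1
  have h2 : ∑ u, curvature p β (m u) * ((if u = r then 1 else 0) - if u = s then (1 : ℝ) else 0) ^ 2
      = ∑ u, ((if u = r then curvature p β (m u) else 0)
        + if u = s then curvature p β (m u) else 0) := by
    refine Finset.sum_congr rfl fun u _ => ?_
    by_cases h3 : u = r
    · subst h3; simp [hrs]
    · by_cases h4 : u = s
      · subst h4; simp [h3]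
      · simp [h3, h4]
  rw [h2, Finset.sum_add_distrib] at h1
  simpa using h1

/-- Without a field, exchanging two coordinates preserves the free energy, so unequal coordinates
would produce a second maximizer. -/
lemma eq_xvec_zero (H : IsRegularMaximizer p β 0 m) : m = xvec q 0 := by
  have heq : ∀ r s, m r = m s := by
    intro r s
    by_contra hne
    have hrs : r ≠ s := fun h0 => hne (by rw [h0])
    have := H.pair_lt hrs (H.mem.1 s) (H.mem.1 r) (add_comm _ _) (Ne.symm hne)
    simp only [colorEnergy, ite_self, zero_mul, add_zero] at this
    linarith
  have hsum : (q : ℝ) * m 0 = 1 := by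
    rw [← H.mem.2, Finset.sum_congr rfl fun r _ => heq r 0]
    simp
  ext r
  rw [heq r 0]
  have hq0 : (q : ℝ) ≠ 0 := Nat.cast_ne_zero.mpr (NeZero.ne q)
  simp only [xvec, mul_zero, add_zero, sub_zero, ite_self]
  field_simp
  linarith

/-- Otherwise exchanging the coordinates r and 0 would increase the field term and leave the rest
unchanged. -/
lemma ge_of_field_pos (H : IsRegularMaximizer p β h m) (hh : 0 < h) (r : Fin q) :
    m r ≤ m 0 := by
  by_contra! hlt
  have hr : (0 : Fin q) ≠ r := by rintro rfl; exact lt_irrefl _ hlt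
  have := H.pair_lt hr (H.mem.1 r) (H.mem.1 0) (add_comm _ _) hlt.ne'
  simp only [colorEnergy, if_true, Ne.symm hr, if_false, zero_mul, add_zero] at this
  have h2 := mul_lt_mul_of_pos_left hlt hh
  linarith

/-- If m_r < m_s for two colors without field, the critical equations give equal slopes and hence
k''(m_s) > 0. Since m_s ≤ m_0, also k''(m_0) > 0, which contradicts negativity of the form at e_s -
e_0. -/
lemma eq_of_ne_zero (hp : 2 ≤ p) (H : IsRegularMaximizer p β h m) (hh : 0 < h) {r s : Fin q}
    (hr : r ≠ 0) (hs : s ≠ 0) : m r = m s := by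
  have key : ∀ r s : Fin q, r ≠ 0 → s ≠ 0 → ¬ m r < m s := by
    intro r s hr hs hlt
    have h1 := H.critical hp r s
    simp only [hr, hs, if_false, add_zero] at h1
    have h2 := curvature_pos_of_slope_eq hp H.beta_pos (H.pos hp r) hlt h1
    have h3 := curvature_pos_mono hp H.beta_pos (H.pos hp s) (H.ge_of_field_pos hh s) h2
    have h4 := H.curvature_add_neg hs
    linarith
  exact le_antisymm (not_lt.mp (key s r hs hr)) (not_lt.mp (key r s hr hs))

/-- In the case of equality the slopes would cancel in the critical equation, leaving h = 0. -/
lemma lt_of_field_pos (hp : 2 ≤ p) (H : IsRegularMaximizer p β h m) (hh : 0 < h) {r : Fin q}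
    (hr : r ≠ 0) : m r < m 0 := by
  refine lt_of_le_of_ne (H.ge_of_field_pos hh r) fun heq => ?_
  have h1 := H.critical hp r 0
  simp only [hr, if_false, if_true, heq] at h1
  linarith

lemma exists_eq_xvec (hp : 2 ≤ p) (hq : 2 ≤ q) (H : IsRegularMaximizer p β h m) (hh : 0 < h) :
    ∃ s : ℝ, 0 < s ∧ s < 1 ∧ m = xvec q s := by
  have h10 : (1 : Fin q) ≠ 0 := by
    rw [Ne, Fin.ext_iff, Fin.val_one', Fin.val_zero, Nat.mod_eq_of_lt hq]
    exact one_ne_zero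
  have hq0 : (0 : ℝ) < q := Nat.cast_pos.mpr (by omega)
  have heq : ∀ r : Fin q, r ≠ 0 → m r = m 1 := fun r hr => H.eq_of_ne_zero hp hh hr h10
  have hsum : m 0 + (q - 1) * m 1 = 1 := by
    have h1 := H.mem.2
    rw [← Finset.add_sum_erase _ _ (Finset.mem_univ (0 : Fin q)),
      Finset.sum_congr rfl fun r hr => heq r (Finset.ne_of_mem_erase hr)] at h1
    simpa [Finset.card_erase_of_mem, Nat.cast_sub (show 1 ≤ q by omega)] using h1
  have hlt := H.lt_of_field_pos hp hh h10
  have h1 := H.pos hp 1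
  -- The value of s solves m_1 = (1 - s)/q. It is positive because m_1 < m_0 and the coordinates sum
  -- to 1, and less than 1 because m_1 > 0.
  refine ⟨1 - q * m 1, ?_, ?_, ?_⟩
  · linarith
  · have := mul_pos hq0 h1
    linarith
  · ext r
    unfold xvec
    split_ifs with hr
    · subst hr
      field_simp
      linear_combination (q : ℝ) * hsum
    · rw [heq r hr]
      field_simp
      ring

/-- Negative definiteness is made uniform by compactness of the unit sphere of the hyperplane, then
extended by homogeneity. The sphere is empty when q = 1. -/
lemma exists_quadForm_le (H : IsRegularMaximizer p β h m) :
    ∃ c > 0, ∀ w : Fin q → ℝ, ∑ r, w r = 0 → quadForm p β m w ≤ -c * ∑ r, w r ^ 2 := by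
  set K : Set (Fin q → ℝ) := {w | ∑ r, w r = 0 ∧ ∑ r, w r ^ 2 = 1} with hK
  have hKc : IsCompact K := by
    refine Metric.isCompact_of_isClosed_isBounded ?_ ?_
    · exact (isClosed_eq (by fun_prop) (by fun_prop)).inter (isClosed_eq (by fun_prop) (by fun_prop))
    · refine (Metric.isBounded_closedBall (x := (0 : Fin q → ℝ)) (r := 1)).subset fun w hw => ?_
      rw [mem_closedBall_zero_iff, pi_norm_le_iff_of_nonneg zero_le_one]
      intro r
      rw [Real.norm_eq_abs, ← sq_le_one_iff_abs_le_one, ← hw.2]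
      exact Finset.single_le_sum (f := fun r => w r ^ 2) (fun _ _ => sq_nonneg _)
        (Finset.mem_univ r)
  have hcont : Continuous (quadForm p β m) := by unfold quadForm; fun_prop
  obtain ⟨c, hc, hbd⟩ : ∃ c > 0, ∀ w ∈ K, quadForm p β m w ≤ -c := by
    rcases K.eq_empty_or_nonempty with hKe | hKn
    · exact ⟨1, one_pos, fun w hw => by simp [hKe] at hw⟩
    · obtain ⟨w₀, hw₀, hmax⟩ := hKc.exists_isMaxOn hKn hcont.continuousOn
      refine ⟨-quadForm p β m w₀, ?_, fun w hw => by rw [neg_neg]; exact hmax hw⟩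
      have := H.neg w₀ hw₀.1 (fun h0 => by simpa [h0] using hw₀.2)
      linarith
  refine ⟨c, hc, fun w hw => ?_⟩
  set n := ∑ r, w r ^ 2 with hn
  have hn0 : 0 ≤ n := Finset.sum_nonneg fun r _ => sq_nonneg _
  rcases hn0.eq_or_lt with h0 | hpos
  · have hw0 : w = 0 := by
      ext r
      have := (Finset.sum_eq_zero_iff_of_nonneg (fun r _ => sq_nonneg (w r))).mp h0.symm r
        (Finset.mem_univ r)
      simpa using this
    simp [← h0, hw0, quadForm]
  · have hsq : √n ^ 2 = n := Real.sq_sqrt hn0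
    have h1 := hbd (fun r => (√n)⁻¹ * w r) ⟨by rw [← Finset.mul_sum, hw, mul_zero], by
      simp only [mul_pow]
      rw [← Finset.mul_sum, ← hn, inv_pow, hsq, inv_mul_cancel₀ hpos.ne']⟩
    have h2 : quadForm p β m (fun r => (√n)⁻¹ * w r) = n⁻¹ * quadForm p β m w := by
      unfold quadForm
      rw [Finset.mul_sum]
      refine Finset.sum_congr rfl fun r _ => ?_
      rw [mul_pow, inv_pow, hsq]
      ring
    rw [h2, inv_mul_le_iff₀ hpos] at h1
    linarith

end IsRegularMaximizer

/-! ### The free energy along the line x_s -/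

lemma sum_xvec_comp (hq : 1 ≤ q) (s : ℝ) (F : ℝ → ℝ) :
    ∑ r, F (xvec q s r) = F ((1 + ((q : ℝ) - 1) * s) / q) + (q - 1) * F ((1 - s) / q) := by
  rw [← Finset.add_sum_erase _ _ (Finset.mem_univ (0 : Fin q)),
    Finset.sum_congr rfl (g := fun _ => F ((1 - s) / q))
      (fun r hr => by simp [xvec, Finset.ne_of_mem_erase hr])]
  simp [xvec, Finset.card_erase_of_mem, Nat.cast_sub hq]

lemma iteratedDeriv_two_freeEnergyLine (hp : 2 ≤ p) (hq : 2 ≤ q) (β h : ℝ) {s : ℝ} (hs0 : 0 ≤ s)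
    (hs1 : s < 1) :
    iteratedDeriv 2 (freeEnergyLine p q β h) s
      = ((q : ℝ) - 1) / q ^ 2 * (((q : ℝ) - 1) * curvature p β ((1 + ((q : ℝ) - 1) * s) / q)
        + curvature p β ((1 - s) / q)) := by
  have hq1 : (2 : ℝ) ≤ q := by exact_mod_cast hq
  have hq0 : (0 : ℝ) < q := by linarith
  set a : ℝ → ℝ := fun s => (1 + ((q : ℝ) - 1) * s) / q with ha
  set b : ℝ → ℝ := fun s => (1 - s) / q with hb
  have hf : freeEnergyLine p q β h = fun s => kfun p β (a s) + ((q : ℝ) - 1) * kfun p β (b s)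
      + h * a s := by
    ext s
    rw [freeEnergyLine, freeEnergy_eq_sum]
    simp only [colorEnergy, Finset.sum_add_distrib, ite_mul, zero_mul, Finset.sum_ite_eq',
      Finset.mem_univ, if_true]
    rw [sum_xvec_comp (by omega) s (kfun p β)]
    simp [xvec, ha, hb]
  have hda : ∀ s, HasDerivAt a (((q : ℝ) - 1) / q) s := fun s => by
    simpa using (((hasDerivAt_id s).const_mul ((q : ℝ) - 1)).const_add 1).div_const (q : ℝ)
  have hdb : ∀ s, HasDerivAt b (-1 / q) s := fun s => by
    simpa using ((hasDerivAt_id s).const_sub 1).div_const (q : ℝ)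
  have hapos : 0 < a s := by
    have : 0 ≤ ((q : ℝ) - 1) * s := mul_nonneg (by linarith) hs0
    simp only [ha]; positivity
  have hbpos : 0 < b s := div_pos (by linarith) hq0
  have hev : ∀ᶠ s' in 𝓝 s, 0 < a s' ∧ 0 < b s' :=
    ((hda s).continuousAt.eventually (lt_mem_nhds hapos)).and
      ((hdb s).continuousAt.eventually (lt_mem_nhds hbpos))
  rw [iteratedDeriv_succ, iteratedDeriv_one]
  have h1 : deriv (freeEnergyLine p q β h) =ᶠ[𝓝 s] fun s' =>
      (slope p β (a s') - 1) * (((q : ℝ) - 1) / q)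
        + ((q : ℝ) - 1) * ((slope p β (b s') - 1) * (-1 / q)) + h * (((q : ℝ) - 1) / q) := by
    filter_upwards [hev] with s' hs'
    rw [hf]
    exact ((((hasDerivAt_kfun β hs'.1).comp s' (hda s')).add
      (((hasDerivAt_kfun β hs'.2).comp s' (hdb s')).const_mul _)).add
      ((hda s').const_mul h)).deriv
  rw [h1.deriv_eq]
  have h2 := ((((((hasDerivAt_slope hp β hapos).comp s (hda s)).sub_const 1).mul_const
    (((q : ℝ) - 1) / q)).add (((((hasDerivAt_slope hp β hbpos).comp s (hdb s)).sub_const 1).mul_const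
      (-1 / (q : ℝ))).const_mul ((q : ℝ) - 1))).add_const (h * (((q : ℝ) - 1) / q))).deriv
  refine h2.trans ?_
  simp only [ha, hb]
  field_simp

end Maximizer

/-! ### Expansion of the exchange rates and moments of the fluctuations -/

section Moments

variable {p q : ℕ}

/-- The fluctuations `√N (X̄_N - m)`. -/
def scaledDev {N : ℕ} (m : Fin q → ℝ) (x : Fin N → Fin q) (r : Fin q) : ℝ :=
  √N * (magnetization x r - m r)

/-- `∑ᵣ wᵣ²` for the fluctuations `w = √N (X̄_N - m)`. -/
def sqDev {N : ℕ} (m : Fin q → ℝ) (x : Fin N → Fin q) : ℝ := ∑ r, scaledDev m x r ^ 2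

lemma sqDev_nonneg {N : ℕ} (m : Fin q → ℝ) (x : Fin N → Fin q) : 0 ≤ sqDev m x :=
  Finset.sum_nonneg fun _ _ => sq_nonneg _

lemma scaledDev_sq_le {N : ℕ} (m : Fin q → ℝ) (x : Fin N → Fin q) (r : Fin q) :
    scaledDev m x r ^ 2 ≤ sqDev m x :=
  Finset.single_le_sum (f := fun r => scaledDev m x r ^ 2) (fun _ _ => sq_nonneg _)
    (Finset.mem_univ r)

lemma abs_scaledDev_le {N : ℕ} (m : Fin q → ℝ) (x : Fin N → Fin q) (r : Fin q) :
    |scaledDev m x r| ≤ 1 + sqDev m x := by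
  have h1 := scaledDev_sq_le m x r
  have h2 := sq_abs (scaledDev m x r)
  nlinarith [sq_nonneg (|scaledDev m x r| - 1), abs_nonneg (scaledDev m x r)]

lemma sum_scaledDev {N : ℕ} [NeZero N] {m : Fin q → ℝ} (hm : ∑ r, m r = 1) (x : Fin N → Fin q) :
    ∑ r, scaledDev m x r = 0 := by
  simp only [scaledDev]
  rw [← Finset.mul_sum, Finset.sum_sub_distrib, sum_magnetization, hm, sub_self, mul_zero]

lemma abs_magnetization_sub_le_one {N : ℕ} [NeZero N] {m : Fin q → ℝ}
    (hm : m ∈ stdSimplex ℝ (Fin q)) (x : Fin N → Fin q) (r : Fin q) :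
    |magnetization x r - m r| ≤ 1 := by
  have h1 : m r ≤ 1 := by
    rw [← hm.2]
    exact Finset.single_le_sum (f := m) (fun s _ => hm.1 s) (Finset.mem_univ r)
  rw [abs_le]
  constructor <;> linarith [magnetization_nonneg x r, magnetization_le_one x r, hm.1 r]

variable [NeZero q] {β h : ℝ} {m : Fin q → ℝ}

/-- The common value `m_r exp (-(β p m_r^{p-1} + h 𝟙_{r=0}))` of the exchange rates at the
maximizer. -/
def equilibriumRate (p : ℕ) (β h : ℝ) (m : Fin q → ℝ) : ℝ := Real.exp (-(slope p β (m 0) + h))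

lemma equilibriumRate_pos : 0 < equilibriumRate p β h m := Real.exp_pos _

/-- The exponentiated critical equation: at the maximizer every color is left at the same rate κ. -/
lemma IsRegularMaximizer.exp_eq (hp : 2 ≤ p) (H : IsRegularMaximizer p β h m) (r : Fin q) :
    Real.exp (-(β * (p * m r ^ (p - 1)) + if r = 0 then h else 0))
      = equilibriumRate p β h m / m r := by
  have h1 := H.critical hp r 0
  rw [if_pos rfl] at h1
  have h2 := H.pos hp r
  rw [eq_div_iff h2.ne', equilibriumRate, ← h1, slope]
  nth_rewrite 2 [← Real.exp_log h2]
  rw [← Real.exp_add]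
  congr 1
  ring

/-! ### First-order expansion of the exchange rates -/

lemma differentiable_exchangeRate (β h t : ℝ) (r : Fin q) :
    Differentiable ℝ fun z : ℝ × ℝ => exchangeRate p β h t r z.1 z.2 := by
  unfold exchangeRate powSlope
  fun_prop

/-- The logarithmic derivative of y exp (-β p y^{p-1}) is -k''(y), and the value at m_r is κ. This
is how the Hessian of the free energy enters the exchange identity. -/
lemma hasDerivAt_exchangeRate_left (hp : 2 ≤ p) (H : IsRegularMaximizer p β h m) (t : ℝ)
    (r : Fin q) :
    HasDerivAt (fun y => exchangeRate p β h t r y 0)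
      (-(equilibriumRate p β h m * curvature p β (m r))) (m r) := by
  have hpos := H.pos hp r
  have h1 : HasDerivAt (fun y : ℝ => -(β * (p * y ^ (p - 1)) + if r = 0 then h else 0))
      (-(β * (p * (((p - 1 : ℕ) : ℝ) * m r ^ (p - 1 - 1))))) (m r) :=
    ((((hasDerivAt_pow (p - 1) (m r)).const_mul (p : ℝ)).const_mul β).add_const _).neg
  have h2 := (hasDerivAt_id (m r)).mul h1.exp
  have h3 : (fun y => exchangeRate p β h t r y 0) = fun y : ℝ =>
      y * Real.exp (-(β * (p * y ^ (p - 1)) + if r = 0 then h else 0)) := by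
    ext y
    simp [exchangeRate, powSlope_zero]
  rw [h3]
  refine h2.congr_deriv ?_
  rw [H.exp_eq hp]
  simp only [curvature, id]
  rw [Nat.cast_sub (by omega), Nat.sub_sub]
  push_cast
  field_simp
  ring

/-- The finite-N correction enters through η² and does not contribute at first order; only the shift
t η of the parameter does. -/
lemma hasDerivAt_exchangeRate_right (hp : 2 ≤ p) (H : IsRegularMaximizer p β h m) (t : ℝ)
    (r : Fin q) :
    HasDerivAt (fun η => exchangeRate p β h t r (m r) η)
      (-(equilibriumRate p β h m * (t * (p * m r ^ (p - 1))))) 0 := by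
  have hpos := H.pos hp r
  have hP : Differentiable ℝ (fun z => powSlope p (m r) z) := by unfold powSlope; fun_prop
  have h0 : HasDerivAt (fun η : ℝ => powSlope p (m r) (η ^ 2)) 0 0 := by
    have := (hP ((0 : ℝ) ^ 2)).hasDerivAt.comp (0 : ℝ) (hasDerivAt_pow 2 (0 : ℝ))
    exact this.congr_deriv (by simp)
  have h1 : HasDerivAt (fun η : ℝ => β + t * η) t 0 := by
    simpa using ((hasDerivAt_id (0 : ℝ)).const_mul t).const_add β
  have h2 : HasDerivAt (fun η : ℝ => m r * Real.exp (-((β + t * η) * powSlope p (m r) (η ^ 2)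
      + if r = 0 then h else 0)))
      (m r * (Real.exp (-((β + t * 0) * powSlope p (m r) (0 ^ 2) + if r = 0 then h else 0))
        * -(t * powSlope p (m r) (0 ^ 2) + (β + t * 0) * 0))) 0 :=
    (((h1.mul h0).add_const (if r = 0 then h else 0)).neg.exp).const_mul (m r)
  refine h2.congr_deriv ?_
  simp only [mul_zero, add_zero, ne_eq, OfNat.ofNat_ne_zero, not_false_eq_true, zero_pow,
    powSlope_zero]
  rw [H.exp_eq hp]
  field_simp

lemma exchangeRate_maximizer (hp : 2 ≤ p) (H : IsRegularMaximizer p β h m) (t : ℝ) (r : Fin q) :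
    exchangeRate p β h t r (m r) 0 = equilibriumRate p β h m := by
  have hpos := H.pos hp r
  simp only [exchangeRate, mul_zero, add_zero, ne_eq, OfNat.ofNat_ne_zero, not_false_eq_true,
    zero_pow, powSlope_zero]
  rw [H.exp_eq hp]
  field_simp

/-- Fréchet differentiability at (m_r, 0), with the differential identified by its two partial
derivatives. Writing the difference quotient as the polynomial `powSlope` makes the rate smooth
across η = 0. -/
lemma exchangeRate_expansion (hp : 2 ≤ p) (H : IsRegularMaximizer p β h m) (t : ℝ) (r : Fin q)
    {ε : ℝ} (hε : 0 < ε) :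
    ∃ δ > 0, ∀ y η : ℝ, |y - m r| < δ → |η| < δ →
      |exchangeRate p β h t r y η - equilibriumRate p β h m
        + equilibriumRate p β h m * (curvature p β (m r) * (y - m r) + t * (p * m r ^ (p - 1)) * η)|
      ≤ ε * (|y - m r| + |η|) := by
  set κ := equilibriumRate p β h m with hκ
  obtain ⟨L, hL⟩ := differentiable_exchangeRate (p := p) β h t r (m r, 0)
  have hy : HasDerivAt (fun y : ℝ => exchangeRate p β h t r y 0) (L (1, 0)) (m r) :=
    HasFDerivAt.comp_hasDerivAt (l := fun z : ℝ × ℝ => exchangeRate p β h t r z.1 z.2)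
      (f := fun y : ℝ => (y, (0 : ℝ))) (m r) hL
      ((hasDerivAt_id (m r)).prodMk (hasDerivAt_const (m r) (0 : ℝ)))
  have hη : HasDerivAt (fun η : ℝ => exchangeRate p β h t r (m r) η) (L (0, 1)) 0 :=
    HasFDerivAt.comp_hasDerivAt (l := fun z : ℝ × ℝ => exchangeRate p β h t r z.1 z.2)
      (f := fun η : ℝ => (m r, η)) (0 : ℝ) hL
      ((hasDerivAt_const (0 : ℝ) (m r)).prodMk (hasDerivAt_id (0 : ℝ)))
  have hL1 := hy.unique (hasDerivAt_exchangeRate_left hp H t r)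
  have hL2 := hη.unique (hasDerivAt_exchangeRate_right hp H t r)
  have hLv : ∀ a b : ℝ, L (a, b) = -(κ * (curvature p β (m r) * a + t * (p * m r ^ (p - 1)) * b)) := by
    intro a b
    have : ((a, b) : ℝ × ℝ) = a • (1, 0) + b • (0, 1) := by simp
    rw [this, map_add, map_smul, map_smul, hL1, hL2, smul_eq_mul, smul_eq_mul]
    ring
  have ho := hL.isLittleO.def hε
  obtain ⟨δ, hδ, hball⟩ := Metric.eventually_nhds_iff.mp ho
  refine ⟨δ, hδ, fun y η h1 h2 => ?_⟩
  have h3 := @hball (y, η) (by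
    rw [Prod.dist_eq, max_lt_iff, Real.dist_eq, Real.dist_eq, sub_zero]
    exact ⟨h1, h2⟩)
  simp only [Prod.mk_sub_mk, sub_zero, hLv, exchangeRate_maximizer hp H, Real.norm_eq_abs,
    sub_neg_eq_add] at h3
  refine h3.trans (mul_le_mul_of_nonneg_left ?_ hε.le)
  rw [Prod.norm_def, Real.norm_eq_abs, Real.norm_eq_abs]
  exact max_le_add_of_nonneg (abs_nonneg _) (abs_nonneg _)

lemma exists_exchangeRate_le (β h t : ℝ) (r : Fin q) :
    ∃ C, 0 ≤ C ∧ ∀ y ∈ Set.Icc (0 : ℝ) 1, ∀ η ∈ Set.Icc (0 : ℝ) 1,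
      |exchangeRate p β h t r y η| ≤ C := by
  obtain ⟨C, hC⟩ := (isCompact_Icc (a := (0 : ℝ)) (b := 1)).prod (isCompact_Icc (a := (0 : ℝ))
    (b := 1)) |>.exists_bound_of_continuousOn
      (differentiable_exchangeRate (p := p) β h t r).continuous.continuousOn
  refine ⟨C, (norm_nonneg _).trans (hC (0, 0) (by simp)), fun y hy η hη => ?_⟩
  exact hC (y, η) ⟨hy, hη⟩

/-- The exchange rate of the color `r` at the configuration `x`. -/
def rate (p : ℕ) (β h t : ℝ) {N : ℕ} (x : Fin N → Fin q) (r : Fin q) : ℝ :=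
  exchangeRate p β h t r (magnetization x r) (√N)⁻¹

/-- The remainder of the linearization of `√N (θ_r - κ)` in the fluctuations. -/
def rateRemainder (p : ℕ) (β h t : ℝ) (m : Fin q → ℝ) {N : ℕ} (x : Fin N → Fin q) (r : Fin q) : ℝ :=
  √N * (rate p β h t x r - equilibriumRate p β h m) + equilibriumRate p β h m
    * (curvature p β (m r) * scaledDev m x r + t * (p * m r ^ (p - 1)))

lemma inv_sqrt_mem_Icc (N : ℕ) : (√N)⁻¹ ∈ Set.Icc (0 : ℝ) 1 := by
  refine ⟨by positivity, ?_⟩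
  rcases Nat.eq_zero_or_pos N with rfl | hN
  · simp
  · exact inv_le_one_of_one_le₀ (by rw [Real.one_le_sqrt]; exact_mod_cast hN)

lemma exists_rate_le (β h t : ℝ) (r : Fin q) :
    ∃ C, 0 ≤ C ∧ ∀ (N : ℕ) [NeZero N] (x : Fin N → Fin q), |rate p β h t x r| ≤ C := by
  obtain ⟨C, hC0, hC⟩ := exists_exchangeRate_le (p := p) β h t r
  exact ⟨C, hC0, fun N _ x => hC _ ⟨magnetization_nonneg x r, magnetization_le_one x r⟩ _
    (inv_sqrt_mem_Icc N)⟩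

lemma tendsto_inv_sqrt : Tendsto (fun N : ℕ => (√(N : ℝ))⁻¹) atTop (𝓝 0) :=
  (Real.tendsto_sqrt_atTop.comp tendsto_natCast_atTop_atTop).inv_tendsto_atTop

/-- Near m the expansion is multiplied by √N. Away from m the rates are bounded and |w_r| ≤ √N, so
the remainder is at most of order √N. -/
lemma abs_rateRemainder_le (hp : 2 ≤ p) (H : IsRegularMaximizer p β h m) (t : ℝ) (r : Fin q)
    {ε : ℝ} (hε : 0 < ε) :
    ∃ δ > 0, ∃ C, 0 ≤ C ∧ ∀ᶠ N : ℕ in atTop, ∀ x : Fin N → Fin q,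
      |rateRemainder p β h t m x r|
        ≤ ε * (1 + |scaledDev m x r|) + C * √N * farIndicator m δ (magnetization x) := by
  obtain ⟨δ, hδ, hexp⟩ := exchangeRate_expansion hp H t r hε
  obtain ⟨C, hC0, hC⟩ := exists_rate_le (p := p) β h t r
  set κ := equilibriumRate p β h m with hκ
  refine ⟨δ, hδ, C + |κ| + |κ| * (|curvature p β (m r)| + |t * (p * m r ^ (p - 1))|),
    by positivity, ?_⟩
  filter_upwards [eventually_ge_atTop 1, tendsto_inv_sqrt.eventually (gt_mem_nhds hδ)] with N hN hNδ x
  have : NeZero N := ⟨by omega⟩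
  have hs1 : 1 ≤ √(N : ℝ) := by rw [Real.one_le_sqrt]; exact_mod_cast hN
  have hs0 : 0 < √(N : ℝ) := by linarith
  by_cases hy : |magnetization x r - m r| < δ
  · have h1 := hexp (magnetization x r) (√N)⁻¹ hy
      (by rw [abs_of_nonneg (inv_nonneg.mpr hs0.le)]; exact hNδ)
    have h2 : rateRemainder p β h t m x r = √N * (exchangeRate p β h t r (magnetization x r) (√N)⁻¹
        - κ + κ * (curvature p β (m r) * (magnetization x r - m r)
          + t * (p * m r ^ (p - 1)) * (√N)⁻¹)) := by
      have h3 : √(N : ℝ) * (√N)⁻¹ = 1 := mul_inv_cancel₀ hs0.ne'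
      simp only [rateRemainder, rate, scaledDev, ← hκ]
      linear_combination -(κ * (t * (p * m r ^ (p - 1)))) * h3
    have h3 : |rateRemainder p β h t m x r| ≤ ε * (1 + |scaledDev m x r|) := by
      rw [h2, abs_mul, abs_of_pos hs0]
      refine (mul_le_mul_of_nonneg_left h1 hs0.le).trans_eq ?_
      rw [scaledDev, abs_mul, abs_of_pos hs0, abs_of_nonneg (inv_nonneg.mpr hs0.le)]
      field_simp
      ring
    have := farIndicator_nonneg m δ (magnetization x)
    have h4 : 0 ≤ (C + |κ| + |κ| * (|curvature p β (m r)| + |t * (p * m r ^ (p - 1))|)) * √N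
      * farIndicator m δ (magnetization x) := by positivity
    linarith
  · rw [farIndicator_of_le r (not_lt.mp hy), mul_one]
    have h1 : |√N * (rate p β h t x r - κ)| ≤ √N * (C + |κ|) := by
      rw [abs_mul, abs_of_pos hs0]
      refine mul_le_mul_of_nonneg_left ?_ hs0.le
      exact (abs_sub _ _).trans (add_le_add (hC N x) le_rfl)
    have h2 : |scaledDev m x r| ≤ √N := by
      rw [scaledDev, abs_mul, abs_of_pos hs0]
      exact mul_le_of_le_one_right hs0.le (abs_magnetization_sub_le_one H.mem x r)
    have h3 : |κ * (curvature p β (m r) * scaledDev m x r + t * (p * m r ^ (p - 1)))|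
        ≤ |κ| * (|curvature p β (m r)| * √N + |t * (p * m r ^ (p - 1))| * √N) := by
      rw [abs_mul]
      refine mul_le_mul_of_nonneg_left ((abs_add_le _ _).trans (add_le_add ?_ ?_)) (abs_nonneg _)
      · rw [abs_mul]
        exact mul_le_mul_of_nonneg_left h2 (abs_nonneg _)
      · exact le_mul_of_one_le_right (abs_nonneg _) hs1
    have h4 : |rateRemainder p β h t m x r| ≤ √N * (C + |κ|)
        + |κ| * (|curvature p β (m r)| * √N + |t * (p * m r ^ (p - 1))| * √N) :=
      (abs_add_le _ _).trans (add_le_add h1 h3)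
    have h5 : 0 ≤ ε * (1 + |scaledDev m x r|) := by positivity
    linarith

/-- The expectation of the remainder, weighted with the fluctuation, is small relative to the
second moment of the fluctuations. -/
lemma gibbsMean_rateRemainder_le (hp : 2 ≤ p) (H : IsRegularMaximizer p β h m) (t : ℝ) (r : Fin q)
    {ε : ℝ} (hε : 0 < ε) :
    ∀ᶠ N : ℕ in atTop, gibbsMean p (β + t / √N) h (fun x : Fin N → Fin q =>
        |rateRemainder p β h t m x r| * (1 + |scaledDev m x r|))
      ≤ ε * (1 + gibbsMean p (β + t / √N) h (fun x : Fin N → Fin q => sqDev m x)) := by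
  obtain ⟨δ, hδ, C, hC0, hC⟩ := abs_rateRemainder_le hp H t r (ε := ε / 4) (by positivity)
  have hfar := (tendsto_mul_gibbsMean_far (by omega) H.beta_pos.le H.mem (H.pos hp) H.lt t
    hδ).const_mul (2 * C)
  rw [mul_zero] at hfar
  filter_upwards [hC, hfar.eventually (gt_mem_nhds (half_pos hε)), eventually_ge_atTop 1]
    with N hN hNfar hN1
  have : NeZero N := ⟨by omega⟩
  have hs1 : 1 ≤ √(N : ℝ) := by rw [Real.one_le_sqrt]; exact_mod_cast hN1
  have hsq : √(N : ℝ) * √N = N := Real.mul_self_sqrt (Nat.cast_nonneg N)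
  -- Near m, (1 + a)² ≤ 2 (1 + a²) turns ε/4 into ε/2. Far from m both factors are of order √N, so
  -- concentration is needed with the prefactor N.
  have hpt : ∀ x : Fin N → Fin q, |rateRemainder p β h t m x r| * (1 + |scaledDev m x r|)
      ≤ ε / 2 * (1 + sqDev m x) + 2 * C * (N * farIndicator m δ (magnetization x)) := by
    intro x
    have h1 := scaledDev_sq_le m x r
    rw [← sq_abs] at h1
    have h2 : |scaledDev m x r| ≤ √N := by
      rw [scaledDev, abs_mul, abs_of_nonneg (Real.sqrt_nonneg _)]
      exact mul_le_of_le_one_right (by positivity) (abs_magnetization_sub_le_one H.mem x r)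
    have h3 := farIndicator_nonneg m δ (magnetization x)
    set a := |scaledDev m x r|
    have ha : 0 ≤ a := abs_nonneg _
    calc |rateRemainder p β h t m x r| * (1 + a)
        ≤ (ε / 4 * (1 + a) + C * √N * farIndicator m δ (magnetization x)) * (1 + a) :=
          mul_le_mul_of_nonneg_right (hN x) (by positivity)
      _ = ε / 4 * (1 + a) ^ 2 + C * farIndicator m δ (magnetization x) * (√N * (1 + a)) := by ring
      _ ≤ ε / 4 * (2 * (1 + sqDev m x))
          + C * farIndicator m δ (magnetization x) * (√N * (2 * √N)) := by
          refine add_le_add (mul_le_mul_of_nonneg_left ?_ (by positivity))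
            (mul_le_mul_of_nonneg_left ?_ (by positivity))
          · nlinarith [sq_nonneg (a - 1)]
          · exact mul_le_mul_of_nonneg_left (by linarith) (by positivity)
      _ = _ := by linear_combination 2 * C * farIndicator m δ (magnetization x) * hsq
  refine (gibbsMean_mono hpt).trans ?_
  rw [gibbsMean_add, gibbsMean_const_mul, gibbsMean_const_mul, gibbsMean_add, gibbsMean_const,
    gibbsMean_const_mul]
  have h0 : 0 ≤ gibbsMean p (β + t / √N) h (fun x : Fin N → Fin q => sqDev m x) :=
    gibbsMean_nonneg fun x => sqDev_nonneg m x
  have := mul_nonneg hε.le h0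
  linarith

/-- The exchange identity tested against the fluctuations themselves. -/
lemma sum_gibbsMean_rate_mul_scaledDev {N : ℕ} [NeZero N] (hm : ∑ r, m r = 1) (t : ℝ) :
    √N * ∑ r, gibbsMean p (β + t / √N) h
        (fun x : Fin N → Fin q => rate p β h t x r * scaledDev m x r)
      = (q - 1) * gibbsMean p (β + t / √N) h (fun x : Fin N → Fin q => rate p β h t x 0) := by
  have hs : √(N : ℝ) ≠ 0 := by
    rw [Real.sqrt_ne_zero (Nat.cast_nonneg N)]
    exact Nat.cast_ne_zero.mpr (NeZero.ne N)
  have hsN : √(N : ℝ) * (√N * (N : ℝ)⁻¹) = 1 := by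
    rw [← mul_assoc, Real.mul_self_sqrt (Nat.cast_nonneg N),
      mul_inv_cancel₀ (Nat.cast_ne_zero.mpr (NeZero.ne N))]
  have h1 : ∀ r, gibbsMean p (β + t / √N) h
        (fun x : Fin N → Fin q => rate p β h t x r * scaledDev m x r)
      = gibbsMean p (β + t / √N) h (fun x : Fin N → Fin q => rate p β h t x 0
        * (scaledDev m x r + √N * (N : ℝ)⁻¹ * (1 - if r = 0 then 1 else 0))) := by
    intro r
    have := gibbsMean_exchange (p := p) (N := N) β h t r (fun τ => √N * (τ r - m r))
    simp only [smul_eq_mul] at this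
    refine this.trans ?_
    congr 1
    ext x
    simp only [rate, scaledDev, if_true]
    ring
  rw [Finset.sum_congr rfl fun r _ => h1 r, ← gibbsMean_sum, ← gibbsMean_const_mul,
    ← gibbsMean_const_mul]
  congr 1
  ext x
  -- Summed over r, the fluctuations cancel, and what remains is one increment for each of the q - 1
  -- colors other than 0.
  rw [← Finset.mul_sum, Finset.sum_add_distrib, sum_scaledDev hm x, ← Finset.mul_sum,
    Finset.sum_sub_distrib]
  simp only [Finset.sum_const, Finset.card_univ, Fintype.card_fin, nsmul_eq_mul, mul_one,
    Finset.sum_ite_eq', Finset.mem_univ, if_true, zero_add]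
  linear_combination (rate p β h t x 0 * ((q : ℝ) - 1)) * hsN

/-- An exact energy identity: multiply the linearized rates by w_r and sum over r. The constant κ
disappears because ∑ᵣ wᵣ = 0, and the exchange identity evaluates the rate term. It serves both to
bound the second moment and, at the uniform vector, to compute its limit. -/
lemma gibbsMean_quadForm {N : ℕ} [NeZero N] (hm : ∑ r, m r = 1) (t : ℝ) :
    equilibriumRate p β h m * gibbsMean p (β + t / √N) h
        (fun x : Fin N → Fin q => quadForm p β m (scaledDev m x))
      = ∑ r, gibbsMean p (β + t / √N) h
          (fun x : Fin N → Fin q => rateRemainder p β h t m x r * scaledDev m x r)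
        - equilibriumRate p β h m * t * p * gibbsMean p (β + t / √N) h
          (fun x : Fin N → Fin q => ∑ r, m r ^ (p - 1) * scaledDev m x r)
        - (q - 1) * gibbsMean p (β + t / √N) h (fun x : Fin N → Fin q => rate p β h t x 0) := by
  rw [← sum_gibbsMean_rate_mul_scaledDev hm t, ← gibbsMean_sum, ← gibbsMean_sum,
    ← gibbsMean_const_mul, ← gibbsMean_const_mul, ← gibbsMean_const_mul, ← gibbsMean_sub,
    ← gibbsMean_sub]
  congr 1
  ext x
  have h0 := sum_scaledDev hm x
  set κ := equilibriumRate p β h m with hκ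
  have h1 : ∑ r, rateRemainder p β h t m x r * scaledDev m x r
      = √N * ∑ r, rate p β h t x r * scaledDev m x r - √N * κ * ∑ r, scaledDev m x r
        + κ * quadForm p β m (scaledDev m x)
        + κ * t * p * ∑ r, m r ^ (p - 1) * scaledDev m x r := by
    simp only [quadForm_eq, Finset.mul_sum, ← Finset.sum_add_distrib, ← Finset.sum_sub_distrib]
    refine Finset.sum_congr rfl fun r _ => ?_
    simp only [rateRemainder]
    ring
  rw [h1, h0]
  ring

/-- With M = E|w|², the left side of the energy identity is at most -κ c M. On the right, the
remainder and the linear term each cost κ c M / 4 plus a constant, and the rate term is bounded, so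
κ c M / 2 is bounded. -/
lemma exists_gibbsMean_sqDev_le (hp : 2 ≤ p) (H : IsRegularMaximizer p β h m) (t : ℝ) :
    ∃ K, 0 ≤ K ∧ ∀ᶠ N : ℕ in atTop,
      gibbsMean p (β + t / √N) h (fun x : Fin N → Fin q => sqDev m x) ≤ K := by
  obtain ⟨c, hc, hquad⟩ := H.exists_quadForm_le
  obtain ⟨C, hC0, hC⟩ := exists_rate_le (p := p) β h t (0 : Fin q)
  set κ := equilibriumRate p β h m with hκ
  have hκ0 : 0 < κ := equilibriumRate_pos
  have hq0 : (0 : ℝ) < q := Nat.cast_pos.mpr (NeZero.pos q)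
  set A := κ * |t| * p with hA
  -- Chosen so that the q remainder terms together cost κ c (1 + M) / 4.
  set ε := κ * c / (4 * q) with hε
  have hε0 : 0 < ε := by positivity
  have hall : ∀ᶠ N : ℕ in atTop, ∀ r : Fin q, gibbsMean p (β + t / √N) h
      (fun x : Fin N → Fin q => |rateRemainder p β h t m x r| * (1 + |scaledDev m x r|))
      ≤ ε * (1 + gibbsMean p (β + t / √N) h (fun x : Fin N → Fin q => sqDev m x)) :=
    eventually_all.mpr fun r => gibbsMean_rateRemainder_le hp H t r hε0
  refine ⟨(κ * c / 2)⁻¹ * (κ * c / 4 + q * (A ^ 2 / (κ * c)) + q * C), by positivity, ?_⟩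
  filter_upwards [hall, eventually_ge_atTop 1] with N hN hN1
  have : NeZero N := ⟨by omega⟩
  set M := gibbsMean p (β + t / √N) h (fun x : Fin N → Fin q => sqDev m x) with hM
  have hid := gibbsMean_quadForm (p := p) (β := β) (h := h) (N := N) H.mem.2 t
  have h1 : gibbsMean p (β + t / √N) h (fun x : Fin N → Fin q => quadForm p β m (scaledDev m x))
      ≤ -c * M := by
    rw [hM, ← gibbsMean_const_mul]
    exact gibbsMean_mono fun x => hquad _ (sum_scaledDev H.mem.2 x)
  have h2 : ∀ r, -(ε * (1 + M)) ≤ gibbsMean p (β + t / √N) h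
      (fun x : Fin N → Fin q => rateRemainder p β h t m x r * scaledDev m x r) := by
    intro r
    have h0 := norm_gibbsMean_le (p := p) (β := β + t / √N) (h := h)
      (f := fun x : Fin N → Fin q => rateRemainder p β h t m x r * scaledDev m x r)
      (g := fun x : Fin N → Fin q => |rateRemainder p β h t m x r| * (1 + |scaledDev m x r|))
      fun x => by
        rw [Real.norm_eq_abs, abs_mul]
        exact mul_le_mul_of_nonneg_left (by linarith) (abs_nonneg _)
    rw [Real.norm_eq_abs] at h0
    exact (abs_le.mp (h0.trans (hN r))).1
  have h3 : -(q * (ε * (1 + M))) ≤ ∑ r, gibbsMean p (β + t / √N) h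
      (fun x : Fin N → Fin q => rateRemainder p β h t m x r * scaledDev m x r) := by
    have := Finset.sum_le_sum fun (r : Fin q) (_ : r ∈ Finset.univ) => h2 r
    simpa using this
  have h4 : κ * t * p * gibbsMean p (β + t / √N) h
      (fun x : Fin N → Fin q => ∑ r, m r ^ (p - 1) * scaledDev m x r)
      ≤ κ * c / 4 * M + q * (A ^ 2 / (κ * c)) := by
    rw [hM, ← gibbsMean_const_mul, ← gibbsMean_const_mul,
      ← gibbsMean_const (p := p) (q := q) (N := N) (β := β + t / √N) (h := h)
        ((q : ℝ) * (A ^ 2 / (κ * c))),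
      ← gibbsMean_add]
    refine gibbsMean_mono fun x => ?_
    have hterm : ∀ r, κ * t * p * (m r ^ (p - 1) * scaledDev m x r)
        ≤ κ * c / 4 * scaledDev m x r ^ 2 + A ^ 2 / (κ * c) := by
      intro r
      have hm1 : m r ≤ 1 := by
        rw [← H.mem.2]
        exact Finset.single_le_sum (f := m) (fun s _ => H.mem.1 s) (Finset.mem_univ r)
      have hmp : m r ^ (p - 1) ≤ 1 := pow_le_one₀ (H.mem.1 r) hm1
      have hmp0 : 0 ≤ m r ^ (p - 1) := pow_nonneg (H.mem.1 r) _
      have e1 : κ * t * p * (m r ^ (p - 1) * scaledDev m x r) ≤ A * |scaledDev m x r| := by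
        refine (le_abs_self _).trans ?_
        rw [abs_mul, abs_mul, abs_mul, abs_mul, abs_of_pos hκ0, Nat.abs_cast, abs_of_nonneg hmp0]
        refine mul_le_mul_of_nonneg_left ?_ (by positivity)
        exact mul_le_of_le_one_left (abs_nonneg _) hmp
      -- Completing the square: the linear term costs another quarter of κ c M.
      have e2 : κ * c / 4 * scaledDev m x r ^ 2 + A ^ 2 / (κ * c) - A * |scaledDev m x r|
          = (κ * c * |scaledDev m x r| - 2 * A) ^ 2 / (4 * (κ * c)) := by
        rw [← sq_abs (scaledDev m x r)]
        field_simp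
        ring
      have e3 : 0 ≤ (κ * c * |scaledDev m x r| - 2 * A) ^ 2 / (4 * (κ * c)) := by positivity
      linarith
    rw [Finset.mul_sum]
    refine (Finset.sum_le_sum fun r _ => hterm r).trans_eq ?_
    rw [Finset.sum_add_distrib, ← Finset.mul_sum, sqDev]
    simp
  have h5 : gibbsMean p (β + t / √N) h (fun x : Fin N → Fin q => rate p β h t x 0) ≤ C :=
    (gibbsMean_mono fun x => (le_abs_self _).trans (hC N x)).trans_eq (gibbsMean_const C)
  have h5' : ((q : ℝ) - 1) * gibbsMean p (β + t / √N) h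
      (fun x : Fin N → Fin q => rate p β h t x 0) ≤ q * C := by
    have hq1 : (1 : ℝ) ≤ q := by exact_mod_cast NeZero.one_le
    exact (mul_le_mul_of_nonneg_left h5 (by linarith)).trans
      (mul_le_mul_of_nonneg_right (by linarith) hC0)
  have h6 := mul_le_mul_of_nonneg_left h1 hκ0.le
  have h7 : (q : ℝ) * (ε * (1 + M)) = κ * c / 4 * (1 + M) := by
    rw [hε]; field_simp
  rw [h7] at h3
  rw [← div_eq_inv_mul, le_div_iff₀ (by positivity)]
  linarith

/-- The remainder of the linearization is negligible in mean, also against the fluctuations. -/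
lemma tendsto_gibbsMean_rateRemainder (hp : 2 ≤ p) (H : IsRegularMaximizer p β h m) (t : ℝ)
    (r : Fin q) :
    Tendsto (fun N : ℕ => gibbsMean p (β + t / √N) h (fun x : Fin N → Fin q =>
        |rateRemainder p β h t m x r| * (1 + |scaledDev m x r|))) atTop (𝓝 0) := by
  obtain ⟨K, hK0, hK⟩ := exists_gibbsMean_sqDev_le hp H t
  rw [Metric.tendsto_atTop']
  intro ε hε
  have h1 := gibbsMean_rateRemainder_le hp H t r (ε := ε / (2 * (1 + K))) (by positivity)
  obtain ⟨N₀, hN₀⟩ := eventually_atTop.mp (h1.and hK)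
  refine ⟨N₀, fun N hN => ?_⟩
  obtain ⟨h2, h3⟩ := hN₀ N hN.le
  have h0 : 0 ≤ gibbsMean p (β + t / √N) h (fun x : Fin N → Fin q =>
      |rateRemainder p β h t m x r| * (1 + |scaledDev m x r|)) :=
    gibbsMean_nonneg fun x => by positivity
  rw [Real.dist_eq, sub_zero, abs_of_nonneg h0]
  refine h2.trans_lt ?_
  calc ε / (2 * (1 + K)) * (1 + gibbsMean p (β + t / √N) h (fun x : Fin N → Fin q => sqDev m x))
      ≤ ε / (2 * (1 + K)) * (1 + K) := mul_le_mul_of_nonneg_left (by linarith) (by positivity)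
    _ = ε / 2 := by field_simp
    _ < ε := half_lt_self hε

lemma tendsto_gibbsMean_abs_rateRemainder (hp : 2 ≤ p) (H : IsRegularMaximizer p β h m) (t : ℝ)
    (r : Fin q) :
    Tendsto (fun N : ℕ => gibbsMean p (β + t / √N) h (fun x : Fin N → Fin q =>
        |rateRemainder p β h t m x r|)) atTop (𝓝 0) := by
  refine squeeze_zero (fun N => gibbsMean_nonneg fun x => abs_nonneg _) (fun N => ?_)
    (tendsto_gibbsMean_rateRemainder hp H t r)
  exact gibbsMean_mono fun x => le_mul_of_one_le_right (abs_nonneg _)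
    (by linarith [abs_nonneg (scaledDev m x r)])

/-- By the second-moment bound, √N (θ_r - κ) is bounded in mean; the factor (√N)⁻¹ then gives the
limit. -/
lemma tendsto_gibbsMean_abs_rate_sub (hp : 2 ≤ p) (H : IsRegularMaximizer p β h m) (t : ℝ)
    (r : Fin q) :
    Tendsto (fun N : ℕ => gibbsMean p (β + t / √N) h (fun x : Fin N → Fin q =>
        |rate p β h t x r - equilibriumRate p β h m|)) atTop (𝓝 0) := by
  obtain ⟨K, hK0, hK⟩ := exists_gibbsMean_sqDev_le hp H t
  set κ := equilibriumRate p β h m with hκ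
  set D := |κ| * (|curvature p β (m r)| * (1 + K) + |t * (p * m r ^ (p - 1))|) with hD
  have hlim : Tendsto (fun N : ℕ => (√(N : ℝ))⁻¹ * (gibbsMean p (β + t / √N) h
      (fun x : Fin N → Fin q => |rateRemainder p β h t m x r|) + D)) atTop (𝓝 0) := by
    simpa using tendsto_inv_sqrt.mul ((tendsto_gibbsMean_abs_rateRemainder hp H t r).add_const D)
  refine squeeze_zero' (Eventually.of_forall fun N => gibbsMean_nonneg fun x => abs_nonneg _) ?_ hlim
  filter_upwards [hK, eventually_ge_atTop 1] with N hN hN1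
  have hs0 : 0 < √(N : ℝ) := Real.sqrt_pos.mpr (by exact_mod_cast hN1)
  rw [← div_eq_inv_mul, le_div_iff₀ hs0, mul_comm, ← gibbsMean_const_mul]
  have hpt : ∀ x : Fin N → Fin q, √N * |rate p β h t x r - κ| ≤ |rateRemainder p β h t m x r|
      + |κ| * (|curvature p β (m r)| * (1 + sqDev m x) + |t * (p * m r ^ (p - 1))|) := by
    intro x
    have h1 : √N * (rate p β h t x r - κ) = rateRemainder p β h t m x r
        - κ * (curvature p β (m r) * scaledDev m x r + t * (p * m r ^ (p - 1))) := by
      simp only [rateRemainder]; ring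
    have h2 : √N * |rate p β h t x r - κ| = |√N * (rate p β h t x r - κ)| := by
      rw [abs_mul, abs_of_pos hs0]
    rw [h2, h1]
    refine (abs_sub _ _).trans (add_le_add le_rfl ?_)
    rw [abs_mul]
    refine mul_le_mul_of_nonneg_left ((abs_add_le _ _).trans (add_le_add ?_ le_rfl)) (abs_nonneg _)
    rw [abs_mul]
    exact mul_le_mul_of_nonneg_left (abs_scaledDev_le m x r) (abs_nonneg _)
  refine (gibbsMean_mono hpt).trans ?_
  rw [gibbsMean_add, gibbsMean_const_mul, gibbsMean_add, gibbsMean_const_mul, gibbsMean_add,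
    gibbsMean_const, gibbsMean_const]
  refine add_le_add le_rfl (mul_le_mul_of_nonneg_left (add_le_add (mul_le_mul_of_nonneg_left
    (by linarith) (abs_nonneg _)) le_rfl) (abs_nonneg _))

lemma tendsto_gibbsMean_rate (hp : 2 ≤ p) (H : IsRegularMaximizer p β h m) (t : ℝ)
    (r : Fin q) :
    Tendsto (fun N : ℕ => gibbsMean p (β + t / √N) h (fun x : Fin N → Fin q => rate p β h t x r))
      atTop (𝓝 (equilibriumRate p β h m)) := by
  rw [tendsto_iff_norm_sub_tendsto_zero]
  refine squeeze_zero (fun N => norm_nonneg _) (fun N => ?_)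
    (tendsto_gibbsMean_abs_rate_sub hp H t r)
  have h1 : gibbsMean p (β + t / √N) h (fun x : Fin N → Fin q => rate p β h t x r)
      - equilibriumRate p β h m = gibbsMean p (β + t / √N) h
        (fun x : Fin N → Fin q => rate p β h t x r - equilibriumRate p β h m) := by
    rw [gibbsMean_sub, gibbsMean_const]
  rw [h1]
  exact norm_gibbsMean_le fun x => le_rfl

/-- If the maximizer is the uniform vector, then the limit of the second moment of the fluctuations
is the trace of the limiting covariance. -/
theorem tendsto_gibbsMean_sqDev (hp : 2 ≤ p) (H : IsRegularMaximizer p β h m) (t : ℝ)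
    (hunif : ∀ r, m r = m 0) (hd : curvature p β (m 0) ≠ 0) :
    Tendsto (fun N : ℕ => gibbsMean p (β + t / √N) h (fun x : Fin N → Fin q => sqDev m x)) atTop
      (𝓝 ((1 - q) / curvature p β (m 0))) := by
  set κ := equilibriumRate p β h m with hκ
  have hκ0 : 0 < κ := equilibriumRate_pos
  have hR : Tendsto (fun N : ℕ => ∑ r, gibbsMean p (β + t / √N) h
      (fun x : Fin N → Fin q => rateRemainder p β h t m x r * scaledDev m x r)) atTop (𝓝 0) := by
    rw [show (0 : ℝ) = ∑ r : Fin q, (0 : ℝ) by simp]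
    refine tendsto_finsetSum _ fun r _ => squeeze_zero_norm (fun N => ?_)
      (tendsto_gibbsMean_rateRemainder hp H t r)
    refine norm_gibbsMean_le fun x => ?_
    rw [Real.norm_eq_abs, abs_mul]
    exact mul_le_mul_of_nonneg_left (by linarith) (abs_nonneg _)
  have hlim := (hR.sub ((tendsto_gibbsMean_rate hp H t 0).const_mul ((q : ℝ) - 1))).const_mul
    ((κ * curvature p β (m 0))⁻¹)
  have hval : (κ * curvature p β (m 0))⁻¹ * (0 - ((q : ℝ) - 1) * κ)
      = (1 - q) / curvature p β (m 0) := by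
    field_simp; ring
  rw [hval] at hlim
  refine hlim.congr' ?_
  filter_upwards [eventually_ge_atTop 1] with N hN1
  have : NeZero N := ⟨by omega⟩
  have hid := gibbsMean_quadForm (p := p) (β := β) (h := h) (N := N) H.mem.2 t
  have h1 : (fun x : Fin N → Fin q => quadForm p β m (scaledDev m x))
      = fun x => curvature p β (m 0) * sqDev m x := by
    ext x
    rw [quadForm_eq, sqDev, Finset.mul_sum]
    exact Finset.sum_congr rfl fun r _ => by rw [hunif r]
  -- The coefficients are equal and the fluctuations sum to zero. This is where the dependence on t
  -- disappears.
  have h2 : (fun x : Fin N → Fin q => ∑ r, m r ^ (p - 1) * scaledDev m x r) = fun _ => 0 := by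
    ext x
    rw [Finset.sum_congr rfl (g := fun r => m 0 ^ (p - 1) * scaledDev m x r)
      (fun r _ => by rw [hunif r]), ← Finset.mul_sum, sum_scaledDev H.mem.2, mul_zero]
  rw [h1, h2, gibbsMean_const_mul, gibbsMean_const, mul_zero, sub_zero] at hid
  rw [← hid, ← hκ, ← mul_assoc κ, inv_mul_cancel_left₀ (mul_ne_zero hκ0.ne' hd)]

/-- The limit of the mean fluctuations under the perturbed parameter. -/
theorem tendsto_gibbsMean_linear (hp : 2 ≤ p) (H : IsRegularMaximizer p β h m) (t : ℝ)
    {u : Fin q → ℝ} (hu : ∑ r, u r = 0) :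
    Tendsto (fun N : ℕ => gibbsMean p (β + t / √N) h
        (fun x : Fin N → Fin q => ∑ r, u r * curvature p β (m r) * scaledDev m x r)) atTop
      (𝓝 (-(t * p * ∑ r, u r * m r ^ (p - 1)))) := by
  set κ := equilibriumRate p β h m with hκ
  have hκ0 : 0 < κ := equilibriumRate_pos
  have hR : Tendsto (fun N : ℕ => ∑ r, u r * gibbsMean p (β + t / √N) h
      (fun x : Fin N → Fin q => rateRemainder p β h t m x r)) atTop (𝓝 0) := by
    rw [show (0 : ℝ) = ∑ r : Fin q, u r * (0 : ℝ) by simp]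
    refine tendsto_finsetSum _ fun r _ => Tendsto.const_mul _ (squeeze_zero_norm (fun N => ?_)
      (tendsto_gibbsMean_abs_rateRemainder hp H t r))
    exact norm_gibbsMean_le fun x => le_rfl
  have hlim := (hR.const_mul κ⁻¹).sub_const (t * p * ∑ r, u r * m r ^ (p - 1))
  rw [mul_zero, zero_sub] at hlim
  refine hlim.congr' ?_
  filter_upwards [eventually_ge_atTop 1] with N hN1
  have : NeZero N := ⟨by omega⟩
  -- Testing against the constant 1 shows that all rates have the same mean. The rescaled deviation
  -- of that mean from κ is then common to all colors and drops out against ∑ᵣ uᵣ = 0, so no limit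
  -- for it is needed.
  have h1 : ∀ r, gibbsMean p (β + t / √N) h (fun x : Fin N → Fin q => rate p β h t x r)
      = gibbsMean p (β + t / √N) h (fun x : Fin N → Fin q => rate p β h t x 0) := by
    intro r
    have := gibbsMean_exchange (p := p) (N := N) β h t r (fun _ => (1 : ℝ))
    simpa [rate] using this
  have h2 : ∀ r, gibbsMean p (β + t / √N) h (fun x : Fin N → Fin q => rateRemainder p β h t m x r)
      = √N * (gibbsMean p (β + t / √N) h (fun x : Fin N → Fin q => rate p β h t x 0) - κ)
        + κ * (curvature p β (m r) * gibbsMean p (β + t / √N) h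
          (fun x : Fin N → Fin q => scaledDev m x r) + t * (p * m r ^ (p - 1))) := by
    intro r
    simp only [rateRemainder]
    rw [gibbsMean_add, gibbsMean_const_mul, gibbsMean_sub, gibbsMean_const, h1 r,
      gibbsMean_const_mul, gibbsMean_add, gibbsMean_const, gibbsMean_const_mul]
  have h3 : gibbsMean p (β + t / √N) h
        (fun x : Fin N → Fin q => ∑ r, u r * curvature p β (m r) * scaledDev m x r)
      = ∑ r, u r * curvature p β (m r) * gibbsMean p (β + t / √N) h
        (fun x : Fin N → Fin q => scaledDev m x r) := by
    rw [gibbsMean_sum]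
    exact Finset.sum_congr rfl fun r _ => gibbsMean_const_mul _ _
  rw [h3]
  set B := √N * (gibbsMean p (β + t / √N) h (fun x : Fin N → Fin q => rate p β h t x 0) - κ)
  have h4 : ∑ r, u r * gibbsMean p (β + t / √N) h
        (fun x : Fin N → Fin q => rateRemainder p β h t m x r)
      = (∑ r, u r) * B + κ * ((∑ r, u r * curvature p β (m r) * gibbsMean p (β + t / √N) h
        (fun x : Fin N → Fin q => scaledDev m x r)) + t * p * ∑ r, u r * m r ^ (p - 1)) := by
    simp only [h2, Finset.sum_mul, Finset.mul_sum, ← Finset.sum_add_distrib]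
    exact Finset.sum_congr rfl fun r _ => by ring
  rw [h4, hu, zero_mul, zero_add, inv_mul_cancel_left₀ hκ0.ne', add_sub_cancel_right]

end Moments

/-! ### The central limit theorem for the fluctuations -/

section CharFun

lemma norm_exp_I_mul_sub_one_sub_le (a : ℝ) :
    ‖Complex.exp (Complex.I * a) - 1 - Complex.I * a‖ ≤ 2 * a ^ 2 := by
  have hn : ‖Complex.I * (a : ℂ)‖ = |a| := by simp
  rcases le_or_gt |a| 1 with h1 | h1
  · have := Complex.norm_exp_sub_one_sub_id_le (hn.trans_le h1)
    rw [hn, sq_abs] at this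
    nlinarith [sq_nonneg a]
  · have h2 := norm_sub_le (Complex.exp (Complex.I * a) - 1) (Complex.I * a)
    have h3 := Real.norm_exp_I_mul_ofReal_sub_one_le (x := a)
    rw [hn] at h2
    rw [Real.norm_eq_abs] at h3
    have h4 := sq_abs a
    nlinarith

/-- A function that almost solves the equation `ψ' = -v s ψ` of the Gaussian characteristic
function is close to it. -/
lemma norm_sub_exp_le {ψ ψ' : ℝ → ℂ} {v e : ℝ} (hψ : ∀ s, HasDerivAt ψ (ψ' s) s) (h0 : ψ 0 = 1)
    (he : ∀ s, ‖ψ' s + v * s * ψ s‖ ≤ e * (1 + s ^ 2)) (s : ℝ) :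
    ‖ψ s - Complex.exp (-(v * s ^ 2 / 2))‖
      ≤ e * (1 + s ^ 2) * Real.exp (|v| * s ^ 2) * |s| := by
  have he0 : 0 ≤ e := by
    have := (norm_nonneg _).trans (he 0)
    simpa using this
  -- Integrating factor: the derivative of φ is the error of the equation times the exponential, so
  -- φ stays close to φ 0 = 1 by the mean value inequality.
  set φ : ℝ → ℂ := fun s => ψ s * Complex.exp (v * s ^ 2 / 2) with hφ
  have hE : ∀ s : ℝ, HasDerivAt (fun s : ℝ => Complex.exp (v * s ^ 2 / 2))
      (Complex.exp (v * s ^ 2 / 2) * (v * s)) s := by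
    intro s
    have h1 : HasDerivAt (fun s : ℝ => ((v * s ^ 2 / 2 : ℝ) : ℂ)) ((v * s : ℝ) : ℂ) s := by
      refine HasDerivAt.ofReal_comp ?_
      refine (((hasDerivAt_pow 2 s).const_mul v).div_const 2).congr_deriv ?_
      simp
      ring
    have h2 := h1.cexp
    push_cast at h2
    exact h2
  have hφ' : ∀ s, HasDerivAt φ ((ψ' s + v * s * ψ s) * Complex.exp (v * s ^ 2 / 2)) s := by
    intro s
    refine ((hψ s).mul (hE s)).congr_deriv ?_
    ring
  have hnE : ∀ a : ℝ, ‖Complex.exp ((v : ℂ) * a ^ 2 / 2)‖ = Real.exp (v * a ^ 2 / 2) := by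
    intro a
    rw [show (v : ℂ) * a ^ 2 / 2 = ((v * a ^ 2 / 2 : ℝ) : ℂ) by push_cast; ring,
      Complex.norm_exp_ofReal]
  have hbound : ∀ a ∈ Set.uIcc 0 s, ‖(ψ' a + v * a * ψ a) * Complex.exp ((v : ℂ) * a ^ 2 / 2)‖
      ≤ e * (1 + s ^ 2) * Real.exp (|v| * s ^ 2 / 2) := by
    intro a ha
    have has : a ^ 2 ≤ s ^ 2 := by
      rw [sq_le_sq]
      simpa using Set.abs_sub_left_of_mem_uIcc ha
    rw [norm_mul, hnE]
    refine mul_le_mul ((he a).trans (mul_le_mul_of_nonneg_left (by linarith) he0)) ?_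
      (Real.exp_pos _).le (by positivity)
    refine Real.exp_le_exp.mpr (div_le_div_of_nonneg_right ?_ zero_le_two)
    exact mul_le_mul (le_abs_self v) has (sq_nonneg a) (abs_nonneg v)
  have hmv := Convex.norm_image_sub_le_of_norm_hasDerivWithin_le
    (fun a _ => (hφ' a).hasDerivWithinAt) hbound (convex_uIcc 0 s) Set.left_mem_uIcc
    Set.right_mem_uIcc
  have hφ0 : φ 0 = 1 := by simp [hφ, h0]
  rw [hφ0, sub_zero, Real.norm_eq_abs] at hmv
  have hfac : ψ s - Complex.exp (-(v * s ^ 2 / 2))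
      = (φ s - 1) * Complex.exp (-(v * s ^ 2 / 2)) := by
    simp only [hφ]
    rw [sub_mul, mul_assoc, ← Complex.exp_add, add_neg_cancel, Complex.exp_zero, mul_one, one_mul]
  rw [hfac, norm_mul, show -((v : ℂ) * s ^ 2 / 2) = ((-(v * s ^ 2 / 2) : ℝ) : ℂ) by push_cast; ring,
    Complex.norm_exp_ofReal]
  calc ‖φ s - 1‖ * Real.exp (-(v * s ^ 2 / 2))
      ≤ e * (1 + s ^ 2) * Real.exp (|v| * s ^ 2 / 2) * |s| * Real.exp (|v| * s ^ 2 / 2) := by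
        refine mul_le_mul hmv (Real.exp_le_exp.mpr ?_) (Real.exp_pos _).le (by positivity)
        have := mul_le_mul_of_nonneg_right (neg_abs_le v) (sq_nonneg s)
        linarith
    _ = e * (1 + s ^ 2) * (Real.exp (|v| * s ^ 2 / 2) * Real.exp (|v| * s ^ 2 / 2)) * |s| := by ring
    _ = _ := by rw [← Real.exp_add, add_halves]

variable {p q : ℕ}

/-- The character `exp (i s ∑ᵣ λᵣ wᵣ)` of the fluctuations. -/
def devChar {N : ℕ} (m l : Fin q → ℝ) (s : ℝ) (x : Fin N → Fin q) : ℂ :=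
  Complex.exp (Complex.I * ((s * ∑ r, l r * scaledDev m x r : ℝ) : ℂ))


lemma norm_devChar {N : ℕ} (m l : Fin q → ℝ) (s : ℝ) (x : Fin N → Fin q) :
    ‖devChar m l s x‖ = 1 := Complex.norm_exp_I_mul_ofReal _

variable [NeZero q] {β h : ℝ} {m : Fin q → ℝ}

/-- The exchange identity tested against a character of the fluctuations. -/
lemma gibbsMean_rate_mul_devChar {N : ℕ} [NeZero N] (l : Fin q → ℝ) (s : ℝ) (r : Fin q) :
    gibbsMean p β h (fun x : Fin N → Fin q => (rate p β h 0 x r : ℂ) * devChar m l s x)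
      = gibbsMean p β h (fun x : Fin N → Fin q => (rate p β h 0 x 0 : ℂ) * devChar m l s x
        * Complex.exp (Complex.I * ((s * (l r - l 0) * (√N)⁻¹ : ℝ) : ℂ))) := by
  have hs : √(N : ℝ) * (N : ℝ)⁻¹ = (√N)⁻¹ := by
    have h0 : √(N : ℝ) ≠ 0 := by
      rw [Real.sqrt_ne_zero (Nat.cast_nonneg N)]
      exact Nat.cast_ne_zero.mpr (NeZero.ne N)
    have h1 : √(N : ℝ) * √N = N := Real.mul_self_sqrt (Nat.cast_nonneg N)
    have h2 : (N : ℝ) ≠ 0 := Nat.cast_ne_zero.mpr (NeZero.ne N)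
    field_simp
    linarith
  have := gibbsMean_exchange (p := p) (N := N) β h 0 r (fun τ : Fin q → ℝ =>
    Complex.exp (Complex.I * ((s * ∑ k, l k * (√N * (τ k - m k)) : ℝ) : ℂ)))
  simp only [zero_div, add_zero, Complex.real_smul] at this
  refine this.trans ?_
  congr 1
  ext x
  rw [rate, devChar, mul_assoc, ← Complex.exp_add]
  congr 2
  rw [← mul_add, ← Complex.ofReal_add]
  congr 2
  have h1 : ∀ k, l k * (√(N : ℝ) * (magnetization x k
        + (N : ℝ)⁻¹ * ((if k = r then 1 else 0) - (if k = 0 then 1 else 0)) - m k))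
      = l k * scaledDev m x k + √(N : ℝ) * (N : ℝ)⁻¹ * ((if k = r then l k else 0)
        - if k = 0 then l k else 0) := by
    intro k
    rw [scaledDev]
    split_ifs <;> ring
  rw [Finset.sum_congr rfl fun k _ => h1 k, Finset.sum_add_distrib, ← Finset.mul_sum,
    Finset.sum_sub_distrib, hs]
  simp only [Finset.sum_ite_eq', Finset.mem_univ, if_true]
  ring

/-- The error in the approximate Stein equation for the characters. -/
def steinError (p N : ℕ) (β h : ℝ) (m l u : Fin q → ℝ) : ℝ :=
  (equilibriumRate p β h m)⁻¹ * ∑ r, |u r|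
      * gibbsMean p β h (fun x : Fin N → Fin q => |rateRemainder p β h 0 m x r|)
    + (equilibriumRate p β h m)⁻¹ * (∑ r, |u r| * |l r - l 0|)
      * gibbsMean p β h (fun x : Fin N → Fin q => |rate p β h 0 x 0 - equilibriumRate p β h m|)
    + (∑ r, |u r| * (2 * (l r - l 0) ^ 2)) * (√N)⁻¹

lemma tendsto_steinError (hp : 2 ≤ p) (H : IsRegularMaximizer p β h m) (l u : Fin q → ℝ) :
    Tendsto (fun N => steinError p N β h m l u) atTop (𝓝 0) := by
  have h1 : ∀ r, Tendsto (fun N : ℕ => gibbsMean p β h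
      (fun x : Fin N → Fin q => |rateRemainder p β h 0 m x r|)) atTop (𝓝 0) := fun r => by
    simpa using tendsto_gibbsMean_abs_rateRemainder hp H 0 r
  have h2 : Tendsto (fun N : ℕ => gibbsMean p β h
      (fun x : Fin N → Fin q => |rate p β h 0 x 0 - equilibriumRate p β h m|)) atTop (𝓝 0) := by
    simpa using tendsto_gibbsMean_abs_rate_sub hp H 0 0
  have h3 := (((tendsto_finsetSum Finset.univ fun r _ => (h1 r).const_mul |u r|).const_mul
    (equilibriumRate p β h m)⁻¹).add (h2.const_mul
      ((equilibriumRate p β h m)⁻¹ * (∑ r, |u r| * |l r - l 0|)))).add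
        (tendsto_inv_sqrt.const_mul (∑ r, |u r| * (2 * (l r - l 0) ^ 2)))
  simpa [steinError] using h3

/-- The vector u is the dual of l under the negative Hessian, modulo constants. The u-combination of
the linearized rates, tested against a character, produces the functional l·w on one side. The
exchange identity turns the other side into increments of the character, with leading coefficient i
s (l_r - l_0), and their u-combination is i s u·l. -/
lemma norm_stein_devChar_le {N : ℕ} [NeZero N] (hm : ∑ r, m r = 1) {l u : Fin q → ℝ}
    (hu : ∑ r, u r = 0)
    (hL : ∀ w : Fin q → ℝ, ∑ r, w r = 0 →
      ∑ r, l r * w r = -∑ r, u r * curvature p β (m r) * w r) (s : ℝ) :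
    ‖gibbsMean p β h (fun x : Fin N → Fin q =>
          ((∑ r, l r * scaledDev m x r : ℝ) : ℂ) * devChar m l s x)
        - Complex.I * ((s * ∑ r, u r * l r : ℝ) : ℂ)
          * gibbsMean p β h (fun x : Fin N → Fin q => devChar m l s x)‖
      ≤ steinError p N β h m l u * (1 + s ^ 2) := by
  set κ := equilibriumRate p β h m with hκ
  have hκ0 : 0 < κ := equilibriumRate_pos
  set g : (Fin N → Fin q) → ℂ := devChar m l s with hg
  have hgn : ∀ x, ‖g x‖ = 1 := norm_devChar m l s
  have hs0 : 0 < √(N : ℝ) := Real.sqrt_pos.mpr (Nat.cast_pos.mpr (NeZero.pos N))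
  set e : Fin q → ℂ := fun r => Complex.exp (Complex.I * ((s * (l r - l 0) * (√N)⁻¹ : ℝ) : ℂ))
    with he
  set a : Fin q → ℂ := fun r => Complex.I * ((s * (l r - l 0) : ℝ) : ℂ) with ha
  have hsη : (√(N : ℝ) : ℂ) * ((√(N : ℝ))⁻¹ : ℝ) = 1 := by
    rw [← Complex.ofReal_mul, mul_inv_cancel₀ hs0.ne', Complex.ofReal_one]
  have he1 : ∀ r, ‖(√N : ℂ) * (e r - 1)‖ ≤ |s| * |l r - l 0| := by
    intro r
    rw [norm_mul, Complex.norm_real, Real.norm_of_nonneg hs0.le]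
    refine (mul_le_mul_of_nonneg_left Real.norm_exp_I_mul_ofReal_sub_one_le hs0.le).trans_eq ?_
    rw [Real.norm_eq_abs, abs_mul, abs_mul, abs_of_pos (inv_pos.mpr hs0)]
    field_simp
  have he2 : ∀ r, ‖(√N : ℂ) * (e r - 1) - a r‖ ≤ 2 * (l r - l 0) ^ 2 * (√N)⁻¹ * s ^ 2 := by
    intro r
    have h1 : (√N : ℂ) * (e r - 1) - a r = (√N : ℂ) * (e r - 1
        - Complex.I * ((s * (l r - l 0) * (√N)⁻¹ : ℝ) : ℂ)) := by
      have : (√N : ℂ) * (Complex.I * ((s * (l r - l 0) * (√N)⁻¹ : ℝ) : ℂ)) = a r := by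
        simp only [ha]
        rw [Complex.ofReal_mul]
        linear_combination (Complex.I * ((s * (l r - l 0) : ℝ) : ℂ)) * hsη
      rw [mul_sub _ (e r - 1), this]
    rw [h1, norm_mul, Complex.norm_real, Real.norm_of_nonneg hs0.le]
    refine (mul_le_mul_of_nonneg_left (norm_exp_I_mul_sub_one_sub_le _) hs0.le).trans_eq ?_
    field_simp
  -- An exact decomposition into three errors: linearization of the rates, replacement of θ_0 by κ,
  -- and the first-order expansion of the increment of the character. Terms that do not depend on r
  -- cancel because ∑ᵣ uᵣ = 0.
  have hid : (κ : ℂ) * (gibbsMean p β h (fun x : Fin N → Fin q =>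
          ((∑ r, l r * scaledDev m x r : ℝ) : ℂ) * g x)
        - Complex.I * ((s * ∑ r, u r * l r : ℝ) : ℂ) * gibbsMean p β h g)
      = -(∑ r, (u r : ℂ) * gibbsMean p β h
            (fun x : Fin N → Fin q => (rateRemainder p β h 0 m x r : ℂ) * g x))
        + ∑ r, (u r : ℂ) * gibbsMean p β h (fun x : Fin N → Fin q =>
            ((rate p β h 0 x 0 - κ : ℝ) : ℂ) * (g x * ((√N : ℂ) * (e r - 1))))
        + κ * ∑ r, (u r : ℂ) * gibbsMean p β h (fun x : Fin N → Fin q =>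
            g x * ((√N : ℂ) * (e r - 1) - a r)) := by
    have hex : ∑ r, (u r : ℂ) * gibbsMean p β h (fun x : Fin N → Fin q =>
          (√N : ℂ) * ((rate p β h 0 x r : ℂ) * g x))
        = ∑ r, (u r : ℂ) * gibbsMean p β h (fun x : Fin N → Fin q =>
          (√N : ℂ) * ((rate p β h 0 x 0 : ℂ) * g x * e r)) := by
      refine Finset.sum_congr rfl fun r _ => ?_
      rw [gibbsMean_const_mul, gibbsMean_const_mul, gibbsMean_rate_mul_devChar]
    simp only [← gibbsMean_const_mul, ← gibbsMean_sum] at hex ⊢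
    rw [← gibbsMean_sub, ← gibbsMean_const_mul]
    have hneg : ∀ f : (Fin N → Fin q) → ℂ, -gibbsMean p β h f = gibbsMean p β h (fun x => -f x) := by
      intro f; simp [gibbsMean]
    rw [hneg, ← gibbsMean_add, ← gibbsMean_add, ← sub_eq_zero, ← gibbsMean_sub]
    rw [← sub_eq_zero, ← gibbsMean_sub] at hex
    rw [← hex]
    congr 1
    ext x
    have huC : ∑ r, (u r : ℂ) = 0 := by
      rw [← Complex.ofReal_sum, hu, Complex.ofReal_zero]
    have hR : ∑ r, (u r : ℂ) * (rateRemainder p β h 0 m x r : ℂ)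
        = ∑ r, (u r : ℂ) * ((√N : ℂ) * (rate p β h 0 x r : ℂ))
          - κ * ((∑ r, l r * scaledDev m x r : ℝ) : ℂ) := by
      rw [hL _ (sum_scaledDev hm x)]
      have : ∀ r, (u r : ℂ) * (rateRemainder p β h 0 m x r : ℂ)
          = (u r : ℂ) * ((√N : ℂ) * (rate p β h 0 x r : ℂ)) - (u r : ℂ) * ((√N : ℂ) * κ)
            + κ * ((u r * curvature p β (m r) * scaledDev m x r : ℝ) : ℂ) := by
        intro r
        simp only [rateRemainder]
        push_cast
        ring
      rw [Finset.sum_congr rfl fun r _ => this r, Finset.sum_add_distrib, Finset.sum_sub_distrib,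
        ← Finset.sum_mul, huC, ← Finset.mul_sum, ← Complex.ofReal_sum, Complex.ofReal_neg]
      ring
    have ha' : ∑ r, (u r : ℂ) * a r = Complex.I * ((s * ∑ r, u r * l r : ℝ) : ℂ) := by
      have : ∀ r, (u r : ℂ) * a r = Complex.I * ((s * (u r * l r) : ℝ) : ℂ)
          - (u r : ℂ) * (Complex.I * (s * l 0 : ℝ)) := by
        intro r
        simp only [ha]
        push_cast
        ring
      rw [Finset.sum_congr rfl fun r _ => this r, Finset.sum_sub_distrib, ← Finset.sum_mul, huC,
        ← Finset.mul_sum, ← Complex.ofReal_sum, ← Finset.mul_sum]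
      ring
    have e1 : ∑ r, (u r : ℂ) * ((rateRemainder p β h 0 m x r : ℂ) * g x)
        = (∑ r, (u r : ℂ) * (rateRemainder p β h 0 m x r : ℂ)) * g x := by
      rw [Finset.sum_mul]; exact Finset.sum_congr rfl fun r _ => by ring
    have e2 : ∑ r, (u r : ℂ) * (((rate p β h 0 x 0 - κ : ℝ) : ℂ) * (g x * ((√N : ℂ) * (e r - 1))))
        = ((rate p β h 0 x 0 : ℂ) - κ) * g x * (√N : ℂ) * (∑ r, (u r : ℂ) * e r) := by
      have : ∀ r, (u r : ℂ) * (((rate p β h 0 x 0 - κ : ℝ) : ℂ) * (g x * ((√N : ℂ) * (e r - 1))))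
          = ((rate p β h 0 x 0 : ℂ) - κ) * g x * (√N : ℂ) * ((u r : ℂ) * e r)
            - (u r : ℂ) * (((rate p β h 0 x 0 : ℂ) - κ) * g x * (√N : ℂ)) := by
        intro r
        push_cast
        ring
      rw [Finset.sum_congr rfl fun r _ => this r, Finset.sum_sub_distrib, ← Finset.sum_mul, huC,
        ← Finset.mul_sum]
      ring
    have e3 : ∑ r, (u r : ℂ) * (g x * ((√N : ℂ) * (e r - 1) - a r))
        = g x * ((√N : ℂ) * (∑ r, (u r : ℂ) * e r)
          - Complex.I * ((s * ∑ r, u r * l r : ℝ) : ℂ)) := by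
      rw [← ha']
      have : ∀ r, (u r : ℂ) * (g x * ((√N : ℂ) * (e r - 1) - a r))
          = g x * ((√N : ℂ) * ((u r : ℂ) * e r)) - g x * ((u r : ℂ) * a r)
            - (u r : ℂ) * (g x * (√N : ℂ)) := by
        intro r; ring
      rw [Finset.sum_congr rfl fun r _ => this r, Finset.sum_sub_distrib, Finset.sum_sub_distrib,
        ← Finset.sum_mul, huC, ← Finset.mul_sum, ← Finset.mul_sum, ← Finset.mul_sum]
      ring
    have e4 : ∑ r, (u r : ℂ) * ((√N : ℂ) * ((rate p β h 0 x r : ℂ) * g x))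
        = (∑ r, (u r : ℂ) * ((√N : ℂ) * (rate p β h 0 x r : ℂ))) * g x := by
      rw [Finset.sum_mul]; exact Finset.sum_congr rfl fun r _ => by ring
    have e5 : ∑ r, (u r : ℂ) * ((√N : ℂ) * ((rate p β h 0 x 0 : ℂ) * g x * e r))
        = (rate p β h 0 x 0 : ℂ) * g x * (√N : ℂ) * (∑ r, (u r : ℂ) * e r) := by
      rw [Finset.mul_sum]; exact Finset.sum_congr rfl fun r _ => by ring
    rw [e1, e2, e3, e4, e5, hR]
    ring
  have hsle : |s| ≤ 1 + s ^ 2 := by nlinarith [sq_abs s, sq_nonneg (|s| - 1), abs_nonneg s]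
  have hb1 : ‖∑ r, (u r : ℂ) * gibbsMean p β h
      (fun x : Fin N → Fin q => (rateRemainder p β h 0 m x r : ℂ) * g x)‖
      ≤ (∑ r, |u r| * gibbsMean p β h
        (fun x : Fin N → Fin q => |rateRemainder p β h 0 m x r|)) * (1 + s ^ 2) := by
    refine (norm_sum_le_of_le _ fun r _ => ?_).trans (le_mul_of_one_le_right
      (Finset.sum_nonneg fun r _ => mul_nonneg (abs_nonneg _)
        (gibbsMean_nonneg fun x => abs_nonneg _)) (by linarith [sq_nonneg s]))
    rw [norm_mul, Complex.norm_real, Real.norm_eq_abs]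
    refine mul_le_mul_of_nonneg_left (norm_gibbsMean_le fun x => ?_) (abs_nonneg _)
    rw [norm_mul, hgn, mul_one, Complex.norm_real, Real.norm_eq_abs]
  have hb2 : ‖∑ r, (u r : ℂ) * gibbsMean p β h (fun x : Fin N → Fin q =>
      ((rate p β h 0 x 0 - κ : ℝ) : ℂ) * (g x * ((√N : ℂ) * (e r - 1))))‖
      ≤ (∑ r, |u r| * |l r - l 0|) * gibbsMean p β h
        (fun x : Fin N → Fin q => |rate p β h 0 x 0 - κ|) * (1 + s ^ 2) := by
    rw [Finset.sum_mul, Finset.sum_mul]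
    refine norm_sum_le_of_le _ fun r _ => ?_
    rw [norm_mul, Complex.norm_real, Real.norm_eq_abs]
    have h1 : ‖gibbsMean p β h (fun x : Fin N → Fin q =>
        ((rate p β h 0 x 0 - κ : ℝ) : ℂ) * (g x * ((√N : ℂ) * (e r - 1))))‖
        ≤ gibbsMean p β h (fun x : Fin N → Fin q =>
          |l r - l 0| * (1 + s ^ 2) * |rate p β h 0 x 0 - κ|) := by
      refine norm_gibbsMean_le fun x => ?_
      rw [norm_mul, norm_mul, hgn, one_mul, Complex.norm_real, Real.norm_eq_abs, mul_comm]
      refine mul_le_mul_of_nonneg_right ((he1 r).trans ?_) (abs_nonneg _)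
      rw [mul_comm]
      exact mul_le_mul_of_nonneg_left hsle (abs_nonneg _)
    rw [gibbsMean_const_mul] at h1
    refine (mul_le_mul_of_nonneg_left h1 (abs_nonneg _)).trans_eq ?_
    ring
  have hb3 : ‖(κ : ℂ) * ∑ r, (u r : ℂ) * gibbsMean p β h (fun x : Fin N → Fin q =>
      g x * ((√N : ℂ) * (e r - 1) - a r))‖
      ≤ κ * ((∑ r, |u r| * (2 * (l r - l 0) ^ 2)) * (√N)⁻¹ * (1 + s ^ 2)) := by
    rw [norm_mul, Complex.norm_real, Real.norm_of_nonneg hκ0.le]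
    refine mul_le_mul_of_nonneg_left ?_ hκ0.le
    rw [Finset.sum_mul, Finset.sum_mul]
    refine norm_sum_le_of_le _ fun r _ => ?_
    rw [norm_mul, Complex.norm_real, Real.norm_eq_abs]
    have h1 : ‖gibbsMean p β h (fun x : Fin N → Fin q =>
        g x * ((√N : ℂ) * (e r - 1) - a r))‖ ≤ 2 * (l r - l 0) ^ 2 * (√N)⁻¹ * s ^ 2 := by
      refine (norm_gibbsMean_le (g := fun _ => 2 * (l r - l 0) ^ 2 * (√N)⁻¹ * s ^ 2)
        fun x => ?_).trans_eq (gibbsMean_const _)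
      rw [norm_mul, hgn, one_mul]
      exact he2 r
    have h2 : 2 * (l r - l 0) ^ 2 * (√N)⁻¹ * s ^ 2
        ≤ 2 * (l r - l 0) ^ 2 * (√N)⁻¹ * (1 + s ^ 2) :=
      mul_le_mul_of_nonneg_left (by linarith) (by positivity)
    refine (mul_le_mul_of_nonneg_left (h1.trans h2) (abs_nonneg _)).trans_eq ?_
    ring
  set X := gibbsMean p β h (fun x : Fin N → Fin q =>
          ((∑ r, l r * scaledDev m x r : ℝ) : ℂ) * g x)
        - Complex.I * ((s * ∑ r, u r * l r : ℝ) : ℂ) * gibbsMean p β h g with hX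
  have hn : κ * ‖X‖ ≤ κ * (steinError p N β h m l u * (1 + s ^ 2)) := by
    have h1 : κ * ‖X‖ = ‖(κ : ℂ) * X‖ := by
      rw [norm_mul, Complex.norm_real, Real.norm_of_nonneg hκ0.le]
    rw [h1, hid]
    refine (norm_add₃_le).trans ?_
    rw [norm_neg]
    refine (add_le_add (add_le_add hb1 hb2) hb3).trans_eq ?_
    simp only [steinError, ← hκ]
    rw [← sub_eq_zero]
    linear_combination (-(∑ r, |u r| * gibbsMean p β h
        (fun x : Fin N → Fin q => |rateRemainder p β h 0 m x r|)) * (1 + s ^ 2)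
      - (∑ r, |u r| * |l r - l 0|) * gibbsMean p β h
        (fun x : Fin N → Fin q => |rate p β h 0 x 0 - κ|) * (1 + s ^ 2)) * mul_inv_cancel₀ hκ0.ne'
  exact le_of_mul_le_mul_left hn hκ0

/-- **Central limit theorem** for a linear functional of the fluctuations, in terms of
characteristic functions. -/
theorem tendsto_gibbsMean_devChar (hp : 2 ≤ p) (H : IsRegularMaximizer p β h m) {l u : Fin q → ℝ}
    (hu : ∑ r, u r = 0)
    (hL : ∀ w : Fin q → ℝ, ∑ r, w r = 0 →
      ∑ r, l r * w r = -∑ r, u r * curvature p β (m r) * w r) (s : ℝ) :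
    Tendsto (fun N : ℕ => gibbsMean p β h (fun x : Fin N → Fin q => devChar m l s x)) atTop
      (𝓝 (Complex.exp (-(((∑ r, u r * l r : ℝ) : ℂ) * s ^ 2 / 2)))) := by
  set v := ∑ r, u r * l r with hv
  rw [tendsto_iff_norm_sub_tendsto_zero]
  have hlim : Tendsto (fun N : ℕ => steinError p N β h m l u * (1 + s ^ 2)
      * Real.exp (|v| * s ^ 2) * |s|) atTop (𝓝 0) := by
    simpa using (((tendsto_steinError hp H l u).mul_const (1 + s ^ 2)).mul_const
      (Real.exp (|v| * s ^ 2))).mul_const |s|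
  refine squeeze_zero' (Eventually.of_forall fun N => norm_nonneg _) ?_ hlim
  filter_upwards [eventually_ge_atTop 1] with N hN1
  have : NeZero N := ⟨by omega⟩
  refine norm_sub_exp_le (ψ := fun s => gibbsMean p β h (fun x : Fin N → Fin q => devChar m l s x))
    (ψ' := fun s => Complex.I * gibbsMean p β h (fun x : Fin N → Fin q =>
      ((∑ r, l r * scaledDev m x r : ℝ) : ℂ) * devChar m l s x)) (fun s => ?_) ?_ (fun s => ?_) s
  · rw [← gibbsMean_const_mul]
    simp only [gibbsMean]
    refine HasDerivAt.fun_sum fun x _ => ?_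
    refine HasDerivAt.const_smul _ ?_
    have h1 : HasDerivAt (fun s : ℝ => ((s * ∑ r, l r * scaledDev m x r : ℝ) : ℂ))
        ((∑ r, l r * scaledDev m x r : ℝ) : ℂ) s := by
      refine HasDerivAt.ofReal_comp ?_
      simpa using (hasDerivAt_id s).mul_const (∑ r, l r * scaledDev m x r)
    have h2 := (h1.const_mul Complex.I).cexp
    refine h2.congr_deriv ?_
    rw [devChar]
    ring
  · have : ∀ x : Fin N → Fin q, devChar m l 0 x = 1 := fun x => by simp [devChar]
    simp only [this]
    exact gibbsMean_const 1
  · have h1 := norm_stein_devChar_le (p := p) (h := h) (N := N) H.mem.2 hu hL s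
    rw [← hv] at h1
    refine le_trans (le_of_eq ?_) h1
    rw [← one_mul ‖_ - _‖, ← Complex.norm_I, ← norm_mul]
    congr 1
    rw [mul_sub, ← mul_assoc, ← mul_assoc, Complex.I_mul_I]
    push_cast
    ring

end CharFun

/-! ### Distribution functions of statistics of the model -/

section DistributionFunction

variable {p q : ℕ}

lemma measurable_of_config {N : ℕ} {E : Type*} [MeasurableSpace E] (f : (Fin N → Fin q) → E) :
    Measurable f := measurable_of_countable f

variable [NeZero q] {β h : ℝ}

/-- The law of the statistic `Y` under `P_{β,h,N}`. -/
def statLaw (p : ℕ) (β h : ℝ) {N : ℕ} {E : Type*} [MeasurableSpace E] (Y : (Fin N → Fin q) → E) :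
    ProbabilityMeasure E :=
  ⟨(pottsMeasure p q N β h).map Y,
    Measure.isProbabilityMeasure_map (measurable_of_config Y).aemeasurable⟩

lemma charFun_statLaw {N : ℕ} {E : Type*} [NormedAddCommGroup E] [InnerProductSpace ℝ E]
    [MeasurableSpace E] [BorelSpace E] [SecondCountableTopology E] (Y : (Fin N → Fin q) → E)
    (t : E) :
    charFun (statLaw p β h Y : Measure E) t
      = gibbsMean p β h (fun x => Complex.exp (inner ℝ (Y x) t * Complex.I)) := by
  rw [charFun_apply, statLaw, ProbabilityMeasure.coe_mk,
    integral_map (measurable_of_config Y).aemeasurable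
      (by fun_prop : Measurable fun y : E => Complex.exp ((inner ℝ y t : ℂ) * Complex.I)).aestronglyMeasurable,
    integral_pottsMeasure]

lemma charFun_statLaw_real {N : ℕ} (Y : (Fin N → Fin q) → ℝ) (s : ℝ) :
    charFun (statLaw p β h Y : Measure ℝ) s
      = gibbsMean p β h (fun x => Complex.exp (Complex.I * ((s * Y x : ℝ) : ℂ))) := by
  rw [charFun_statLaw]
  congr 1
  ext x
  congr 1
  rw [RCLike.inner_apply, conj_trivial]
  push_cast
  ring

/-- Convergence of the characteristic functions gives convergence of the distribution functions
along convergent thresholds. -/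
lemma tendsto_pottsMeasure_le_of_charFun {Y : (N : ℕ) → (Fin N → Fin q) → ℝ} {μ : Measure ℝ}
    [IsProbabilityMeasure μ]
    (hY : ∀ s : ℝ, Tendsto (fun N => gibbsMean p β h
      (fun x : Fin N → Fin q => Complex.exp (Complex.I * ((s * Y N x : ℝ) : ℂ)))) atTop
        (𝓝 (charFun μ s)))
    {c : ℕ → ℝ} {c₀ : ℝ} (hc : Tendsto c atTop (𝓝 c₀)) (hμ : μ {c₀} = 0) :
    Tendsto (fun N => (pottsMeasure p q N β h).real {x | Y N x ≤ c N}) atTop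
      (𝓝 (μ.real (Set.Iic c₀))) := by
  have hprob : IsProbabilityMeasure (μ.map fun y => y + -c₀) :=
    Measure.isProbabilityMeasure_map (by fun_prop)
  obtain ⟨ν, hν⟩ : ∃ ν : ProbabilityMeasure ℝ, (ν : Measure ℝ) = μ.map fun y => y + -c₀ :=
    ⟨⟨_, hprob⟩, rfl⟩
  -- Subtracting the moving threshold turns the events into one fixed half-line, to which the
  -- portmanteau theorem applies.
  have hw : Tendsto (fun N => statLaw p β h (fun x : Fin N → Fin q => Y N x - c N)) atTop
      (𝓝 ν) := by
    refine ProbabilityMeasure.tendsto_of_tendsto_charFun fun s => ?_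
    rw [hν, charFun_map_add_const]
    have h1 : Tendsto (fun N => Complex.exp (((inner ℝ (-c N) s : ℝ) : ℂ) * Complex.I)) atTop
        (𝓝 (Complex.exp (((inner ℝ (-c₀) s : ℝ) : ℂ) * Complex.I))) := by
      refine (Continuous.tendsto (f := fun y : ℝ =>
        Complex.exp (((inner ℝ y s : ℝ) : ℂ) * Complex.I)) (by fun_prop) (-c₀)).comp hc.neg
    refine ((hY s).mul h1).congr fun N => ?_
    rw [charFun_statLaw_real, mul_comm, ← gibbsMean_const_mul]
    congr 1
    ext x
    rw [← Complex.exp_add, RCLike.inner_apply, conj_trivial]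
    congr 1
    push_cast
    ring
  have hfr : (ν : Measure ℝ) (frontier (Set.Iic 0)) = 0 := by
    rw [frontier_Iic, hν, Measure.map_apply (by fun_prop)
      (measurableSet_singleton 0)]
    have : (fun y => y + -c₀) ⁻¹' {(0 : ℝ)} = {c₀} := by
      ext y
      simp only [Set.mem_preimage, Set.mem_singleton_iff]
      constructor <;> intro h <;> linarith
    rw [this, hμ]
  have hlim := ProbabilityMeasure.tendsto_measure_of_null_frontier_of_tendsto' hw hfr
  have h2 := (ENNReal.tendsto_toReal (measure_ne_top _ _)).comp hlim
  have e1 : ((ν : Measure ℝ) (Set.Iic 0)).toReal = μ.real (Set.Iic c₀) := by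
    rw [hν, Measure.map_apply (by fun_prop) measurableSet_Iic, measureReal_def]
    congr 2
    ext y
    simp
  rw [e1] at h2
  refine h2.congr fun N => ?_
  simp only [Function.comp]
  rw [statLaw, ProbabilityMeasure.coe_mk, Measure.map_apply (measurable_of_config _)
    measurableSet_Iic, measureReal_def]
  congr 2
  ext x
  simp

/-- A form of Slutsky's theorem: |exp (ia) - exp (ib)| ≤ |a - b|, so convergence to zero in mean of
the difference suffices. -/
lemma tendsto_gibbsMean_exp_of_sub {Y Y' : (N : ℕ) → (Fin N → Fin q) → ℝ} {s : ℝ} {z : ℂ}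
    (hY : Tendsto (fun N => gibbsMean p β h
      (fun x : Fin N → Fin q => Complex.exp (Complex.I * ((s * Y N x : ℝ) : ℂ)))) atTop (𝓝 z))
    (hYY' : Tendsto (fun N => gibbsMean p β h (fun x : Fin N → Fin q => |Y' N x - Y N x|)) atTop
      (𝓝 0)) :
    Tendsto (fun N => gibbsMean p β h
      (fun x : Fin N → Fin q => Complex.exp (Complex.I * ((s * Y' N x : ℝ) : ℂ)))) atTop (𝓝 z) := by
  have h1 : Tendsto (fun N => gibbsMean p β h
      (fun x : Fin N → Fin q => Complex.exp (Complex.I * ((s * Y' N x : ℝ) : ℂ)))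
      - gibbsMean p β h
      (fun x : Fin N → Fin q => Complex.exp (Complex.I * ((s * Y N x : ℝ) : ℂ)))) atTop (𝓝 0) := by
    have h2 := hYY'.const_mul |s|
    rw [mul_zero] at h2
    refine squeeze_zero_norm (fun N => ?_) h2
    rw [← gibbsMean_sub, ← gibbsMean_const_mul]
    refine norm_gibbsMean_le fun x => ?_
    have h3 : Complex.exp (Complex.I * ((s * Y' N x : ℝ) : ℂ))
        - Complex.exp (Complex.I * ((s * Y N x : ℝ) : ℂ))
        = Complex.exp (Complex.I * ((s * Y N x : ℝ) : ℂ))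
          * (Complex.exp (Complex.I * ((s * (Y' N x - Y N x) : ℝ) : ℂ)) - 1) := by
      rw [mul_sub, ← Complex.exp_add, mul_one]
      congr 2
      push_cast
      ring
    rw [h3, norm_mul, Complex.norm_exp_I_mul_ofReal, one_mul]
    refine Real.norm_exp_I_mul_ofReal_sub_one_le.trans_eq ?_
    rw [Real.norm_eq_abs, abs_mul]
  simpa using hY.add h1

/-- Without atoms the distribution function is continuous, so it takes the value ε/2. -/
lemma exists_cdf_mem_Ioo {μ : Measure ℝ} [IsProbabilityMeasure μ] (hμ : ∀ a, μ {a} = 0) {ε : ℝ}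
    (hε : 0 < ε) (hε1 : ε ≤ 1) : ∃ c, 0 < μ.real (Set.Iic c) ∧ μ.real (Set.Iic c) < ε := by
  have hcont : Continuous (cdf μ) := by
    rw [continuous_iff_continuousAt]
    intro a
    rw [(monotone_cdf μ).continuousAt_iff_leftLim_eq_rightLim, (cdf μ).rightLim_eq]
    have h1 := (cdf μ).measure_singleton a
    rw [measure_cdf, hμ a] at h1
    refine le_antisymm ((monotone_cdf μ).leftLim_le le_rfl) ?_
    have := ENNReal.ofReal_eq_zero.mp h1.symm
    linarith
  have h0 := (tendsto_cdf_atBot μ).eventually (gt_mem_nhds (half_pos hε))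
  have h1 := (tendsto_cdf_atTop μ).eventually (lt_mem_nhds (show ε / 2 < 1 by linarith))
  obtain ⟨a, ha⟩ := h0.exists
  obtain ⟨b, hb⟩ := h1.exists
  obtain ⟨c, hc⟩ := mem_range_of_exists_le_of_exists_ge hcont ⟨a, ha.le⟩ ⟨b, hb.le⟩
  refine ⟨c, ?_⟩
  rw [← cdf_eq_real, hc]
  constructor <;> linarith

/-- In the situation of a limit law without atoms, the probability that a statistic takes its
smallest possible value tends to zero. -/
lemma tendsto_pottsMeasure_isMin {Y : (N : ℕ) → (Fin N → Fin q) → ℝ} {μ : Measure ℝ}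
    [IsProbabilityMeasure μ] (hμ : ∀ a, μ {a} = 0)
    (hY : ∀ c, Tendsto (fun N => (pottsMeasure p q N β h).real {x | Y N x ≤ c}) atTop
      (𝓝 (μ.real (Set.Iic c)))) :
    Tendsto (fun N => (pottsMeasure p q N β h).real {x | ∀ y, Y N x ≤ Y N y}) atTop (𝓝 0) := by
  rw [Metric.tendsto_atTop']
  intro ε hε
  obtain ⟨c, hc0, hcε⟩ := exists_cdf_mem_Ioo hμ (lt_min hε one_pos) (min_le_right ε 1)
  obtain ⟨N₀, hN₀⟩ := eventually_atTop.mp (((hY c).eventually (lt_mem_nhds hc0)).and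
    ((hY c).eventually (gt_mem_nhds (hcε.trans_le (min_le_left _ _)))))
  refine ⟨N₀, fun N hN => ?_⟩
  obtain ⟨h1, h2⟩ := hN₀ N hN.le
  rw [Real.dist_eq, sub_zero, abs_of_nonneg measureReal_nonneg]
  refine lt_of_le_of_lt (measureReal_mono ?_) h2
  -- The lower level set has positive probability, hence is nonempty. The minimum is therefore at
  -- most c, and minimal configurations lie in a set of probability less than ε.
  obtain ⟨y, hy⟩ : {x | Y N x ≤ c}.Nonempty := by
    by_contra hempty
    rw [Set.not_nonempty_iff_eq_empty.mp hempty] at h1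
    simp at h1
  exact fun x hx => (hx y).trans hy

end DistributionFunction

/-! ### The maximum likelihood estimator -/

section MLE

variable {p q : ℕ}

/-- The sufficient statistic `∑ᵣ X̄_{·r}^p`. -/
def powerSum (p : ℕ) {N : ℕ} (x : Fin N → Fin q) : ℝ := ∑ r, magnetization x r ^ p

variable [NeZero q] {h : ℝ} {N : ℕ}

/-- The reciprocal of the likelihood of the observation `x`. -/
def invLikelihood (p : ℕ) (h : ℝ) (x : Fin N → Fin q) (b : ℝ) : ℝ :=
  ∑ y : Fin N → Fin q, Real.exp (b * (N * (powerSum p y - powerSum p x))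
    + N * h * (magnetization y 0 - magnetization x 0))

lemma gibbsWeight_div (x y : Fin N → Fin q) (b : ℝ) :
    gibbsWeight p b h y / gibbsWeight p b h x
      = Real.exp (b * (N * (powerSum p y - powerSum p x))
        + N * h * (magnetization y 0 - magnetization x 0)) := by
  rw [gibbsWeight, gibbsWeight, ← Real.exp_sub, powerSum, powerSum]
  congr 1
  ring

lemma invLikelihood_eq (x : Fin N → Fin q) (b : ℝ) :
    invLikelihood p h x b = (gibbsProb p b h x)⁻¹ := by
  rw [gibbsProb_eq, inv_div, Finset.sum_div, invLikelihood]
  exact Finset.sum_congr rfl fun y _ => (gibbsWeight_div x y b).symm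

lemma isMLEBeta_iff (x : Fin N → Fin q) (b : ℝ) :
    IsMLEBeta p h x b ↔ ∀ b', invLikelihood p h x b ≤ invLikelihood p h x b' := by
  simp only [IsMLEBeta, invLikelihood_eq]
  exact forall_congr' fun b' => (inv_le_inv₀ (gibbsProb_pos x) (gibbsProb_pos x)).symm

/-- The derivative of `invLikelihood` in the parameter. -/
def invLikelihoodDeriv (p : ℕ) (h : ℝ) (x : Fin N → Fin q) (b : ℝ) : ℝ :=
  ∑ y : Fin N → Fin q, Real.exp (b * (N * (powerSum p y - powerSum p x))
    + N * h * (magnetization y 0 - magnetization x 0)) * (N * (powerSum p y - powerSum p x))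

lemma hasDerivAt_invLikelihood (x : Fin N → Fin q) (b : ℝ) :
    HasDerivAt (invLikelihood p h x) (invLikelihoodDeriv p h x b) b := by
  unfold invLikelihood invLikelihoodDeriv
  refine HasDerivAt.fun_sum fun y _ => ?_
  refine HasDerivAt.exp ?_
  simpa using ((hasDerivAt_id b).mul_const (N * (powerSum p y - powerSum p x))).add_const
    (N * h * (magnetization y 0 - magnetization x 0))

/-- The score equation: up to a nonnegative factor, the derivative is the expected minus the
observed value of the sufficient statistic. -/
lemma invLikelihoodDeriv_eq (x : Fin N → Fin q) (b : ℝ) :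
    invLikelihoodDeriv p h x b
      = N * (gibbsProb p b h x)⁻¹
        * (gibbsMean p b h (powerSum p : (Fin N → Fin q) → ℝ) - powerSum p x) := by
  have h1 : gibbsMean p b h (powerSum p : (Fin N → Fin q) → ℝ) - powerSum p x
      = gibbsMean p b h (fun y : Fin N → Fin q => powerSum p y - powerSum p x) := by
    rw [gibbsMean_sub, gibbsMean_const]
  rw [h1, gibbsMean, Finset.mul_sum, invLikelihoodDeriv]
  refine Finset.sum_congr rfl fun y _ => ?_
  rw [← gibbsWeight_div, gibbsProb_eq, gibbsProb_eq, smul_eq_mul]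
  have hx := (gibbsWeight_pos (p := p) (β := b) (h := h) x).ne'
  have hs := (sum_gibbsWeight_pos (p := p) (q := q) (N := N) (β := b) (h := h)).ne'
  field_simp

/-- Each summand has the form exp (b a + const) a, which is nondecreasing in b and strictly
increasing when a > 0; the configuration y₀ provides a strict term. -/
lemma strictMono_invLikelihoodDeriv [NeZero N] {x y₀ : Fin N → Fin q}
    (hy₀ : powerSum p x < powerSum p y₀) : StrictMono (invLikelihoodDeriv p h x) := by
  have hN : 0 < (N : ℝ) := Nat.cast_pos.mpr (NeZero.pos N)
  intro b b' hbb'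
  refine Finset.sum_lt_sum (fun y _ => ?_) ⟨y₀, Finset.mem_univ _, ?_⟩
  · rcases le_total 0 (N * (powerSum p y - powerSum p x)) with h0 | h0
    · exact mul_le_mul_of_nonneg_right (Real.exp_le_exp.mpr (add_le_add
        (mul_le_mul_of_nonneg_right hbb'.le h0) le_rfl)) h0
    · exact mul_le_mul_of_nonpos_right (Real.exp_le_exp.mpr (add_le_add
        (mul_le_mul_of_nonpos_right hbb'.le h0) le_rfl)) h0
  · have h0 : 0 < N * (powerSum p y₀ - powerSum p x) := mul_pos hN (by linarith)
    exact mul_lt_mul_of_pos_right (Real.exp_lt_exp.mpr (by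
      have := mul_lt_mul_of_pos_right hbb' h0
      linarith)) h0

/-- The maximum likelihood estimate exists if the sufficient statistic is neither minimal nor
maximal. -/
lemma exists_isMLEBeta [NeZero N] {x y₀ y₁ : Fin N → Fin q}
    (hy₀ : powerSum p x < powerSum p y₀) (hy₁ : powerSum p y₁ < powerSum p x) :
    ∃ b, IsMLEBeta p h x b := by
  have hN : 0 < (N : ℝ) := Nat.cast_pos.mpr (NeZero.pos N)
  simp only [isMLEBeta_iff]
  have hcont : Continuous (invLikelihood p h x) := by
    rw [continuous_iff_continuousAt]
    exact fun b => (hasDerivAt_invLikelihood x b).continuousAt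
  refine hcont.exists_forall_le ?_
  have hge : ∀ (y : Fin N → Fin q) b, Real.exp (b * (N * (powerSum p y - powerSum p x))
      + N * h * (magnetization y 0 - magnetization x 0)) ≤ invLikelihood p h x b := fun y b =>
    Finset.single_le_sum (f := fun y : Fin N → Fin q =>
      Real.exp (b * (N * (powerSum p y - powerSum p x))
        + N * h * (magnetization y 0 - magnetization x 0)))
      (fun y _ => (Real.exp_pos _).le) (Finset.mem_univ y)
  -- Coercivity: the summand of y₁ blows up at -∞ and that of y₀ at +∞.
  rw [cocompact_eq_atBot_atTop, tendsto_sup]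
  constructor
  · refine tendsto_atTop_mono (hge y₁) (Real.tendsto_exp_atTop.comp ?_)
    refine tendsto_atTop_add_const_right _ _ (tendsto_id.atBot_mul_const_of_neg ?_)
    exact mul_neg_of_pos_of_neg hN (by linarith)
  · refine tendsto_atTop_mono (hge y₀) (Real.tendsto_exp_atTop.comp ?_)
    refine tendsto_atTop_add_const_right _ _ (tendsto_id.atTop_mul_const ?_)
    exact mul_pos hN (by linarith)

/-- The maximum likelihood estimate is at most `b` iff the observed sufficient statistic is at most
its expectation under `b`. -/
lemma IsMLEBeta.le_iff [NeZero N] {x y₀ : Fin N → Fin q} {b₀ : ℝ} (hb₀ : IsMLEBeta p h x b₀)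
    (hy₀ : powerSum p x < powerSum p y₀) (b : ℝ) :
    b₀ ≤ b ↔ powerSum p x ≤ gibbsMean p b h (powerSum p : (Fin N → Fin q) → ℝ) := by
  have hN : 0 < (N : ℝ) := Nat.cast_pos.mpr (NeZero.pos N)
  have hzero : invLikelihoodDeriv p h x b₀ = 0 := by
    refine IsLocalMin.hasDerivAt_eq_zero (Eventually.of_forall fun b' => ?_)
      (hasDerivAt_invLikelihood x b₀)
    exact (isMLEBeta_iff x b₀).mp hb₀ b'
  -- The derivative vanishes at b₀ and is strictly increasing, so comparing b₀ with b amounts to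
  -- reading the sign of the derivative at b.
  rw [← (strictMono_invLikelihoodDeriv (h := h) hy₀).le_iff_le, hzero, invLikelihoodDeriv_eq,
    mul_nonneg_iff_of_pos_left (mul_pos hN (inv_pos.mpr (gibbsProb_pos x))), sub_nonneg]

end MLE

/-! ### From the score equation to the distribution function of the estimator -/

section Estimator

variable {p q : ℕ} [NeZero q] {β h : ℝ} {m : Fin q → ℝ}

lemma IsRegularMaximizer.sum_pow_lt_one (hp : 2 ≤ p) (hq : 2 ≤ q)
    (H : IsRegularMaximizer p β h m) : ∑ r, m r ^ p < 1 := by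
  rw [← H.mem.2]
  have hlt : ∀ r, m r ^ p < m r := by
    intro r
    obtain ⟨s, hs⟩ : ∃ s : Fin q, s ≠ r := by
      have : Nontrivial (Fin q) := Fin.nontrivial_iff_two_le.mpr hq
      exact exists_ne r
    have h1 : m r < 1 := by
      have h2 : m r + m s ≤ ∑ u, m u := by
        rw [← Finset.sum_pair hs.symm]
        exact Finset.sum_le_sum_of_subset_of_nonneg (Finset.subset_univ _)
          fun u _ _ => H.mem.1 u
      rw [H.mem.2] at h2
      linarith [H.pos hp s]
    exact pow_lt_self_of_lt_one₀ (H.pos hp r) h1 (by omega)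
  exact Finset.sum_lt_sum_of_nonempty ⟨0, Finset.mem_univ _⟩ fun r _ => hlt r

/-- The probability that the sufficient statistic takes its largest value tends to zero. -/
lemma tendsto_pottsMeasure_isMax (hp : 2 ≤ p) (hq : 2 ≤ q) (H : IsRegularMaximizer p β h m) :
    Tendsto (fun N => (pottsMeasure p q N β h).real
      {x : Fin N → Fin q | ∀ y : Fin N → Fin q, powerSum p y ≤ powerSum p x}) atTop (𝓝 0) := by
  have hcont : Continuous fun τ : Fin q → ℝ => ∑ r, τ r ^ p := by fun_prop
  obtain ⟨δ, hδ, hball⟩ := Metric.eventually_nhds_iff.mp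
    ((hcont.tendsto m).eventually (gt_mem_nhds (H.sum_pow_lt_one hp hq)))
  have hfar := tendsto_mul_gibbsMean_far (by omega) H.beta_pos.le H.mem (H.pos hp) H.lt 0 hδ
  simp only [zero_div, add_zero] at hfar
  refine squeeze_zero' (Eventually.of_forall fun N => measureReal_nonneg) ?_ hfar
  filter_upwards [eventually_ge_atTop 1] with N hN1
  have : NeZero N := ⟨by omega⟩
  classical
  rw [pottsMeasure_real_eq]
  have h0 : 0 ≤ gibbsMean p β h (fun x : Fin N → Fin q => farIndicator m δ (magnetization x)) :=
    gibbsMean_nonneg fun x => farIndicator_nonneg _ _ _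
  refine le_trans (gibbsMean_mono (g := fun x : Fin N → Fin q =>
    farIndicator m δ (magnetization x)) fun x => ?_)
    (le_mul_of_one_le_left h0 (by exact_mod_cast hN1))
  split_ifs with hx
  -- A monochromatic configuration gives the value 1. A maximal observation therefore has value at
  -- least 1, while the value is below 1 near m, so it lies in the far set.
  · have hconst : powerSum p (fun _ : Fin N => (0 : Fin q)) = 1 := by
      have hm : ∀ r : Fin q, magnetization (fun _ : Fin N => (0 : Fin q)) r
          = if r = 0 then 1 else 0 := by
        intro r
        have hN : (N : ℝ) ≠ 0 := Nat.cast_ne_zero.mpr (NeZero.ne N)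
        simp only [magnetization, eq_comm (a := r)]
        split_ifs <;> simp [hN]
      simp only [powerSum, hm, ite_pow, one_pow, zero_pow (show p ≠ 0 by omega),
        Finset.sum_ite_eq', Finset.mem_univ, if_true]
    have h1 : 1 ≤ ∑ r, magnetization x r ^ p := by
      rw [← hconst]; exact hx _
    have h2 : ∃ r, δ ≤ |magnetization x r - m r| := by
      by_contra! hall
      refine absurd (hball (y := magnetization x) ?_) (not_lt.mpr h1)
      rw [dist_pi_lt_iff hδ]
      exact hall
    obtain ⟨r, hr⟩ := h2
    rw [farIndicator_of_le r hr]
  · exact farIndicator_nonneg _ _ _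

/-- The distribution function of the rescaled maximum likelihood estimator, in terms of the limit
law `μ` of the centered and rescaled sufficient statistic `a_N (∑ᵣ X̄_{·r}^p - T)` and of the limits
of its expectation under local perturbations of `β`. -/
theorem tendsto_pottsMeasure_estimator_le (hp : 2 ≤ p) (hq : 2 ≤ q)
    (H : IsRegularMaximizer p β h m) {βhat : (N : ℕ) → (Fin N → Fin q) → ℝ}
    (hβhat : IsMLEstimatorBeta p q h βhat) {a : ℕ → ℝ} (ha : ∀ N, 0 < N → 0 < a N) {T : ℝ}
    {μ : Measure ℝ} [IsProbabilityMeasure μ] (hμ : ∀ c, μ {c} = 0)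
    (hY : ∀ s : ℝ, Tendsto (fun N => gibbsMean p β h (fun x : Fin N → Fin q =>
      Complex.exp (Complex.I * ((s * (a N * (powerSum p x - T)) : ℝ) : ℂ)))) atTop
        (𝓝 (charFun μ s)))
    {t c : ℝ}
    (hc : Tendsto (fun N : ℕ => gibbsMean p (β + t / √N) h (fun x : Fin N → Fin q =>
      a N * (powerSum p x - T))) atTop (𝓝 c)) :
    Tendsto (fun N => (pottsMeasure p q N β h).real {x | √N * (βhat N x - β) ≤ t}) atTop
      (𝓝 (μ.real (Set.Iic c))) := by
  have hmain := tendsto_pottsMeasure_le_of_charFun hY hc (hμ c)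
  have hmax := tendsto_pottsMeasure_isMax hp hq H
  have hmin := tendsto_pottsMeasure_isMin hμ fun c =>
    tendsto_pottsMeasure_le_of_charFun hY tendsto_const_nhds (hμ c)
  have hdiff : Tendsto (fun N => (pottsMeasure p q N β h).real {x | √N * (βhat N x - β) ≤ t}
      - (pottsMeasure p q N β h).real {x : Fin N → Fin q | a N * (powerSum p x - T)
        ≤ gibbsMean p (β + t / √N) h (fun x : Fin N → Fin q => a N * (powerSum p x - T))})
      atTop (𝓝 0) := by
    have hsum := hmax.add hmin
    rw [add_zero] at hsum
    refine squeeze_zero_norm' ?_ hsum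
    filter_upwards [eventually_ge_atTop 1] with N hN1
    have : NeZero N := ⟨by omega⟩
    have haN := ha N (by omega)
    have hs : 0 < √(N : ℝ) := Real.sqrt_pos.mpr (by exact_mod_cast hN1)
    set A : Set (Fin N → Fin q) := {x | √N * (βhat N x - β) ≤ t} with hA
    set B : Set (Fin N → Fin q) := {x | a N * (powerSum p x - T)
        ≤ gibbsMean p (β + t / √N) h (fun x : Fin N → Fin q => a N * (powerSum p x - T))} with hB
    set D : Set (Fin N → Fin q) := {x | ∀ y : Fin N → Fin q, powerSum p y ≤ powerSum p x} with hD
    set D' : Set (Fin N → Fin q) :=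
      {x | ∀ y, a N * (powerSum p x - T) ≤ a N * (powerSum p y - T)} with hD'
    have hiff : ∀ x, x ∉ D → x ∉ D' → (x ∈ A ↔ x ∈ B) := by
      intro x hxD hxD'
      simp only [hD, hD', Set.mem_ofPred_eq, not_forall, not_le] at hxD hxD'
      obtain ⟨y₀, hy₀⟩ := hxD
      obtain ⟨y₁, hy₁⟩ := hxD'
      have hy₁' : powerSum p y₁ < powerSum p x := by
        have := lt_of_mul_lt_mul_left hy₁ haN.le
        linarith
      have hmle := hβhat N x (exists_isMLEBeta hy₀ hy₁')
      have h1 : x ∈ A ↔ βhat N x ≤ β + t / √N := by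
        rw [hA, Set.mem_ofPred_eq, mul_comm, ← le_div_iff₀ hs]
        constructor <;> intro h <;> linarith
      have h2 : x ∈ B ↔ powerSum p x
          ≤ gibbsMean p (β + t / √N) h (powerSum p : (Fin N → Fin q) → ℝ) := by
        rw [hB, Set.mem_ofPred_eq, gibbsMean_const_mul, gibbsMean_sub, gibbsMean_const,
          mul_le_mul_iff_right₀ haN]
        constructor <;> intro h <;> linarith
      rw [h1, h2]
      exact hmle.le_iff hy₀ _
    have hAB : A ⊆ B ∪ (D ∪ D') := by
      intro x hx
      by_cases h1 : x ∈ D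
      · exact Or.inr (Or.inl h1)
      by_cases h2 : x ∈ D'
      · exact Or.inr (Or.inr h2)
      exact Or.inl ((hiff x h1 h2).mp hx)
    have hBA : B ⊆ A ∪ (D ∪ D') := by
      intro x hx
      by_cases h1 : x ∈ D
      · exact Or.inr (Or.inl h1)
      by_cases h2 : x ∈ D'
      · exact Or.inr (Or.inr h2)
      exact Or.inl ((hiff x h1 h2).mpr hx)
    have e1 := (measureReal_mono (μ := pottsMeasure p q N β h) hAB).trans
      (measureReal_union_le _ _)
    have e2 := (measureReal_mono (μ := pottsMeasure p q N β h) hBA).trans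
      (measureReal_union_le _ _)
    have e3 := measureReal_union_le (μ := pottsMeasure p q N β h) D D'
    rw [Real.norm_eq_abs, abs_le]
    constructor <;> linarith
  simpa using hdiff.add hmain

end Estimator

/-! ### Expansion of the sufficient statistic -/

section Expansion

/-- Second-order Taylor expansion with a constant uniform in both points. Multiplying the remainder
by y raises the exponent and adds only a cubic term, so induction applies. -/
lemma exists_pow_expansion (n : ℕ) : ∃ K : ℝ, 0 ≤ K ∧ ∀ a ∈ Set.Icc (0 : ℝ) 1,
    ∀ y ∈ Set.Icc (0 : ℝ) 1,
    |y ^ (n + 2) - a ^ (n + 2) - (n + 2) * a ^ (n + 1) * (y - a)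
      - (n + 2) * (n + 1) / 2 * a ^ n * (y - a) ^ 2| ≤ K * |y - a| ^ 3 := by
  induction n with
  | zero =>
    refine ⟨0, le_rfl, fun a _ y _ => ?_⟩
    rw [zero_mul, abs_nonpos_iff]
    push_cast
    ring
  | succ n ih =>
    obtain ⟨K, hK, hexp⟩ := ih
    have hC : (0 : ℝ) ≤ (n + 2) * (n + 1) / 2 := by positivity
    refine ⟨K + (n + 2) * (n + 1) / 2, by positivity, fun a ha y hy => ?_⟩
    have h1 := hexp a ha y hy
    set R := y ^ (n + 2) - a ^ (n + 2) - (n + 2) * a ^ (n + 1) * (y - a)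
      - (n + 2) * (n + 1) / 2 * a ^ n * (y - a) ^ 2 with hR
    have h2 : y ^ (n + 1 + 2) - a ^ (n + 1 + 2) - ((n + 1 : ℕ) + 2) * a ^ (n + 1 + 1) * (y - a)
        - ((n + 1 : ℕ) + 2) * ((n + 1 : ℕ) + 1) / 2 * a ^ (n + 1) * (y - a) ^ 2
        = y * R + (n + 2) * (n + 1) / 2 * a ^ n * (y - a) ^ 3 := by
      rw [hR]
      push_cast
      ring
    rw [h2]
    calc |y * R + (n + 2) * (n + 1) / 2 * a ^ n * (y - a) ^ 3|
        ≤ |y * R| + |(n + 2) * (n + 1) / 2 * a ^ n * (y - a) ^ 3| := abs_add_le _ _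
      _ = y * |R| + (n + 2) * (n + 1) / 2 * a ^ n * |y - a| ^ 3 := by
          rw [abs_mul, abs_of_nonneg hy.1, abs_mul,
            abs_of_nonneg (mul_nonneg hC (pow_nonneg ha.1 n)), abs_pow]
      _ ≤ 1 * (K * |y - a| ^ 3) + (n + 2) * (n + 1) / 2 * 1 * |y - a| ^ 3 := by
          gcongr
          · exact hy.2
          · exact pow_le_one₀ ha.1 ha.2
      _ = (K + (n + 2) * (n + 1) / 2) * |y - a| ^ 3 := by ring

variable {p q : ℕ}

lemma exists_powerSum_expansion (hp : 2 ≤ p) : ∃ K : ℝ, 0 ≤ K ∧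
    ∀ m ∈ stdSimplex ℝ (Fin q), ∀ (N : ℕ) [NeZero N] (x : Fin N → Fin q),
    |powerSum p x - ∑ r, m r ^ p - ∑ r, p * m r ^ (p - 1) * (magnetization x r - m r)
      - ∑ r, p * (p - 1) / 2 * m r ^ (p - 2) * (magnetization x r - m r) ^ 2|
      ≤ K * ∑ r, |magnetization x r - m r| ^ 3 := by
  obtain ⟨n, rfl⟩ := Nat.exists_eq_add_of_le' hp
  obtain ⟨K, hK, hexp⟩ := exists_pow_expansion n
  refine ⟨K, hK, fun m hm N _ x => ?_⟩
  rw [powerSum, ← Finset.sum_sub_distrib, ← Finset.sum_sub_distrib, ← Finset.sum_sub_distrib,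
    Finset.mul_sum]
  refine (Finset.abs_sum_le_sum_abs _ _).trans (Finset.sum_le_sum fun r _ => ?_)
  have hm1 : m r ≤ 1 := by
    rw [← hm.2]
    exact Finset.single_le_sum (f := m) (fun s _ => hm.1 s) (Finset.mem_univ r)
  have h1 := hexp (m r) ⟨hm.1 r, hm1⟩ (magnetization x r)
    ⟨magnetization_nonneg x r, magnetization_le_one x r⟩
  rw [show n + 2 - 1 = n + 1 from rfl, show n + 2 - 2 = n from rfl]
  push_cast
  rwa [show ((n : ℝ) + 2 - 1) = n + 1 by ring]

variable [NeZero q] {β h : ℝ} {m : Fin q → ℝ}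

/-- To first order, `√N (∑ᵣ X̄_{·r} ^ p - ∑ᵣ mᵣ ^ p)` is linear in the fluctuations. -/
lemma tendsto_gibbsMean_powerSum_linear (hp : 2 ≤ p) (H : IsRegularMaximizer p β h m) (t : ℝ) :
    Tendsto (fun N : ℕ => gibbsMean p (β + t / √N) h (fun x : Fin N → Fin q =>
      |√N * (powerSum p x - ∑ r, m r ^ p) - ∑ r, p * m r ^ (p - 1) * scaledDev m x r|))
      atTop (𝓝 0) := by
  obtain ⟨K, hK, hexp⟩ := exists_powerSum_expansion (q := q) hp
  obtain ⟨B, hB, hBN⟩ := exists_gibbsMean_sqDev_le hp H t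
  have hp1 : (1 : ℝ) ≤ p := by exact_mod_cast (by omega : 1 ≤ p)
  set C : ℝ := p * (p - 1) / 2 with hC
  have hC0 : 0 ≤ C := by
    have : (0 : ℝ) ≤ p - 1 := by linarith
    positivity
  have hlim : Tendsto (fun N : ℕ => (K + C) * B * (√(N : ℝ))⁻¹) atTop (𝓝 0) := by
    simpa using tendsto_inv_sqrt.const_mul ((K + C) * B)
  refine squeeze_zero' (Eventually.of_forall fun N => gibbsMean_nonneg fun x => abs_nonneg _) ?_
    hlim
  filter_upwards [hBN, eventually_gt_atTop 0] with N hN hN0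
  have : NeZero N := ⟨hN0.ne'⟩
  have hs : 0 < √(N : ℝ) := Real.sqrt_pos.mpr (Nat.cast_pos.mpr hN0)
  calc gibbsMean p (β + t / √N) h (fun x : Fin N → Fin q =>
        |√N * (powerSum p x - ∑ r, m r ^ p) - ∑ r, p * m r ^ (p - 1) * scaledDev m x r|)
      ≤ gibbsMean p (β + t / √N) h (fun x : Fin N → Fin q =>
        ((K + C) * (√(N : ℝ))⁻¹) * sqDev m x) := gibbsMean_mono fun x => ?_
    _ = (K + C) * (√(N : ℝ))⁻¹ * gibbsMean p (β + t / √N) h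
        (fun x : Fin N → Fin q => sqDev m x) := gibbsMean_const_mul _ _
    _ ≤ (K + C) * (√(N : ℝ))⁻¹ * B := by gcongr
    _ = (K + C) * B * (√(N : ℝ))⁻¹ := by ring
  set d : Fin q → ℝ := fun r => magnetization x r - m r with hd
  have hdev : ∀ r, scaledDev m x r = √N * d r := fun _ => rfl
  have h1 : √N * (powerSum p x - ∑ r, m r ^ p) - ∑ r, p * m r ^ (p - 1) * scaledDev m x r
      = √N * ((powerSum p x - ∑ r, m r ^ p - ∑ r, p * m r ^ (p - 1) * d r
        - ∑ r, C * m r ^ (p - 2) * d r ^ 2) + ∑ r, C * m r ^ (p - 2) * d r ^ 2) := by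
    have : ∑ r, p * m r ^ (p - 1) * scaledDev m x r = √N * ∑ r, p * m r ^ (p - 1) * d r := by
      rw [Finset.mul_sum]
      exact Finset.sum_congr rfl fun r _ => by rw [hdev, mul_left_comm]
    rw [this, sub_add_cancel, ← mul_sub]
  have h2 : (√(N : ℝ))⁻¹ * sqDev m x = √N * ∑ r, d r ^ 2 := by
    rw [sqDev, Finset.mul_sum, Finset.mul_sum]
    refine Finset.sum_congr rfl fun r _ => ?_
    rw [hdev, mul_pow]
    field_simp
  have hd1 : ∀ r, |d r| ≤ 1 := fun r => abs_magnetization_sub_le_one H.mem x r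
  have h3 : ∑ r, |d r| ^ 3 ≤ ∑ r, d r ^ 2 := Finset.sum_le_sum fun r _ => by
    rw [pow_succ, sq_abs]
    exact mul_le_of_le_one_right (sq_nonneg _) (hd1 r)
  have h4 : |∑ r, C * m r ^ (p - 2) * d r ^ 2| ≤ C * ∑ r, d r ^ 2 := by
    rw [Finset.mul_sum]
    refine (Finset.abs_sum_le_sum_abs _ _).trans (Finset.sum_le_sum fun r _ => ?_)
    have hm1 : m r ≤ 1 := by
      rw [← H.mem.2]
      exact Finset.single_le_sum (f := m) (fun s _ => H.mem.1 s) (Finset.mem_univ r)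
    have h5 : m r ^ (p - 2) ≤ 1 := pow_le_one₀ (H.mem.1 r) hm1
    have h6 : 0 ≤ m r ^ (p - 2) := pow_nonneg (H.mem.1 r) _
    rw [abs_of_nonneg (by positivity)]
    have h7 : C * m r ^ (p - 2) ≤ C := mul_le_of_le_one_right hC0 h5
    gcongr
  rw [h1, abs_mul, abs_of_pos hs, mul_assoc, h2]
  have h8 := hexp m H.mem N x
  calc √N * |_ + ∑ r, C * m r ^ (p - 2) * d r ^ 2|
      ≤ √N * (K * ∑ r, |d r| ^ 3 + C * ∑ r, d r ^ 2) := by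
        gcongr
        exact (abs_add_le _ _).trans (add_le_add h8 h4)
    _ ≤ √N * (K * ∑ r, d r ^ 2 + C * ∑ r, d r ^ 2) := by gcongr
    _ = (K + C) * (√N * ∑ r, d r ^ 2) := by ring

/-- At a uniform maximizer the linear term vanishes, and `N (∑ᵣ X̄_{·r} ^ p - ∑ᵣ mᵣ ^ p)` is to
first order quadratic in the fluctuations. -/
lemma tendsto_gibbsMean_powerSum_quadratic (hp : 2 ≤ p) (H : IsRegularMaximizer p β h m) (t : ℝ)
    (hunif : ∀ r, m r = m 0) :
    Tendsto (fun N : ℕ => gibbsMean p (β + t / √N) h (fun x : Fin N → Fin q =>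
      |N * (powerSum p x - ∑ r, m r ^ p) - p * (p - 1) / 2 * m 0 ^ (p - 2) * sqDev m x|))
      atTop (𝓝 0) := by
  obtain ⟨K, hK, hexp⟩ := exists_powerSum_expansion (q := q) hp
  obtain ⟨B, hB, hBN⟩ := exists_gibbsMean_sqDev_le hp H t
  rw [Metric.tendsto_atTop']
  intro ε hε
  -- Makes K δ B at most ε/2; the summand 1 avoids division by zero.
  set δ : ℝ := ε / (2 * (K * B + 1)) with hδ
  have hδ0 : 0 < δ := by positivity
  have hfar := (tendsto_mul_gibbsMean_far (by omega) H.beta_pos.le H.mem (H.pos hp) H.lt t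
    hδ0).const_mul (K * q)
  rw [mul_zero] at hfar
  obtain ⟨N₀, hN₀⟩ := eventually_atTop.mp
    ((hBN.and (hfar.eventually_lt_const (half_pos hε))).and (eventually_gt_atTop 0))
  refine ⟨N₀, fun N hN => ?_⟩
  obtain ⟨⟨hNB, hNfar⟩, hN0⟩ := hN₀ N hN.le
  have : NeZero N := ⟨hN0.ne'⟩
  rw [Real.dist_eq, sub_zero, abs_of_nonneg (gibbsMean_nonneg fun x => abs_nonneg _)]
  have hNr : (0 : ℝ) ≤ N := Nat.cast_nonneg N
  calc gibbsMean p (β + t / √N) h (fun x : Fin N → Fin q =>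
        |N * (powerSum p x - ∑ r, m r ^ p) - p * (p - 1) / 2 * m 0 ^ (p - 2) * sqDev m x|)
      ≤ gibbsMean p (β + t / √N) h (fun x : Fin N → Fin q => K * δ * sqDev m x
          + K * q * N * farIndicator m δ (magnetization x)) := gibbsMean_mono fun x => ?_
    _ = K * δ * gibbsMean p (β + t / √N) h (fun x : Fin N → Fin q => sqDev m x)
        + K * q * (N * gibbsMean p (β + t / √N) h
          (fun x : Fin N → Fin q => farIndicator m δ (magnetization x))) := by
        rw [gibbsMean_add, gibbsMean_const_mul, gibbsMean_const_mul, mul_assoc (K * q)]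
    _ ≤ K * δ * B + K * q * (N * gibbsMean p (β + t / √N) h
          (fun x : Fin N → Fin q => farIndicator m δ (magnetization x))) := by gcongr
    _ < ε / 2 + ε / 2 := by
        refine add_lt_add_of_le_of_lt ?_ hNfar
        rw [hδ]
        have : K * B ≤ K * B + 1 := by linarith
        calc K * (ε / (2 * (K * B + 1))) * B = ε / 2 * (K * B / (K * B + 1)) := by field_simp
          _ ≤ ε / 2 * 1 := by
              gcongr
              exact div_le_one_of_le₀ this (by positivity)
          _ = ε / 2 := mul_one _
    _ = ε := add_halves ε
  set d : Fin q → ℝ := fun r => magnetization x r - m r with hd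
  have hdev : ∀ r, scaledDev m x r = √N * d r := fun _ => rfl
  have hsum : ∑ r, p * m r ^ (p - 1) * d r = 0 := by
    have : ∑ r, d r = 0 := by
      rw [hd, Finset.sum_sub_distrib, sum_magnetization, H.mem.2, sub_self]
    calc ∑ r, p * m r ^ (p - 1) * d r = ∑ r, p * m 0 ^ (p - 1) * d r :=
          Finset.sum_congr rfl fun r _ => by rw [hunif r]
      _ = 0 := by rw [← Finset.mul_sum, this, mul_zero]
  have hsq : p * (p - 1) / 2 * m 0 ^ (p - 2) * sqDev m x
      = N * ∑ r, p * (p - 1) / 2 * m r ^ (p - 2) * d r ^ 2 := by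
    rw [sqDev, Finset.mul_sum, Finset.mul_sum]
    refine Finset.sum_congr rfl fun r _ => ?_
    rw [hdev, mul_pow, Real.sq_sqrt hNr, hunif r]
    ring
  have h1 := hexp m H.mem N x
  rw [hsum, sub_zero] at h1
  rw [hsq, ← mul_sub, abs_mul, abs_of_nonneg hNr]
  -- For each color, N |d|³ = |d| w², which is at most δ w² when |d| ≤ δ; otherwise it is at most N,
  -- charged to the far set.
  have h2 : N * ∑ r, |d r| ^ 3 ≤ δ * sqDev m x
      + q * N * farIndicator m δ (magnetization x) := by
    have h3 : ∀ r, N * |d r| ^ 3 ≤ δ * scaledDev m x r ^ 2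
        + N * farIndicator m δ (magnetization x) := by
      intro r
      have h4 : N * |d r| ^ 3 = |d r| * scaledDev m x r ^ 2 := by
        rw [hdev, mul_pow, Real.sq_sqrt hNr, pow_succ, sq_abs]
        ring
      rcases le_total δ |d r| with h5 | h5
      · rw [farIndicator_of_le r h5, mul_one]
        have h6 : |d r| ^ 3 ≤ 1 :=
          pow_le_one₀ (abs_nonneg _) (abs_magnetization_sub_le_one H.mem x r)
        nlinarith [mul_nonneg hδ0.le (sq_nonneg (scaledDev m x r)), mul_le_mul_of_nonneg_left h6 hNr]
      · rw [h4]
        have := farIndicator_nonneg m δ (magnetization x)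
        nlinarith [mul_le_mul_of_nonneg_right h5 (sq_nonneg (scaledDev m x r)),
          mul_nonneg hNr this]
    calc N * ∑ r, |d r| ^ 3 = ∑ r, N * |d r| ^ 3 := Finset.mul_sum _ _ _
      _ ≤ ∑ r, (δ * scaledDev m x r ^ 2 + N * farIndicator m δ (magnetization x)) :=
          Finset.sum_le_sum fun r _ => h3 r
      _ = _ := by
          rw [Finset.sum_add_distrib, ← Finset.mul_sum, Finset.sum_const, Finset.card_univ,
            Fintype.card_fin, nsmul_eq_mul, sqDev]
          ring
  calc N * |_| ≤ N * (K * ∑ r, |d r| ^ 3) := by gcongr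
    _ = K * (N * ∑ r, |d r| ^ 3) := by ring
    _ ≤ K * (δ * sqDev m x + q * N * farIndicator m δ (magnetization x)) := by gcongr
    _ = _ := by ring

end Expansion

/-! ### The estimator in a positive field -/

section FieldPos

variable {p q : ℕ} [NeZero q] {β h : ℝ} {m : Fin q → ℝ}

/-- Half-open intervals form a π-system containing arbitrarily small neighborhoods of each point,
and their masses are differences of distribution functions. Convergence is assumed at every
threshold, so continuity points need not be singled out. -/
lemma tendstoInDistribution_of_tendsto_Iic {Y : (N : ℕ) → (Fin N → Fin q) → ℝ} {μ : Measure ℝ}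
    [IsProbabilityMeasure μ]
    (hY : ∀ t, Tendsto (fun N => (pottsMeasure p q N β h).real {x | Y N x ≤ t}) atTop
      (𝓝 (μ.real (Set.Iic t)))) :
    TendstoInDistribution Y atTop (id : ℝ → ℝ) (fun N => pottsMeasure p q N β h) μ := by
  refine ⟨fun N => (measurable_of_config _).aemeasurable, aemeasurable_id, ?_⟩
  refine (isPiSystem_Ioc (id : ℝ → ℝ) id).tendsto_probabilityMeasure_of_tendsto_of_mem ?_ ?_ ?_
  · rintro s ⟨l, u, -, rfl⟩
    exact measurableSet_Ioc
  · intro u hu x hx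
    obtain ⟨ε, hε, hball⟩ := Metric.isOpen_iff.mp hu x hx
    refine ⟨Set.Ioc (x - ε / 2) (x + ε / 2), ⟨x - ε / 2, x + ε / 2, by simp only [id]; linarith, rfl⟩,
      Ioc_mem_nhds (by linarith) (by linarith), fun y hy => hball ?_⟩
    rw [Metric.mem_ball, Real.dist_eq, abs_lt]
    constructor <;> linarith [hy.1, hy.2]
  · rintro s ⟨l, u, hlu, rfl⟩
    simp only [id] at hlu ⊢
    have hsplit : ∀ ν : Measure ℝ, IsFiniteMeasure ν →
        ν.real (Set.Ioc l u) = ν.real (Set.Iic u) - ν.real (Set.Iic l) := fun ν _ => by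
      rw [← Set.Iic_sdiff_Iic, measureReal_sdiff (Set.Iic_subset_Iic.mpr hlu.le) measurableSet_Iic]
    rw [← NNReal.tendsto_coe]
    change Tendsto (fun N => ((pottsMeasure p q N β h).map (Y N)).real (Set.Ioc l u)) atTop
      (𝓝 ((μ.map (fun x => x)).real (Set.Ioc l u)))
    rw [Measure.map_id', hsplit _ inferInstance]
    refine ((hY u).sub (hY l)).congr fun N => ?_
    have := Measure.isProbabilityMeasure_map (μ := pottsMeasure p q N β h)
      (measurable_of_config (Y N)).aemeasurable
    rw [hsplit _ inferInstance, map_measureReal_apply (measurable_of_config _) measurableSet_Iic,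
      map_measureReal_apply (measurable_of_config _) measurableSet_Iic]
    rfl

lemma one_ne_zero_color (hq : 2 ≤ q) : (1 : Fin q) ≠ 0 := by
  rw [Ne, Fin.ext_iff, Fin.val_one', Fin.val_zero, Nat.mod_eq_of_lt hq]
  exact one_ne_zero

/-- Subtracting the constant F 1 leaves only the color 0. In a positive field every coefficient
vector attached to m has this shape, so sums over colors reduce to one term. -/
lemma sum_mul_of_sum_eq_zero {F z : Fin q → ℝ} (hF : ∀ r, r ≠ 0 → F r = F 1)
    (hz : ∑ r, z r = 0) : ∑ r, F r * z r = (F 0 - F 1) * z 0 := by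
  have h1 : ∑ r, F r * z r = ∑ r, (F r - F 1) * z r := by
    simp only [sub_mul, Finset.sum_sub_distrib]
    rw [← Finset.mul_sum, hz, mul_zero, sub_zero]
  rw [h1, Finset.sum_eq_single 0 (fun r _ hr => by rw [hF r hr, sub_self, zero_mul]) (by simp)]

/-- The contrast `(q - 1, -1, …, -1)`. -/
def contrast (q : ℕ) [NeZero q] (r : Fin q) : ℝ := if r = 0 then (q : ℝ) - 1 else -1

lemma sum_contrast : ∑ r, contrast q r = 0 := by
  have : ∀ r : Fin q, contrast q r = (if r = 0 then (q : ℝ) else 0) - 1 := fun r => by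
    unfold contrast
    split_ifs <;> ring
  simp [this]

/-- The quadratic form evaluated at the contrast vector. The quantity is a positive multiple of f''
at s, so this is what makes the limiting variance positive. -/
lemma IsRegularMaximizer.contrast_neg (hp : 2 ≤ p) (hq : 2 ≤ q) (H : IsRegularMaximizer p β h m)
    (hh : 0 < h) : ((q : ℝ) - 1) * curvature p β (m 0) + curvature p β (m 1) < 0 := by
  have h10 := one_ne_zero_color hq
  have hq1 : (0 : ℝ) < q - 1 := by
    have : (2 : ℝ) ≤ q := by exact_mod_cast hq
    linarith
  have h1 := H.neg (contrast q) sum_contrast fun h0 => by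
    simpa [contrast, hq1.ne'] using congrFun h0 0
  have h2 : quadForm p β m (contrast q)
      = (((q : ℝ) - 1) * curvature p β (m 0) + curvature p β (m 1)) * (q - 1) := by
    rw [quadForm_eq]
    calc ∑ r, curvature p β (m r) * contrast q r ^ 2
        = ∑ r, (curvature p β (m r) * contrast q r) * contrast q r :=
          Finset.sum_congr rfl fun r _ => by ring
      _ = _ := by
          rw [sum_mul_of_sum_eq_zero (fun r hr => ?_) sum_contrast]
          · simp only [contrast, if_true, h10, if_false]
            ring
          · simp only [contrast, hr, h10, if_false, H.eq_of_ne_zero hp hh hr h10]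
  rw [h2] at h1
  exact neg_of_mul_neg_left h1 hq1.le

lemma limitVarBeta_eq (hp : 2 ≤ p) (hq : 2 ≤ q) (β h : ℝ) {s : ℝ} (hs0 : 0 ≤ s) (hs1 : s < 1)
    (hm : m = xvec q s) :
    limitVarBeta p β h s m = -(((q : ℝ) - 1) * curvature p β (m 0) + curvature p β (m 1))
      / (p ^ 2 * (q - 1) * (m 0 ^ (p - 1) - m 1 ^ (p - 1)) ^ 2) := by
  have hq1 : (0 : ℝ) < q - 1 := by
    have : (2 : ℝ) ≤ q := by exact_mod_cast hq
    linarith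
  have hq0 : (q : ℝ) ≠ 0 := by linarith
  rw [limitVarBeta, iteratedDeriv_two_freeEnergyLine hp hq β h hs0 hs1]
  have h0 : m 0 = (1 + ((q : ℝ) - 1) * s) / q := by rw [hm, xvec, if_pos rfl]
  have h1 : m 1 = (1 - s) / q := by rw [hm, xvec, if_neg (one_ne_zero_color hq)]
  rw [← h0, ← h1, ← div_eq_mul_inv, div_div]
  generalize curvature p β (m 0) = a
  generalize curvature p β (m 1) = b
  generalize (m 0 ^ (p - 1) - m 1 ^ (p - 1)) ^ 2 = c
  -- If c vanishes, both sides are 0 by the convention for division by zero.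
  rcases eq_or_ne c 0 with rfl | hc
  · simp
  have hp0 : (p : ℝ) ≠ 0 := by
    have : p ≠ 0 := by omega
    exact_mod_cast this
  field_simp

/-- Multiplication by V carries N(0, 1/V) to N(0, V). This inverts the variance when passing from
the sufficient statistic to the estimator. -/
lemma gaussianReal_real_Iic_mul {V : ℝ} (hV : 0 < V) (t : ℝ) :
    (gaussianReal 0 V⁻¹.toNNReal).real (Set.Iic (t * V⁻¹))
      = (gaussianReal 0 V.toNNReal).real (Set.Iic t) := by
  have h1 : (gaussianReal 0 V⁻¹.toNNReal).map (V * ·) = gaussianReal 0 V.toNNReal := by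
    rw [gaussianReal_map_const_mul, mul_zero]
    congr 1
    ext
    push_cast
    rw [Real.coe_toNNReal _ hV.le, Real.coe_toNNReal _ (inv_pos.mpr hV).le]
    change V ^ 2 * V⁻¹ = V
    field_simp
  rw [← h1, map_measureReal_apply (by fun_prop) measurableSet_Iic]
  congr 1
  ext y
  simp only [Set.mem_Iic, Set.mem_preimage]
  rw [← div_eq_mul_inv, le_div_iff₀ hV, mul_comm]

/-- The rescaled sufficient statistic is asymptotically l·w. Its limiting variance and the
derivative in t of its limiting mean under β + t/√N are the same number u·l = 1/V, the Fisher
information in the limit. -/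
theorem tendstoInDistribution_estimator_field_pos (hp : 2 ≤ p) (hq : 2 ≤ q)
    (H : IsRegularMaximizer p β h m) (hh : 0 < h) {βhat : (N : ℕ) → (Fin N → Fin q) → ℝ}
    (hβhat : IsMLEstimatorBeta p q h βhat) {V : ℝ}
    (hV : V = -(((q : ℝ) - 1) * curvature p β (m 0) + curvature p β (m 1))
      / (p ^ 2 * (q - 1) * (m 0 ^ (p - 1) - m 1 ^ (p - 1)) ^ 2)) :
    0 < V ∧ TendstoInDistribution
      (fun (N : ℕ) (x : Fin N → Fin q) => √N * (βhat N x - β)) atTop (id : ℝ → ℝ)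
      (fun N => pottsMeasure p q N β h) (gaussianReal 0 V.toNNReal) := by
  have h10 := one_ne_zero_color hq
  have hq1 : (0 : ℝ) < q - 1 := by
    have : (2 : ℝ) ≤ q := by exact_mod_cast hq
    linarith
  have hp0 : (0 : ℝ) < p := by
    have : 0 < p := by omega
    exact_mod_cast this
  set D := ((q : ℝ) - 1) * curvature p β (m 0) + curvature p β (m 1) with hD
  have hD0 : D < 0 := H.contrast_neg hp hq hh
  set Δ := m 0 ^ (p - 1) - m 1 ^ (p - 1) with hΔ
  have hΔ0 : 0 < Δ := sub_pos.mpr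
    (pow_lt_pow_left₀ (H.lt_of_field_pos hp hh h10) (H.mem.1 1) (by omega))
  have hV0 : 0 < V := by
    rw [hV]
    exact div_pos (neg_pos.mpr hD0) (by positivity)
  refine ⟨hV0, tendstoInDistribution_of_tendsto_Iic fun t => ?_⟩
  rw [← gaussianReal_real_Iic_mul hV0]
  set l : Fin q → ℝ := fun r => p * m r ^ (p - 1) with hl
  -- Both l and the curvatures are constant off the color 0, so the dual vector of l is a multiple
  -- of the contrast. The factor is fixed by comparing the coefficients of w_0.
  set u : Fin q → ℝ := fun r => -(p * Δ / D) * contrast q r with hu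
  have hm1 : ∀ r, r ≠ 0 → m r = m 1 := fun r hr => H.eq_of_ne_zero hp hh hr h10
  have hl1 : ∀ r, r ≠ 0 → l r = l 1 := fun r hr => by simp only [hl, hm1 r hr]
  have hlΔ : l 0 - l 1 = p * Δ := by simp only [hl, hΔ]; ring
  have hu0 : ∑ r, u r = 0 := by rw [hu, ← Finset.mul_sum, sum_contrast, mul_zero]
  have hc0 : contrast q 0 = q - 1 := by simp [contrast]
  have hc1 : ∀ r, r ≠ 0 → contrast q r = -1 := fun r hr => by simp [contrast, hr]
  have hL : ∀ w : Fin q → ℝ, ∑ r, w r = 0 →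
      ∑ r, l r * w r = -∑ r, u r * curvature p β (m r) * w r := by
    intro w hw
    rw [sum_mul_of_sum_eq_zero hl1 hw,
      sum_mul_of_sum_eq_zero (fun r hr => by simp only [hu, hc1 r hr, hc1 1 h10, hm1 r hr]) hw, hlΔ]
    simp only [hu, hc0, hc1 1 h10]
    have : -(p * Δ / D) * (q - 1) * curvature p β (m 0) - -(p * Δ / D) * -1 * curvature p β (m 1)
        = -(p * Δ / D) * D := by rw [hD]; ring
    rw [this, neg_mul, div_mul_cancel₀ _ hD0.ne]
    ring
  have hul : ∑ r, u r * l r = V⁻¹ := by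
    calc ∑ r, u r * l r = ∑ r, l r * u r := Finset.sum_congr rfl fun r _ => mul_comm _ _
      _ = V⁻¹ := by
        rw [sum_mul_of_sum_eq_zero hl1 hu0, hlΔ, hV]
        simp only [hu, hc0]
        rw [inv_div, div_neg]
        ring
  have hlin : ∀ t : ℝ, Tendsto (fun N : ℕ => gibbsMean p (β + t / √N) h (fun x : Fin N → Fin q =>
      |√N * (powerSum p x - ∑ r, m r ^ p) - ∑ r, l r * scaledDev m x r|)) atTop (𝓝 0) :=
    tendsto_gibbsMean_powerSum_linear hp H
  refine tendsto_pottsMeasure_estimator_le hp hq H hβhat (a := fun N => √N) (T := ∑ r, m r ^ p)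
    (fun N hN => Real.sqrt_pos.mpr (Nat.cast_pos.mpr hN)) (fun c => ?_) (fun s => ?_) ?_
  · have := nullSingletonClass_gaussianReal (μ := 0) (v := V⁻¹.toNNReal)
      (Real.toNNReal_pos.mpr (inv_pos.mpr hV0)).ne'
    exact measure_singleton c
  · have h1 := tendsto_gibbsMean_devChar hp H hu0 hL s
    have h2 := hlin 0
    simp only [zero_div, add_zero] at h2
    rw [hul] at h1
    rw [charFun_gaussianReal, Real.coe_toNNReal _ (inv_pos.mpr hV0).le]
    have h3 := tendsto_gibbsMean_exp_of_sub h1 h2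
    simpa using h3
  · have h1 : Tendsto (fun N : ℕ => gibbsMean p (β + t / √N) h (fun x : Fin N → Fin q =>
        √N * (powerSum p x - ∑ r, m r ^ p) - ∑ r, l r * scaledDev m x r)) atTop (𝓝 0) :=
      squeeze_zero_norm (fun N => norm_gibbsMean_le fun x => le_rfl) (hlin t)
    have h2 := (tendsto_gibbsMean_linear hp H t hu0).neg
    -- The mean shifts at rate u·l, the same pairing as in the limiting variance.
    have h3 : t * p * ∑ r, u r * m r ^ (p - 1) = t * V⁻¹ := by
      rw [← hul, mul_assoc, Finset.mul_sum]
      congr 1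
      exact Finset.sum_congr rfl fun r _ => by simp only [hl]; ring
    rw [neg_neg, h3] at h2
    have h4 := h1.add h2
    rw [zero_add] at h4
    refine h4.congr' ?_
    filter_upwards [eventually_gt_atTop 0] with N hN
    have : NeZero N := ⟨hN.ne'⟩
    rw [gibbsMean_sub, ← sub_eq_add_neg, sub_sub, ← gibbsMean_add]
    simp only [hL _ (sum_scaledDev H.mem.2 _), neg_add_cancel, gibbsMean_const, sub_zero]

end FieldPos

/-! ### The Gaussian law with covariance proportional to the centering matrix -/

section Centering

open scoped Matrix MatrixOrder

/-- The orthogonal projection onto the vectors with coordinate sum zero. -/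
def centeringMatrix (q : ℕ) : Matrix (Fin q) (Fin q) ℝ :=
  Matrix.of fun i j => (if i = j then 1 else 0) - (q : ℝ)⁻¹

lemma centeringMatrix_mulVec {q : ℕ} (x : Fin q → ℝ) (r : Fin q) :
    (centeringMatrix q *ᵥ x) r = x r - (∑ i, x i) / q := by
  simp only [Matrix.mulVec, dotProduct, centeringMatrix, Matrix.of_apply, sub_mul, ite_mul, one_mul,
    zero_mul, Finset.sum_sub_distrib, Finset.sum_ite_eq, Finset.mem_univ, if_true]
  rw [← Finset.mul_sum, div_eq_inv_mul]

lemma sum_centered {q : ℕ} [NeZero q] (x : Fin q → ℝ) : ∑ r, (x r - (∑ i, x i) / q) = 0 := by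
  have hq : (q : ℝ) ≠ 0 := Nat.cast_ne_zero.mpr (NeZero.ne q)
  rw [Finset.sum_sub_distrib, Finset.sum_const, Finset.card_univ, Fintype.card_fin, nsmul_eq_mul,
    mul_div_cancel₀ _ hq, sub_self]

lemma centeringMatrix_mul_self (q : ℕ) [NeZero q] :
    centeringMatrix q * centeringMatrix q = centeringMatrix q := by
  refine Matrix.toLin'.injective (LinearMap.ext fun x => ?_)
  simp only [Matrix.toLin'_apply, ← Matrix.mulVec_mulVec]
  ext r
  have h1 : ∑ i, (centeringMatrix q *ᵥ x) i = 0 := by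
    simp only [centeringMatrix_mulVec]
    exact sum_centered x
  rw [centeringMatrix_mulVec, h1, zero_div, sub_zero]

lemma centeringMatrix_conjTranspose (q : ℕ) : (centeringMatrix q)ᴴ = centeringMatrix q := by
  ext i j
  simp [centeringMatrix, eq_comm]

lemma posSemidef_centeringMatrix (q : ℕ) [NeZero q] : (centeringMatrix q).PosSemidef := by
  have h1 := Matrix.posSemidef_conjTranspose_mul_self (centeringMatrix q)
  rwa [centeringMatrix_conjTranspose, centeringMatrix_mul_self] at h1

lemma dotProduct_centeringMatrix_mulVec {q : ℕ} (x : Fin q → ℝ) :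
    x ⬝ᵥ centeringMatrix q *ᵥ x = ∑ r, (x r - (∑ i, x i) / q) * x r := by
  rw [dotProduct_comm, dotProduct]
  simp only [centeringMatrix_mulVec]

/-- A positive semidefinite projection is its own square root. The Gaussian law thus becomes an
explicit linear image of independent normals. -/
lemma sqrt_smul_centeringMatrix {q : ℕ} [NeZero q] {v : ℝ} (hv : 0 ≤ v) :
    CFC.sqrt (v • centeringMatrix q) = √v • centeringMatrix q := by
  refine CFC.sqrt_unique ?_ ((posSemidef_centeringMatrix q).smul (Real.sqrt_nonneg v)).nonneg
  rw [smul_mul_smul_comm, centeringMatrix_mul_self, Real.mul_self_sqrt hv]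

lemma multivariateGaussian_smul_centeringMatrix {q : ℕ} [NeZero q] {v : ℝ} (hv : 0 ≤ v) :
    multivariateGaussian 0 (v • centeringMatrix q)
      = (Measure.pi fun _ : Fin q => gaussianReal 0 1).map
        (fun x => WithLp.toLp 2 fun r => √v * (x r - (∑ i, x i) / q)) := by
  rw [multivariateGaussian, sqrt_smul_centeringMatrix hv, ← map_pi_eq_stdGaussian,
    Measure.map_map (by fun_prop) (by fun_prop)]
  congr 1
  ext x r
  simp [centeringMatrix_mulVec]

/-- With the other coordinates fixed, the equation is quadratic in the first coordinate with nonzero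
leading coefficient, since q ≥ 2. It has finitely many roots, and Fubini's theorem concludes. -/
lemma pi_gaussianReal_sum_sq_centered_eq {q : ℕ} (hq : 2 ≤ q) (c : ℝ) :
    (Measure.pi fun _ : Fin q => gaussianReal 0 1)
      {x | ∑ r, (x r - (∑ i, x i) / q) ^ 2 = c} = 0 := by
  obtain ⟨n, rfl⟩ := Nat.exists_eq_add_of_le' (show 1 ≤ q by omega)
  set B : Set (ℝ × (Fin n → ℝ)) := {y | (y.1 - (y.1 + ∑ i, y.2 i) / (n + 1 : ℕ)) ^ 2
    + ∑ r, (y.2 r - (y.1 + ∑ i, y.2 i) / (n + 1 : ℕ)) ^ 2 = c} with hB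
  have hBm : MeasurableSet B := measurableSet_eq_fun (by fun_prop) (by fun_prop)
  have hpre : {x : Fin (n + 1) → ℝ | ∑ r, (x r - (∑ i, x i) / (n + 1 : ℕ)) ^ 2 = c}
      = MeasurableEquiv.piFinSuccAbove (fun _ => ℝ) 0 ⁻¹' B := by
    ext x
    simp [hB, Fin.sum_univ_succ, MeasurableEquiv.piFinSuccAbove, Fin.insertNthEquiv, Fin.tail]
  rw [hpre, (measurePreserving_piFinSuccAbove (fun _ : Fin (n + 1) => gaussianReal 0 1)
    0).measure_preimage hBm.nullMeasurableSet, Measure.prod_apply_symm hBm]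
  have hnull : NullSingletonClass (gaussianReal 0 1) := nullSingletonClass_gaussianReal one_ne_zero
  refine lintegral_eq_zero_of_ae_eq_zero (Eventually.of_forall fun z => ?_)
  have hn : (0 : ℝ) < n := Nat.cast_pos.mpr (by omega)
  set σ := ∑ i, z i with hσ
  -- This is a² + ∑ᵣ zᵣ² - (a + σ)²/(n + 1) - c as a polynomial in the first coordinate a.
  set P : Polynomial ℝ := Polynomial.C ((n : ℝ) / (n + 1)) * Polynomial.X ^ 2
    + Polynomial.C (-(2 * σ / (n + 1))) * Polynomial.X
    + Polynomial.C (∑ r, z r ^ 2 - σ ^ 2 / (n + 1) - c) with hP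
  have hP0 : P ≠ 0 := by
    intro h0
    have := Polynomial.natDegree_quadratic (R := ℝ) (a := (n : ℝ) / (n + 1))
      (b := -(2 * σ / (n + 1))) (c := ∑ r, z r ^ 2 - σ ^ 2 / (n + 1) - c) (by positivity)
    rw [← hP, h0, Polynomial.natDegree_zero] at this
    omega
  refine Set.Finite.measure_zero ((Polynomial.finite_setOfPred_isRoot hP0).subset fun a ha => ?_) _
  simp only [hB, Set.mem_preimage, Set.mem_ofPred_eq] at ha
  rw [Set.mem_ofPred_eq, Polynomial.IsRoot, hP]
  simp only [Polynomial.eval_add, Polynomial.eval_mul, Polynomial.eval_C, Polynomial.eval_pow,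
    Polynomial.eval_X]
  have hn1 : ((n : ℝ) + 1) ≠ 0 := by positivity
  set e := (a + σ) / (n + 1) with he
  have h1 : ∑ r, (z r - (a + σ) / (n + 1 : ℕ)) ^ 2 = ∑ r, z r ^ 2 - 2 * e * σ + n * e ^ 2 := by
    push_cast
    rw [← he]
    calc ∑ r, (z r - e) ^ 2 = ∑ r, (z r ^ 2 - 2 * e * z r + e ^ 2) :=
          Finset.sum_congr rfl fun r _ => by ring
      _ = _ := by
          rw [Finset.sum_add_distrib, Finset.sum_sub_distrib, ← Finset.mul_sum, ← hσ]
          simp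
  rw [h1] at ha
  push_cast at ha
  rw [← he] at ha
  rw [← ha, he]
  field_simp
  ring

lemma multivariateGaussian_sum_sq_eq {q : ℕ} [NeZero q] (hq : 2 ≤ q) {v : ℝ} (hv : 0 < v) (c : ℝ) :
    multivariateGaussian 0 (v • centeringMatrix q)
      {w : EuclideanSpace ℝ (Fin q) | ∑ r, w r ^ 2 = c} = 0 := by
  rw [multivariateGaussian_smul_centeringMatrix hv.le, Measure.map_apply (by fun_prop)
    (measurableSet_eq_fun (by fun_prop) (by fun_prop))]
  refine measure_mono_null (fun x hx => ?_) (pi_gaussianReal_sum_sq_centered_eq hq (c / v))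
  simp only [Set.mem_preimage, Set.mem_ofPred_eq, mul_pow, Real.sq_sqrt hv.le] at hx ⊢
  rw [← hx, ← Finset.mul_sum, mul_div_cancel_left₀ _ hv.ne']

end Centering

/-! ### The limiting law of the fluctuations in zero field -/

section Uniform

variable {p q : ℕ} [NeZero q] {β h : ℝ} {m : Fin q → ℝ}

/-- At s = 0 the two arguments of the ratio coincide, so ρ = 1 and A is q times the centering
projection. The scalar combines with this q to give -1/k''(1/q). -/
lemma limitCov_eq (hp : 2 ≤ p) (hq : 2 ≤ q) (hd : curvature p β (1 / (q : ℝ)) ≠ 0) (h : ℝ) :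
    limitCov p q β h 0 = (-curvature p β (1 / (q : ℝ)))⁻¹ • centeringMatrix q := by
  have hq1 : (0 : ℝ) < q - 1 := by
    have : (2 : ℝ) ≤ q := by exact_mod_cast hq
    linarith
  have hq0 : (0 : ℝ) < q := by linarith
  have hratio : kratio p q β 0 = 1 := by
    rw [kratio, mul_zero, add_zero, sub_zero, iteratedDeriv_two_kfun hp β (by positivity),
      div_self hd]
  rw [limitCov, iteratedDeriv_two_freeEnergyLine hp hq β h le_rfl one_pos, hratio, mul_zero,
    add_zero, sub_zero]
  generalize curvature p β (1 / (q : ℝ)) = d at hd ⊢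
  have hscal : (-((q : ℝ) ^ 2 / (q - 1)) * ((q - 1) / q ^ 2 * ((q - 1) * d + d)))⁻¹
      = (-d)⁻¹ * (q : ℝ)⁻¹ := by
    rw [← mul_inv]
    congr 1
    field_simp
    ring
  rw [hscal, mul_smul]
  congr 1
  ext i j
  simp only [centeringMatrix, Matrix.smul_apply, Matrix.of_apply, smul_eq_mul]
  rcases eq_or_ne i j with rfl | hij
  · rcases eq_or_ne i 0 with rfl | hi
    · simp only [and_self, if_true]
      field_simp
    · simp only [hi, and_self, or_self, if_false, if_true]
      field_simp
      ring
  · have h1 : ¬ (i = 0 ∧ j = 0) := fun h0 => hij (h0.1.trans h0.2.symm)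
    simp only [h1, hij, if_false, ite_self]
    ring

lemma IsRegularMaximizer.curvature_neg (hq : 2 ≤ q) (H : IsRegularMaximizer p β h m)
    (hunif : ∀ r, m r = 1 / q) : curvature p β (1 / (q : ℝ)) < 0 := by
  have h1 := H.curvature_add_neg (one_ne_zero_color hq)
  rw [hunif, hunif] at h1
  linarith

/-- At a uniform maximizer, `√N (X̄_N - m)` is asymptotically Gaussian. -/
lemma tendsto_statLaw_scaledDev (hp : 2 ≤ p) (hq : 2 ≤ q) (H : IsRegularMaximizer p β h m)
    (hunif : ∀ r, m r = 1 / q) {ν : ProbabilityMeasure (EuclideanSpace ℝ (Fin q))}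
    (hν : (ν : Measure (EuclideanSpace ℝ (Fin q)))
      = multivariateGaussian 0 ((-curvature p β (1 / (q : ℝ)))⁻¹ • centeringMatrix q)) :
    Tendsto (fun N => statLaw p β h (fun x : Fin N → Fin q => WithLp.toLp 2 (scaledDev m x))) atTop
      (𝓝 ν) := by
  have hd := H.curvature_neg hq hunif
  set d := curvature p β (1 / (q : ℝ)) with hd_def
  refine ProbabilityMeasure.tendsto_of_tendsto_charFun fun t => ?_
  rw [hν, charFun_multivariateGaussian
    ((posSemidef_centeringMatrix q).smul (inv_pos.mpr (neg_pos.mpr hd)).le)]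
  simp only [charFun_statLaw]
  -- The limiting covariance applied to t. Dividing by -d inverts the Hessian, and the subtracted
  -- average is invisible to vectors with coordinate sum zero.
  set u : Fin q → ℝ := fun r => (-d)⁻¹ * (t r - (∑ i, t i) / q) with hu
  have hu0 : ∑ r, u r = 0 := by rw [hu, ← Finset.mul_sum, sum_centered, mul_zero]
  have hd0 : d ≠ 0 := hd.ne
  have hL : ∀ w : Fin q → ℝ, ∑ r, w r = 0 →
      ∑ r, t r * w r = -∑ r, u r * curvature p β (m r) * w r := by
    intro w hw
    have h1 : ∀ r, u r * curvature p β (m r) * w r = (∑ i, t i) / q * w r - t r * w r := fun r => by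
      rw [hunif r, ← hd_def, hu, inv_neg]
      field_simp
      ring
    simp only [h1, Finset.sum_sub_distrib]
    rw [← Finset.mul_sum, hw]
    ring
  have h1 := tendsto_gibbsMean_devChar hp H hu0 hL 1
  have h2 : ∑ r, u r * t r = t ⬝ᵥ Matrix.mulVec ((-d)⁻¹ • centeringMatrix q) t := by
    rw [Matrix.smul_mulVec, dotProduct_smul, dotProduct_centeringMatrix_mulVec, smul_eq_mul,
      Finset.mul_sum]
    exact Finset.sum_congr rfl fun r _ => by rw [hu, mul_assoc]
  have h3 : ∀ N, ∀ x : Fin N → Fin q, devChar m t 1 x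
      = Complex.exp (inner ℝ (WithLp.toLp 2 (scaledDev m x)) t * Complex.I) := fun N x => by
    rw [devChar, one_mul, mul_comm, PiLp.inner_apply]
    simp
  simp only [h3, h2] at h1
  convert h1 using 2
  simp

/-- The characteristic function of a multiple of `∑ᵣ wᵣ²` for the fluctuations `w` at a uniform
maximizer. -/
lemma tendsto_gibbsMean_exp_sqDev (hp : 2 ≤ p) (hq : 2 ≤ q) (H : IsRegularMaximizer p β h m)
    (hunif : ∀ r, m r = 1 / q) (c s : ℝ) :
    Tendsto (fun N => gibbsMean p β h (fun x : Fin N → Fin q =>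
      Complex.exp (Complex.I * ((s * (c * sqDev m x) : ℝ) : ℂ)))) atTop
      (𝓝 (charFun ((multivariateGaussian 0
        ((-curvature p β (1 / (q : ℝ)))⁻¹ • centeringMatrix q)).map
          (fun w => c * ∑ r, w r ^ 2)) s)) := by
  obtain ⟨ν, hν⟩ : ∃ ν : ProbabilityMeasure (EuclideanSpace ℝ (Fin q)),
      (ν : Measure (EuclideanSpace ℝ (Fin q)))
        = multivariateGaussian 0 ((-curvature p β (1 / (q : ℝ)))⁻¹ • centeringMatrix q) :=
    ⟨⟨multivariateGaussian 0 ((-curvature p β (1 / (q : ℝ)))⁻¹ • centeringMatrix q),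
      inferInstance⟩, rfl⟩
  have hcont : Continuous fun w : EuclideanSpace ℝ (Fin q) => c * ∑ r, w r ^ 2 := by fun_prop
  have h1 := ProbabilityMeasure.tendsto_map_of_tendsto_of_continuous _ _
    (tendsto_statLaw_scaledDev hp hq H hunif hν) hcont
  have h2 := ProbabilityMeasure.tendsto_iff_tendsto_charFun.mp h1 s
  simp only [ProbabilityMeasure.toMeasure_map, hν] at h2
  refine h2.congr fun N => ?_
  rw [← charFun_statLaw_real]
  congr 1
  exact Measure.map_map hcont.measurable (measurable_of_config _)

/-- At a uniform maximizer, the distribution functions of `√N (β̂_N - β)` converge to a constant. -/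
lemma tendsto_pottsMeasure_estimator_le_of_uniform (hp : 2 ≤ p) (hq : 2 ≤ q)
    (H : IsRegularMaximizer p β h m) (hunif : ∀ r, m r = 1 / q)
    {βhat : (N : ℕ) → (Fin N → Fin q) → ℝ} (hβhat : IsMLEstimatorBeta p q h βhat) (t : ℝ) :
    Tendsto (fun N => (pottsMeasure p q N β h).real {x | √N * (βhat N x - β) ≤ t}) atTop
      (𝓝 (gammaOne p q β).toReal) := by
  have hd := H.curvature_neg hq hunif
  have hq0 : (0 : ℝ) < q := Nat.cast_pos.mpr (by omega)
  set S := (-curvature p β (1 / (q : ℝ)))⁻¹ • centeringMatrix q with hS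
  set c : ℝ := p * (p - 1) / 2 * m 0 ^ (p - 2) with hc
  have hc0 : 0 < c := by
    have h1 : (2 : ℝ) ≤ p := by exact_mod_cast hp
    have h2 : (0 : ℝ) < p - 1 := by linarith
    have h3 := H.pos hp 0
    positivity
  have hmeas : Measurable fun w : EuclideanSpace ℝ (Fin q) => c * ∑ r, w r ^ 2 := by fun_prop
  set μ := (multivariateGaussian 0 S).map fun w => c * ∑ r, w r ^ 2 with hμ
  have : IsProbabilityMeasure μ := Measure.isProbabilityMeasure_map hmeas.aemeasurable
  have hm0 : ∀ r, m r = m 0 := fun r => by rw [hunif, hunif]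
  have hquad := fun t => tendsto_gibbsMean_powerSum_quadratic hp H t hm0
  have hγ : (gammaOne p q β).toReal
      = μ.real (Set.Iic (c * ((1 - q) / curvature p β (1 / (q : ℝ))))) := by
    rw [gammaOne, limitCov_eq hp hq hd.ne, iteratedDeriv_two_kfun hp β (by positivity), Measure.real,
      hμ, Measure.map_apply hmeas measurableSet_Iic]
    congr 2
    ext w
    simp [mul_le_mul_iff_right₀ hc0]
  rw [hγ]
  -- The scaling is N instead of √N because the statistic is quadratic in the fluctuations to
  -- leading order. Its limiting mean does not involve t, so neither does the limiting probability.
  refine tendsto_pottsMeasure_estimator_le hp hq H hβhat (a := fun N => N) (T := ∑ r, m r ^ p)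
    (fun N hN => Nat.cast_pos.mpr hN) (fun a => ?_) (fun s => ?_) ?_
  · rw [hμ, Measure.map_apply hmeas (measurableSet_singleton a)]
    refine measure_mono_null (fun w hw => ?_)
      (multivariateGaussian_sum_sq_eq hq (inv_pos.mpr (neg_pos.mpr hd)) (a / c))
    simp only [Set.mem_preimage, Set.mem_singleton_iff] at hw
    rw [Set.mem_ofPred_eq, eq_div_iff hc0.ne', mul_comm, hw]
  · have h2 := hquad 0
    simp only [zero_div, add_zero] at h2
    exact tendsto_gibbsMean_exp_of_sub (tendsto_gibbsMean_exp_sqDev hp hq H hunif c s) h2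
  · have h1 : Tendsto (fun N : ℕ => gibbsMean p (β + t / √N) h (fun x : Fin N → Fin q =>
        N * (powerSum p x - ∑ r, m r ^ p) - c * sqDev m x)) atTop (𝓝 0) :=
      squeeze_zero_norm (fun N => norm_gibbsMean_le fun x => le_rfl) (hquad t)
    have hd' : curvature p β (m 0) ≠ 0 := by rw [hunif]; exact hd.ne
    have h2 := (tendsto_gibbsMean_sqDev hp H t hm0 hd').const_mul c
    have h3 := h1.add h2
    rw [zero_add, hunif 0] at h3
    refine h3.congr fun N => ?_
    rw [gibbsMean_sub, gibbsMean_const_mul c, sub_add_cancel]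

end Uniform

/-! ### Escape of mass to infinity -/

section Escape

variable {p q : ℕ} [NeZero q] {β h : ℝ}

open Classical in
-- Written as a difference of two distribution-function values, to match the limits of the
-- probabilities of an upper and a lower cutoff event.
lemma degenerateLaw_real (F : Set EReal) : (degenerateLaw p q β).real F
    = (if ⊤ ∈ F then 1 else (gammaOne p q β).toReal)
      - (if ⊥ ∈ F then 0 else (gammaOne p q β).toReal) := by
  have h1 : gammaOne p q β ≤ 1 := prob_le_one
  rw [degenerateLaw, measureReal_def, Measure.add_apply, Measure.smul_apply, Measure.smul_apply,
    Measure.dirac_apply, Measure.dirac_apply]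
  by_cases ht : ⊤ ∈ F <;> by_cases hb : ⊥ ∈ F <;>
    simp [ht, hb, h1, ENNReal.toReal_sub_of_le]

/-- If all distribution functions converge to the constant `γ₁`, the mass escapes to `±∞`. -/
lemma tendstoInDistribution_degenerateLaw {Y : (N : ℕ) → (Fin N → Fin q) → ℝ}
    (hY : ∀ t, Tendsto (fun N => (pottsMeasure p q N β h).real {x | Y N x ≤ t}) atTop
      (𝓝 (gammaOne p q β).toReal)) :
    TendstoInDistribution (fun (N : ℕ) (x : Fin N → Fin q) => (Y N x : EReal)) atTop
      (id : EReal → EReal) (fun N => pottsMeasure p q N β h) (degenerateLaw p q β) := by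
  refine ⟨fun N => (measurable_of_config _).aemeasurable, aemeasurable_id, ?_⟩
  classical
  refine tendsto_of_forall_isClosed_limsup_real_le' fun F hF => ?_
  change limsup (fun N => ((pottsMeasure p q N β h).map
    fun x : Fin N → Fin q => (Y N x : EReal)).real F) atTop
      ≤ ((degenerateLaw p q β).map (fun x => x)).real F
  rw [Measure.map_id', degenerateLaw_real]
  -- A closed set that omits an infinite endpoint omits a whole neighborhood of it.
  obtain ⟨c, hc⟩ : ∃ c : ℝ, ⊥ ∉ F → ∀ y : ℝ, y < c → (y : EReal) ∉ F := by
    by_cases hb : ⊥ ∈ F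
    · exact ⟨0, fun h0 => absurd hb h0⟩
    · obtain ⟨c, hc⟩ := EReal.mem_nhds_bot_iff.mp (hF.isOpen_compl.mem_nhds hb)
      exact ⟨c, fun _ y hy => hc (Set.mem_Iio.mpr (EReal.coe_lt_coe_iff.mpr hy))⟩
  obtain ⟨e, hce, he⟩ : ∃ e : ℝ, c ≤ e ∧ (⊤ ∉ F → ∀ y : ℝ, e < y → (y : EReal) ∉ F) := by
    by_cases ht : ⊤ ∈ F
    · exact ⟨c, le_rfl, fun h0 => absurd ht h0⟩
    · obtain ⟨e, he⟩ := EReal.mem_nhds_top_iff.mp (hF.isOpen_compl.mem_nhds ht)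
      exact ⟨max c e, le_max_left _ _, fun _ y hy => he
        (Set.mem_Ioi.mpr (EReal.coe_lt_coe_iff.mpr ((le_max_right _ _).trans_lt hy)))⟩
  set A : (N : ℕ) → Set (Fin N → Fin q) := fun N =>
    if ⊤ ∈ F then Set.univ else {x | Y N x ≤ e} with hA
  -- The set F is reached only on A \ B. The threshold c - 1 is strictly below c, as needed to
  -- exclude F on B, and c ≤ e gives B ⊆ A.
  set B : (N : ℕ) → Set (Fin N → Fin q) := fun N =>
    if ⊥ ∈ F then ∅ else {x | Y N x ≤ c - 1} with hB
  have hAlim : Tendsto (fun N => (pottsMeasure p q N β h).real (A N)) atTop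
      (𝓝 (if ⊤ ∈ F then 1 else (gammaOne p q β).toReal)) := by
    by_cases ht : ⊤ ∈ F
    · simp [hA, ht]
    · simpa only [hA, ht, if_false] using hY e
  have hBlim : Tendsto (fun N => (pottsMeasure p q N β h).real (B N)) atTop
      (𝓝 (if ⊥ ∈ F then 0 else (gammaOne p q β).toReal)) := by
    by_cases hb : ⊥ ∈ F
    · simp [hB, hb]
    · simpa only [hB, hb, if_false] using hY (c - 1)
  have hBA : ∀ N, B N ⊆ A N := by
    intro N x hx
    by_cases ht : ⊤ ∈ F
    · simp [hA, ht]
    by_cases hb : ⊥ ∈ F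
    · simp [hB, hb] at hx
    simp only [hA, hB, ht, hb, if_false, Set.mem_ofPred_eq] at hx ⊢
    linarith
  have hFsub : ∀ N, (fun x : Fin N → Fin q => (Y N x : EReal)) ⁻¹' F ⊆ A N \ B N := by
    intro N x hx
    refine ⟨?_, fun hxB => ?_⟩
    · by_cases ht : ⊤ ∈ F
      · simp [hA, ht]
      · simp only [hA, ht, if_false, Set.mem_ofPred_eq]
        by_contra! hlt
        exact he ht _ hlt hx
    · by_cases hb : ⊥ ∈ F
      · simp [hB, hb] at hxB
      · simp only [hB, hb, if_false, Set.mem_ofPred_eq] at hxB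
        exact hc hb _ (by linarith) hx
  have hle : ∀ N, ((pottsMeasure p q N β h).map
      fun x : Fin N → Fin q => (Y N x : EReal)).real F
        ≤ (pottsMeasure p q N β h).real (A N) - (pottsMeasure p q N β h).real (B N) := by
    intro N
    rw [map_measureReal_apply (measurable_of_config _) hF.measurableSet,
      ← measureReal_sdiff (hBA N) (Set.toFinite _).measurableSet]
    exact measureReal_mono (hFsub N)
  have hlim := hAlim.sub hBlim
  rw [← hlim.limsup_eq]
  refine limsup_le_limsup (Eventually.of_forall hle) ?_ hlim.isBoundedUnder_le
  exact isCoboundedUnder_le_of_le atTop fun N => measureReal_nonneg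

end Escape

end CWPotts

end

theorem theorem3p3 (p q : ℕ) [NeZero q] (hp : 2 ≤ p) (hq : 2 ≤ q) (β h : ℝ)
    (hreg : CWPotts.IsRegular p q β h)
    (m : Fin q → ℝ) (hm : CWPotts.IsGlobalMaximizer p β h m)
    (βhat : (N : ℕ) → (Fin N → Fin q) → ℝ)
    (hβhat : CWPotts.IsMLEstimatorBeta p q h βhat) :
    (0 < h →
      m ≠ CWPotts.xvec q 0 ∧
      ∃ s : ℝ, 0 < s ∧ s < 1 ∧ m = CWPotts.xvec q s ∧
        0 < CWPotts.limitVarBeta p β h s m ∧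
        TendstoInDistribution
          (fun (N : ℕ) (x : Fin N → Fin q) => Real.sqrt N * (βhat N x - β))
          atTop (id : ℝ → ℝ)
          (fun N => CWPotts.pottsMeasure p q N β h)
          (gaussianReal 0 (CWPotts.limitVarBeta p β h s m).toNNReal)) ∧
    (h = 0 →
      m = CWPotts.xvec q 0 ∧
      (CWPotts.limitCov p q β 0 0).PosSemidef ∧
      TendstoInDistribution
        (fun (N : ℕ) (x : Fin N → Fin q) => ((Real.sqrt N * (βhat N x - β) : ℝ) : EReal))
        atTop (id : EReal → EReal)
        (fun N => CWPotts.pottsMeasure p q N β h)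
        (CWPotts.degenerateLaw p q β)) := by
  have H := hreg.isRegularMaximizer hm
  refine ⟨fun hh => ⟨fun h0 => ?_, ?_⟩, fun hh => ?_⟩
  · have hlt := H.lt_of_field_pos hp hh (CWPotts.one_ne_zero_color hq)
    simp [h0, CWPotts.xvec] at hlt
  · obtain ⟨s, hs0, hs1, hms⟩ := H.exists_eq_xvec hp hq hh
    exact ⟨s, hs0, hs1, hms, CWPotts.tendstoInDistribution_estimator_field_pos hp hq H hh hβhat
      (CWPotts.limitVarBeta_eq hp hq β h hs0.le hs1 hms)⟩
  · subst hh
    have hm0 := H.eq_xvec_zero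
    have hunif : ∀ r, m r = 1 / q := fun r => by simp [hm0, CWPotts.xvec]
    have hd := H.curvature_neg hq hunif
    refine ⟨hm0, ?_, CWPotts.tendstoInDistribution_degenerateLaw
      (CWPotts.tendsto_pottsMeasure_estimator_le_of_uniform hp hq H hunif hβhat)⟩
    rw [CWPotts.limitCov_eq hp hq hd.ne]
    exact (CWPotts.posSemidef_centeringMatrix q).smul (inv_pos.mpr (neg_pos.mpr hd)).le
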